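/- Let $G$ be a noncompact connected (real, finite-dimensional) Lie group with identity $e$, $\mu$ a left Haar measure on $G$, and $\delta_G$ the modular function, $\mu(Ax)=\delta_G(x)\mu(A)$. Elements of the Lie algebra $\mathfrak g$ are identified with left-invariant vector fields. Fix a scalar product on $\mathfrak g$, a subspace $\mathcal H\subseteq\mathfrak g$ which generates $\mathfrak g$ as a Lie algebra, and an orthonormal basis $X_1,\dots,X_\nu$ of $\mathcal H$. Put $\nabla_{\mathcal H}f=\sum_{j}(X_jf)X_j$ and \[ \mathcal L=-\sum_{j=1}^{\nu}(X_j^2+c_jX_j),\qquad c_j=(X_j\delta_G)(e). \] Derivatives of functions in $L^1_{\mathrm{loc}}$ are taken in the sense of distributions with respect to $\mu$ (the formal adjoint of $X_j$ in $L^2(\mu)$ is $-X_j-c_j$, and $\mathcal L$ is its own formal adjoint). The spaces $L^p$, $L^p_{\mathrm{loc}}$ are taken with respect to $\mu$, functions in $L^2$ are complex-valued, and $L^p_{\mathcal H}$, $L^p_{\mathcal H,\mathrm{loc}}$ are the corresponding spaces of sections of $\mathcal H$. Let $w$ be a positive function with $w,w^{-1}\in L^1_{\mathrm{loc}}$, and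 let $\mu_w$ be the measure with density $w$ with respect to $\mu$. Assume that \[ \nabla_{\mathcal H}w\in(\sqrt w\,L^2_{\mathcal H,\mathrm{loc}})\cap(w\,L^2_{\mathcal H,\mathrm{loc}}),\qquad \mathcal Lw\in L^1_{\mathrm{loc}}\cap(w\,L^1_{\mathrm{loc}}), \] and that for some $m>0$ \[ V_w:=-\frac{|\nabla_{\mathcal H}w|^2}{4w^2}-\frac{\mathcal Lw}{2w}\ \ge\ -m+1\quad\text{almost everywhere}. \] Consider the forms \[ Q_w(f,g)=\int_G\nabla_{\mathcal H}f\cdot\nabla_{\mathcal H}\overline g\,\mathrm d\mu_w,\qquad \mathrm{Dom}(Q_w)=\{f\in L^2(\mu_w):\nabla_{\mathcal H}f\in L^2_{\mathcal H}(\mu_w)\}, \] \[ Q_{V_w}(f,g)=\int_G(\nabla_{\mathcal H}f\cdot\nabla_{\mathcal H}\overline g+V_wf\overline g)\,\mathrm d\mu,\qquad \mathrm{Dom}(Q_{V_w})=\{f\in L^2:\nabla_{\mathcal H}f\in L^2_{\mathcal H},\ f\sqrt{V_w+m}\in L^2\}. \] Then $f\mapsto fw^{1/2}$ is a linear bijection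 of $\mathrm{Dom}(Q_w)$ onto $\mathrm{Dom}(Q_{V_w})$, and it is an isometry when $\mathrm{Dom}(Q_w)$ carries the norm $\sqrt{m\|f\|_{L^2(\mu_w)}^2+Q_w(f,f)}$ and $\mathrm{Dom}(Q_{V_w})$ the norm $\sqrt{m\|f\|_{L^2}^2+Q_{V_w}(f,f)}$. Moreover it intertwines the forms: $Q_{V_w}(fw^{1/2},gw^{1/2})=Q_w(f,g)$ for all $f,g\in\mathrm{Dom}(Q_w)$. -/

import Mathlib

open MeasureTheory
open scoped Manifold ContDiff ENNReal ComplexConjugate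

noncomputable section

namespace SubLap

section Fields

variable {E : Type*} [NormedAddCommGroup E] [NormedSpace ℝ E] [FiniteDimensional ℝ E]
  {G : Type*} [TopologicalSpace G] [ChartedSpace E G] [Group G]

/-- A smooth real Lie group is regular enough for its Lie algebra (`GroupLieAlgebra`). -/
instance instLieGroupMinSmoothness [LieGroup 𝓘(ℝ, E) ∞ G] :
    LieGroup 𝓘(ℝ, E) (minSmoothness ℝ 3) G :=
  LieGroup.of_le (n := ∞) (by
    rw [minSmoothness_of_isRCLikeNormedField]
    exact WithTop.coe_le_coe.2 (le_top : (3 : ℕ∞) ≤ ⊤))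

/-- `(X φ)(x)`, where `X` is identified with its left-invariant vector field. -/
def fieldDeriv (X : GroupLieAlgebra 𝓘(ℝ, E) G) (φ : G → ℝ) (x : G) : ℝ :=
  mfderiv 𝓘(ℝ, E) 𝓘(ℝ, ℝ) φ x (mulInvariantVectorField X x)

/-- The real-valued elements of `C_c^∞(G)`. -/
structure IsTestFunction (φ : G → ℝ) : Prop where
  smooth : ContMDiff 𝓘(ℝ, E) 𝓘(ℝ, ℝ) ∞ φ
  compact : HasCompactSupport φ

end Fields

section Modular

variable {E : Type*} [NormedAddCommGroup E] [NormedSpace ℝ E] [FiniteDimensional ℝ E]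
  {G : Type*} [TopologicalSpace G] [ChartedSpace E G] [Group G]
  [IsTopologicalGroup G] [LocallyCompactSpace G]

/-- The modular function `δ_G`, normalised by `μ (A x) = δ_G x * μ A` for every left Haar
measure `μ` (see `measure_mul_right`); Mathlib's modular character is its inverse. -/
def modular (x : G) : ℝ := (Measure.modularCharacterFun x⁻¹ : ℝ)

theorem measure_mul_right [MeasurableSpace G] [BorelSpace G]
    (μ : Measure G) [μ.IsHaarMeasure] [μ.InnerRegular] (A : Set G) (x : G) :
    μ ((fun y => y * x) '' A) = ENNReal.ofReal (modular x) * μ A := by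
  have h := Measure.map_right_mul_eq_modularCharacterFun_smul μ x⁻¹
  have h2 : (fun y : G => y * x) '' A = (fun y => y * x⁻¹) ⁻¹' A := by
    simp [Set.image_mul_right]
  have h3 : μ.map (fun y => y * x⁻¹) A = μ ((fun y => y * x⁻¹) ⁻¹' A) :=
    (MeasurableEquiv.mulRight x⁻¹).map_apply A
  rw [h2, ← h3, h, Measure.smul_apply, modular, ENNReal.ofReal_coe_nnreal]
  rfl

/-- `c_X = (X δ_G)(e)`. -/
def modularDeriv (X : GroupLieAlgebra 𝓘(ℝ, E) G) : ℝ := fieldDeriv X (modular : G → ℝ) 1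

variable [MeasurableSpace G]

/-- `v = X u` in the sense of distributions, for `u, v ∈ L¹_loc(μ)`. The formal adjoint
of `X` in `L²(μ)`, `μ` a left Haar measure, is `φ ↦ -(X φ + c_X φ)`. -/
structure IsWeakDeriv {F : Type*} [NormedAddCommGroup F] [NormedSpace ℝ F] (μ : Measure G)
    (X : GroupLieAlgebra 𝓘(ℝ, E) G) (u v : G → F) : Prop where
  locInt : LocallyIntegrable u μ
  locInt_deriv : LocallyIntegrable v μ
  integral_eq : ∀ φ : G → ℝ, IsTestFunction (E := E) φ →
    ∫ x, φ x • v x ∂μ = -∫ x, (fieldDeriv X φ x + modularDeriv X * φ x) • u x ∂μ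

open Classical in
/-- The distributional derivative `X u` whenever it is a locally integrable function
(then it is unique almost everywhere, see `IsWeakDeriv.ae_eq`), and `0` otherwise. -/
def weakDeriv {F : Type*} [NormedAddCommGroup F] [NormedSpace ℝ F] (μ : Measure G)
    (X : GroupLieAlgebra 𝓘(ℝ, E) G) (u : G → F) : G → F :=
  if h : ∃ v, IsWeakDeriv μ X u v then h.choose else 0

end Modular

section WeakDerivLemmas

set_option linter.unusedSectionVars false

variable {E : Type*} [NormedAddCommGroup E] [NormedSpace ℝ E] [FiniteDimensional ℝ E]
  {G : Type*} [TopologicalSpace G] [ChartedSpace E G] [Group G]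
  [LieGroup 𝓘(ℝ, E) ∞ G]

theorem IsTestFunction.continuous_fieldDeriv {φ : G → ℝ} (hφ : IsTestFunction (E := E) φ)
    (X : GroupLieAlgebra 𝓘(ℝ, E) G) : Continuous (fieldDeriv X φ) := by
  have h1 : Continuous (fun g : G =>
      (⟨g, mulInvariantVectorField X g⟩ : TangentBundle 𝓘(ℝ, E) G)) :=
    (contMDiff_mulInvariantVectorField (I := 𝓘(ℝ, E)) X).continuous
  have h2 : Continuous (tangentMap 𝓘(ℝ, E) 𝓘(ℝ, ℝ) φ) :=
    hφ.smooth.continuous_tangentMap (by simp)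
  have h3 : Continuous (fun p : TangentBundle 𝓘(ℝ, ℝ) ℝ => (p.2 : ℝ)) :=
    (contMDiff_snd_tangentBundle_modelSpace ℝ 𝓘(ℝ, ℝ) (n := 0)).continuous
  exact h3.comp (h2.comp h1)

theorem IsTestFunction.hasCompactSupport_fieldDeriv {φ : G → ℝ}
    (hφ : IsTestFunction (E := E) φ) (X : GroupLieAlgebra 𝓘(ℝ, E) G) :
    HasCompactSupport (fieldDeriv X φ) := by
  refine hφ.compact.mono' fun x hx => ?_
  by_contra hx'
  apply hx
  have h : φ =ᶠ[nhds x] fun _ => (0 : ℝ) := notMem_tsupport_iff_eventuallyEq.1 hx'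
  unfold fieldDeriv
  rw [h.mfderiv_eq, mfderiv_const]
  rfl

variable [IsTopologicalGroup G] [LocallyCompactSpace G]
  [T2Space G] [MeasurableSpace G] [BorelSpace G]
  {F : Type*} [NormedAddCommGroup F] [NormedSpace ℝ F] {μ : Measure G}
  {X : GroupLieAlgebra 𝓘(ℝ, E) G}

theorem IsTestFunction.integrable_adjoint_smul {φ : G → ℝ} (hφ : IsTestFunction (E := E) φ)
    {u : G → F} (hu : LocallyIntegrable u μ) :
    Integrable (fun x => (fieldDeriv X φ x + modularDeriv X * φ x) • u x) μ :=
  hu.integrable_smul_left_of_hasCompactSupport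
    ((hφ.continuous_fieldDeriv X).add (continuous_const.mul hφ.smooth.continuous))
    ((hφ.hasCompactSupport_fieldDeriv X).add (hφ.compact.mul_left))

theorem IsTestFunction.integrable_smul {φ : G → ℝ} (hφ : IsTestFunction (E := E) φ)
    {u : G → F} (hu : LocallyIntegrable u μ) : Integrable (fun x => φ x • u x) μ :=
  hu.integrable_smul_left_of_hasCompactSupport hφ.smooth.continuous hφ.compact

theorem IsWeakDeriv.add {u v u' v' : G → F} (h : IsWeakDeriv μ X u v)
    (h' : IsWeakDeriv μ X u' v') : IsWeakDeriv μ X (u + u') (v + v') where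
  locInt := h.locInt.add h'.locInt
  locInt_deriv := h.locInt_deriv.add h'.locInt_deriv
  integral_eq φ hφ := by
    simp only [Pi.add_apply, smul_add]
    rw [integral_add (hφ.integrable_smul h.locInt_deriv) (hφ.integrable_smul h'.locInt_deriv),
      integral_add (hφ.integrable_adjoint_smul h.locInt) (hφ.integrable_adjoint_smul h'.locInt),
      h.integral_eq φ hφ, h'.integral_eq φ hφ, neg_add]

theorem IsWeakDeriv.const_smul {u v : G → ℂ} (h : IsWeakDeriv μ X u v) (c : ℂ) :
    IsWeakDeriv μ X (c • u) (c • v) where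
  locInt := h.locInt.smul c
  locInt_deriv := h.locInt_deriv.smul c
  integral_eq φ hφ := by
    simp only [Pi.smul_apply, smul_comm _ c]
    rw [integral_smul, integral_smul, h.integral_eq φ hφ, smul_neg]

theorem IsWeakDeriv.zero : IsWeakDeriv μ X (0 : G → F) 0 where
  locInt := locallyIntegrable_zero
  locInt_deriv := locallyIntegrable_zero
  integral_eq φ _ := by simp

theorem IsWeakDeriv.congr {u u' v : G → F} (h : IsWeakDeriv μ X u v) (hu : u =ᵐ[μ] u') :
    IsWeakDeriv μ X u' v where
  locInt := h.locInt.congr hu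
  locInt_deriv := h.locInt_deriv
  integral_eq φ hφ := by
    rw [h.integral_eq φ hφ]
    congr 1
    refine integral_congr_ae ?_
    filter_upwards [hu] with x hx
    rw [hx]

theorem IsWeakDeriv.ae_eq [SecondCountableTopology G] [CompleteSpace F] {u v v' : G → F}
    (h : IsWeakDeriv μ X u v) (h' : IsWeakDeriv μ X u v') : v =ᵐ[μ] v' :=
  ae_eq_of_integral_contMDiff_smul_eq 𝓘(ℝ, E) h.locInt_deriv h'.locInt_deriv
    fun φ hφ hc => by rw [h.integral_eq φ ⟨hφ, hc⟩, h'.integral_eq φ ⟨hφ, hc⟩]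

theorem IsWeakDeriv.weakDeriv {u v : G → F} (h : IsWeakDeriv μ X u v) :
    IsWeakDeriv μ X u (weakDeriv μ X u) := by
  have h' : ∃ v, IsWeakDeriv μ X u v := ⟨v, h⟩
  rw [SubLap.weakDeriv, dif_pos h']
  exact h'.choose_spec

end WeakDerivLemmas

section SubRiemannian

/-- A left-invariant sub-Riemannian structure on a Lie group `G`: a scalar product on the
Lie algebra of `G`, a subspace `H` which generates it as a Lie algebra, and a fixed
orthonormal basis `X` of `H`. -/
structure SubRiemannian (E : Type*) [NormedAddCommGroup E] [NormedSpace ℝ E]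
    [FiniteDimensional ℝ E] (G : Type*) [TopologicalSpace G] [ChartedSpace E G] [Group G]
    [LieGroup 𝓘(ℝ, E) ∞ G] where
  scalar : LinearMap.BilinForm ℝ (GroupLieAlgebra 𝓘(ℝ, E) G)
  scalar_symm : ∀ X Y, scalar X Y = scalar Y X
  scalar_pos : ∀ X, X ≠ 0 → 0 < scalar X X
  H : Submodule ℝ (GroupLieAlgebra 𝓘(ℝ, E) G)
  generates : LieSubalgebra.lieSpan ℝ (GroupLieAlgebra 𝓘(ℝ, E) G)
    (H : Set (GroupLieAlgebra 𝓘(ℝ, E) G)) = ⊤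
  dim : ℕ
  basis : Module.Basis (Fin dim) ℝ H
  orthonormal : ∀ i j, scalar (basis i) (basis j) = if i = j then 1 else 0

variable {E : Type*} [NormedAddCommGroup E] [NormedSpace ℝ E] [FiniteDimensional ℝ E]
  {G : Type*} [TopologicalSpace G] [ChartedSpace E G] [Group G]
  [LieGroup 𝓘(ℝ, E) ∞ G]

/-- The `j`-th vector of the orthonormal basis of `H`, as an element of the Lie algebra. -/
def SubRiemannian.X (S : SubRiemannian E G) (j : Fin S.dim) : GroupLieAlgebra 𝓘(ℝ, E) G :=
  S.basis j

variable [IsTopologicalGroup G] [LocallyCompactSpace G]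

/-- The sub-Laplacian `L φ = -∑ j, (X_j² φ + c_j X_j φ)` on smooth functions. -/
def subLaplacian (S : SubRiemannian E G) (φ : G → ℝ) (x : G) : ℝ :=
  -∑ j, (fieldDeriv (S.X j) (fieldDeriv (S.X j) φ) x
    + modularDeriv (S.X j) * fieldDeriv (S.X j) φ x)

variable [MeasurableSpace G]

/-- `ℓ = L u` in the sense of distributions, for real `u, ℓ ∈ L¹_loc(μ)`; the operator `L`
is its own formal adjoint in `L²(μ)`. -/
structure IsWeakSubLaplacian (S : SubRiemannian E G) (μ : Measure G) (u ℓ : G → ℝ) : Prop where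
  locInt : LocallyIntegrable u μ
  locInt_subLaplacian : LocallyIntegrable ℓ μ
  integral_eq : ∀ φ : G → ℝ, IsTestFunction (E := E) φ →
    ∫ x, φ x * ℓ x ∂μ = ∫ x, subLaplacian S φ x * u x ∂μ

end SubRiemannian

section Weights

variable {G : Type*} [TopologicalSpace G] [MeasurableSpace G]

/-- `f ∈ L²_loc(μ)`. -/
def MemL2Loc (f : G → ℝ) (μ : Measure G) : Prop :=
  ∀ K : Set G, IsCompact K → MemLp f 2 (μ.restrict K)

/-- `w` is a positive function with `w, w⁻¹ ∈ L¹_loc(μ)`. -/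
structure IsWeight (μ : Measure G) (w : G → ℝ) : Prop where
  pos : ∀ᵐ x ∂μ, 0 < w x
  locInt : LocallyIntegrable w μ
  locInt_inv : LocallyIntegrable (fun x => (w x)⁻¹) μ

/-- The measure `μ_w` with density `w` with respect to `μ`. -/
def weighted (μ : Measure G) (w : G → ℝ) : Measure G :=
  μ.withDensity fun x => ENNReal.ofReal (w x)

theorem IsWeight.absolutelyContinuous [SecondCountableTopology G] {μ : Measure G} {w : G → ℝ}
    (hw : IsWeight μ w) : μ ≪ weighted μ w := by
  refine withDensity_absolutelyContinuous'
    hw.locInt.aestronglyMeasurable.aemeasurable.ennreal_ofReal ?_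
  filter_upwards [hw.pos] with x hx
  simpa using hx

end Weights

section Forms

variable {E : Type*} [NormedAddCommGroup E] [NormedSpace ℝ E] [FiniteDimensional ℝ E]
  {G : Type*} [TopologicalSpace G] [ChartedSpace E G] [Group G]
  [LieGroup 𝓘(ℝ, E) ∞ G] [IsTopologicalGroup G] [LocallyCompactSpace G]
  [T2Space G] [SecondCountableTopology G] [MeasurableSpace G] [BorelSpace G]

/-- `Dom(Q_w) = {f ∈ L²(μ_w) : ∇_H f ∈ L²_H(μ_w)}`; derivatives are distributional with
respect to `μ`, and sections of `H` are given by their components along `S.X`. -/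
def weightedDom (S : SubRiemannian E G) {μ : Measure G} {w : G → ℝ} (hw : IsWeight μ w) :
    Submodule ℂ (Lp ℂ 2 (weighted μ w)) where
  carrier := {f | ∀ j, ∃ v : G → ℂ, IsWeakDeriv μ (S.X j) f v ∧ MemLp v 2 (weighted μ w)}
  zero_mem' j := ⟨0, IsWeakDeriv.zero.congr
    (hw.absolutelyContinuous.ae_eq (Lp.coeFn_zero ℂ 2 (weighted μ w)).symm), MemLp.zero⟩
  add_mem' {f g} hf hg j := by
    obtain ⟨v, hv, hv2⟩ := hf j
    obtain ⟨u, hu, hu2⟩ := hg j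
    exact ⟨v + u, (hv.add hu).congr
      (hw.absolutelyContinuous.ae_eq (Lp.coeFn_add f g).symm), hv2.add hu2⟩
  smul_mem' c f hf j := by
    obtain ⟨v, hv, hv2⟩ := hf j
    exact ⟨c • v, (hv.const_smul c).congr
      (hw.absolutelyContinuous.ae_eq (Lp.coeFn_smul c f).symm), hv2.const_smul c⟩

/-- `Q_w(f, g) = ∫ ∇_H f · conj (∇_H g) dμ_w`. -/
def weightedForm (S : SubRiemannian E G) (μ : Measure G) (w : G → ℝ) (f g : G → ℂ) : ℂ :=
  ∫ x, ∑ j, weakDeriv μ (S.X j) f x * conj (weakDeriv μ (S.X j) g x) ∂(weighted μ w)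

/-- `V_w = -|∇_H w|² / (4 w²) - L w / (2 w)`, from the components `Dw` of `∇_H w` and
from `Lw = L w`. -/
def potential {n : ℕ} (w : G → ℝ) (Dw : Fin n → G → ℝ) (Lw : G → ℝ) (x : G) : ℝ :=
  -(∑ j, Dw j x ^ 2) / (4 * w x ^ 2) - Lw x / (2 * w x)

/-- `Dom(Q_V) = {f ∈ L²(μ) : ∇_H f ∈ L²_H(μ), f √(V + m) ∈ L²(μ)}`, where `V + m ≥ 0`. -/
def schrodingerDom (S : SubRiemannian E G) (μ : Measure G) (V : G → ℝ) (m : ℝ) :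
    Submodule ℂ (Lp ℂ 2 μ) where
  carrier := {f | (∀ j, ∃ v : G → ℂ, IsWeakDeriv μ (S.X j) f v ∧ MemLp v 2 μ) ∧
    MemLp (fun x => f x * (√(V x + m) : ℂ)) 2 μ}
  zero_mem' := by
    refine ⟨fun j => ⟨0, IsWeakDeriv.zero.congr (Lp.coeFn_zero ℂ 2 μ).symm, MemLp.zero⟩, ?_⟩
    refine (MemLp.zero (ε := ℂ)).ae_eq ?_
    filter_upwards [Lp.coeFn_zero ℂ 2 μ] with x hx
    change (0 : ℂ) = (0 : Lp ℂ 2 μ) x * (√(V x + m) : ℂ)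
    rw [hx, Pi.zero_apply, zero_mul]
  add_mem' {f g} hf hg := by
    refine ⟨fun j => ?_, ?_⟩
    · obtain ⟨v, hv, hv2⟩ := hf.1 j
      obtain ⟨u, hu, hu2⟩ := hg.1 j
      exact ⟨v + u, (hv.add hu).congr (Lp.coeFn_add f g).symm, hv2.add hu2⟩
    · refine (hf.2.add hg.2).ae_eq ?_
      filter_upwards [Lp.coeFn_add f g] with x hx
      change f x * (√(V x + m) : ℂ) + g x * (√(V x + m) : ℂ)
        = (f + g : Lp ℂ 2 μ) x * (√(V x + m) : ℂ)
      rw [hx, Pi.add_apply, add_mul]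
  smul_mem' c f hf := by
    refine ⟨fun j => ?_, ?_⟩
    · obtain ⟨v, hv, hv2⟩ := hf.1 j
      exact ⟨c • v, (hv.const_smul c).congr (Lp.coeFn_smul c f).symm, hv2.const_smul c⟩
    · refine (hf.2.const_smul c).ae_eq ?_
      filter_upwards [Lp.coeFn_smul c f] with x hx
      change c • (f x * (√(V x + m) : ℂ)) = (c • f : Lp ℂ 2 μ) x * (√(V x + m) : ℂ)
      rw [hx, Pi.smul_apply, smul_mul_assoc]

/-- `Q_V(f, g) = ∫ (∇_H f · conj (∇_H g) + V f conj g) dμ`. -/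
def schrodingerForm (S : SubRiemannian E G) (μ : Measure G) (V : G → ℝ) (f g : G → ℂ) : ℂ :=
  ∫ x, ((∑ j, weakDeriv μ (S.X j) f x * conj (weakDeriv μ (S.X j) g x))
    + V x * f x * conj (g x)) ∂μ

end Forms

end SubLap

end

/-! Put u = f√w. The product rule reads X_j u = √w X_j f + f X_j w / (2√w), and V_w is the potential
for which, pointwise, |∇u|² + V_w |u|² = w|∇f|² + ½(∇|f|²·∇w − |f|² Lw). The bracket has integral
zero because L is minus the divergence of ∇_H with respect to μ. So the quadratic forms agree, and
polarization gives the sesquilinear identity. The work lies in justifying this when f is only in the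
domain and w is neither smooth nor bounded from above or from below.

Calculus. A weak derivative along X is the same as absolute continuity on almost every line s ↦ x
γ(s) of the one-parameter group of X (`IsWeakDeriv.hasLineDeriv`, `HasLineDeriv.isWeakDeriv`).
Product and chain rules, including those for √w and 1/√w, thus become statements about functions on
ℝ, and f need not be approximated by smooth functions.

The equation of w. It has to be tested against functions like |f|². Left convolution commutes with
left-invariant fields, so a mollified weight A w solves the mollified equation and can be tested
with ψ/(A w + τ) (`IsWeakSubLaplacian.sum_integral_mollify`). Cauchy–Schwarz gives (A X_j w)² ≤ A w
· A(|X_j w|²/w); as X_j w ∈ √w L²_loc, this dominates the quadratic term while the mollification is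
removed. Letting τ → 0 with X_j w ∈ w L²_loc and Lw ∈ w L¹_loc yields the equation of log w for
bounded, compactly supported ψ with derivatives in L² (`RegularWeight.sum_integral_mul_deriv_div`).
Inserting ψ = g·Mw/(M + w) and letting M → ∞ returns the equation of w itself, now for bounded g
with √w g' in L² (`RegularWeight.sum_integral_mul_deriv`).

Domains. With ψ = |u|² and g = |f|² these two equations give equality of energies for bounded
functions of compact support. Truncation with Fatou on one side and dominated convergence on the
other gives an inequality in each direction (`RegularWeight.energy_le_of_schrodinger`,
`RegularWeight.energy_le_of_weighted`); nonnegativity of V_w + m is what admits Fatou. Finiteness of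
the energies shows that multiplication and division by √w preserve the domains, and the two
inequalities combine to an equality (`RegularWeight.integral_energy_eq`). -/

namespace SubLap

/-! ### Calculus of locally absolutely continuous functions on the line -/

section Interval

open Set Filter Topology

theorem _root_.MeasureTheory.LocallyIntegrable.norm' {F α : Type*} [NormedAddCommGroup F] [TopologicalSpace α]
    [MeasurableSpace α] {μ : Measure α} {V : α → F} (h : LocallyIntegrable V μ) :
    LocallyIntegrable (fun x => ‖V x‖) μ := fun x => by
  obtain ⟨s, hs, hi⟩ := h x
  exact ⟨s, hs, hi.norm⟩

theorem _root_.MeasureTheory.LocallyIntegrable.intervalIntegrable' {F : Type*}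
    [NormedAddCommGroup F] {V : ℝ → F}
    (h : LocallyIntegrable V) (a b : ℝ) : IntervalIntegrable V volume a b :=
  intervalIntegrable_iff.mpr ((h.integrableOn_isCompact isCompact_uIcc).mono_set uIoc_subset_uIcc)

variable {F : Type*} [NormedAddCommGroup F] [NormedSpace ℝ F]

/-- `U` agrees almost everywhere with a locally absolutely continuous function whose
derivative is `V`. -/
def IsACDeriv (U V : ℝ → F) : Prop :=
  LocallyIntegrable V ∧ ∃ c, ∀ᵐ s, U s = c + ∫ r in (0 : ℝ)..s, V r

theorem _root_.MeasureTheory.LocallyIntegrable.continuous_primitive {V : ℝ → F}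
    (h : LocallyIntegrable V) (c : F) : Continuous fun s => c + ∫ r in (0 : ℝ)..s, V r :=
  continuous_const.add (intervalIntegral.continuous_primitive h.intervalIntegrable' 0)

namespace IsACDeriv

variable {U V U₁ V₁ U₂ V₂ : ℝ → F}

theorem congr (h : IsACDeriv U V) (hU : U =ᵐ[volume] U₁) (hV : V =ᵐ[volume] V₁) :
    IsACDeriv U₁ V₁ := by
  obtain ⟨hV', c, hc⟩ := h
  refine ⟨hV'.congr hV, c, ?_⟩
  filter_upwards [hc, hU] with s hs hs'
  rw [← hs', hs]
  congr 1
  exact intervalIntegral.integral_congr_ae (hV.mono fun r hr _ => hr)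

theorem add (h₁ : IsACDeriv U₁ V₁) (h₂ : IsACDeriv U₂ V₂) :
    IsACDeriv (fun s => U₁ s + U₂ s) (fun s => V₁ s + V₂ s) := by
  obtain ⟨hV₁, c₁, hc₁⟩ := h₁
  obtain ⟨hV₂, c₂, hc₂⟩ := h₂
  refine ⟨hV₁.add hV₂, c₁ + c₂, ?_⟩
  filter_upwards [hc₁, hc₂] with s h1 h2
  rw [h1, h2, intervalIntegral.integral_add (hV₁.intervalIntegrable' _ _)
    (hV₂.intervalIntegrable' _ _)]
  abel

theorem clm_apply {F' : Type*} [NormedAddCommGroup F'] [NormedSpace ℝ F'] [CompleteSpace F]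
    [CompleteSpace F'] (L : F →L[ℝ] F') (h : IsACDeriv U V) :
    IsACDeriv (fun s => L (U s)) (fun s => L (V s)) := by
  obtain ⟨hV, c, hc⟩ := h
  refine ⟨fun x => ?_, L c, ?_⟩
  · obtain ⟨s, hs, hi⟩ := hV x
    exact ⟨s, hs, L.integrable_comp hi⟩
  · filter_upwards [hc] with s hs
    rw [hs, map_add, L.intervalIntegral_comp_comm (hV.intervalIntegrable' _ _)]

theorem of_tendsto {Un Vn : ℕ → ℝ → F} (h : ∀ n, IsACDeriv (Un n) (Vn n)) {B : ℝ → ℝ}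
    (hB : LocallyIntegrable B) (hVB : ∀ n, ∀ᵐ s, ‖Vn n s‖ ≤ B s)
    (hU : ∀ᵐ s, Tendsto (fun n => Un n s) atTop (𝓝 (U s)))
    (hV : ∀ᵐ s, Tendsto (fun n => Vn n s) atTop (𝓝 (V s))) : IsACDeriv U V := by
  have hVm : AEStronglyMeasurable V volume :=
    aestronglyMeasurable_of_tendsto_ae atTop (fun n => (h n).1.aestronglyMeasurable) hV
  have hVle : ∀ᵐ s, ‖V s‖ ≤ ‖B s‖ := by
    filter_upwards [ae_all_iff.2 hVB, hV] with s h1 h2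
    exact (le_of_tendsto h2.norm (Eventually.of_forall h1)).trans (le_abs_self _)
  have hVi : LocallyIntegrable V := hB.mono hVm hVle
  have key : ∀ s, Tendsto (fun n => ∫ r in (0 : ℝ)..s, Vn n r) atTop
      (𝓝 (∫ r in (0 : ℝ)..s, V r)) := fun s =>
    intervalIntegral.tendsto_integral_filter_of_dominated_convergence B
      (Eventually.of_forall fun n => (h n).1.aestronglyMeasurable.restrict)
      (Eventually.of_forall fun n => (hVB n).mono fun _ hr _ => hr)
      (hB.intervalIntegrable' _ _) (hV.mono fun _ hr _ => hr)
  choose _ c hc using h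
  have hall := ae_all_iff.2 hc
  -- The primitives converge everywhere, so convergence of `Un` at one good point already forces the
  -- additive constants to converge.
  obtain ⟨s₀, hs₀, hs₀'⟩ := (hall.and hU).exists
  have hclim : Tendsto c atTop (𝓝 (U s₀ - ∫ r in (0 : ℝ)..s₀, V r)) := by
    refine (hs₀'.sub (key s₀)).congr fun n => ?_
    rw [hs₀ n, add_sub_cancel_right]
  refine ⟨hVi, U s₀ - ∫ r in (0 : ℝ)..s₀, V r, ?_⟩
  filter_upwards [hall, hU] with s h1 h2
  refine tendsto_nhds_unique h2 ((hclim.add (key s)).congr fun n => (h1 n).symm)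

/-- The fundamental theorem of calculus for absolutely continuous functions. -/
theorem of_absolutelyContinuous {g g' : ℝ → ℝ}
    (hac : ∀ s, AbsolutelyContinuousOnInterval g 0 s) (hg' : LocallyIntegrable g')
    (hd : ∀ᵐ s, HasDerivAt g (g' s) s) : IsACDeriv g g' := by
  refine ⟨hg', g 0, Eventually.of_forall fun s => ?_⟩
  have := (hac s).integral_deriv_eq_sub
  rw [intervalIntegral.integral_congr_ae (g := g') (hd.mono fun r hr _ => hr.deriv)] at this
  rw [this]; ring

theorem primitive_ac {V : ℝ → ℝ} (hV : LocallyIntegrable V) (c s : ℝ) :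
    AbsolutelyContinuousOnInterval (fun t => c + ∫ r in (0 : ℝ)..t, V r) 0 s :=
  (LipschitzOnWith.absolutelyContinuousOnInterval (K := 0)
    (LipschitzWith.const c).lipschitzOnWith).fun_add
    ((hV.intervalIntegrable' 0 s).absolutelyContinuousOnInterval_intervalIntegral (by simp))

theorem primitive_hasDerivAt {V : ℝ → ℝ} (hV : LocallyIntegrable V) (c : ℝ) :
    ∀ᵐ s, HasDerivAt (fun t => c + ∫ r in (0 : ℝ)..t, V r) (V s) s :=
  (_root_.LocallyIntegrable.ae_hasDerivAt_integral hV).mono fun _ hs => (hs 0).const_add c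

theorem mul {U₁ V₁ U₂ V₂ : ℝ → ℝ} (h₁ : IsACDeriv U₁ V₁) (h₂ : IsACDeriv U₂ V₂) :
    IsACDeriv (fun s => U₁ s * U₂ s) (fun s => V₁ s * U₂ s + U₁ s * V₂ s) := by
  obtain ⟨hV₁, c₁, hc₁⟩ := h₁
  obtain ⟨hV₂, c₂, hc₂⟩ := h₂
  refine IsACDeriv.congr (U := fun s => (c₁ + ∫ r in (0 : ℝ)..s, V₁ r) *
      (c₂ + ∫ r in (0 : ℝ)..s, V₂ r)) (V := fun s => V₁ s * (c₂ + ∫ r in (0 : ℝ)..s, V₂ r) +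
      (c₁ + ∫ r in (0 : ℝ)..s, V₁ r) * V₂ s) ?_ ?_ ?_
  · refine of_absolutelyContinuous
      (fun s => (primitive_ac hV₁ c₁ s).fun_mul (primitive_ac hV₂ c₂ s)) ?_ ?_
    · exact (hV₁.mul_continuous (hV₂.continuous_primitive c₂)).add
        (hV₂.continuous_mul (hV₁.continuous_primitive c₁))
    · filter_upwards [primitive_hasDerivAt hV₁ c₁, primitive_hasDerivAt hV₂ c₂] with s h1 h2
      exact h1.mul h2
  · filter_upwards [hc₁, hc₂] with s h1 h2
    rw [h1, h2]
  · filter_upwards [hc₁, hc₂] with s h1 h2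
    rw [h1, h2]

theorem _root_.AbsolutelyContinuousOnInterval.lipschitzOn_comp {g Φ : ℝ → ℝ} {a b : ℝ}
    (hg : AbsolutelyContinuousOnInterval g a b) {K : NNReal} {S : Set ℝ}
    (hΦ : LipschitzOnWith K Φ S) (hS : ∀ s ∈ uIcc a b, g s ∈ S) :
    AbsolutelyContinuousOnInterval (fun s => Φ (g s)) a b := by
  unfold AbsolutelyContinuousOnInterval at hg ⊢
  refine squeeze_zero' (Eventually.of_forall fun _ => Finset.sum_nonneg fun _ _ => dist_nonneg) ?_
    (by simpa using hg.const_mul (K : ℝ))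
  rw [eventually_inf_principal]
  filter_upwards with p hp
  rw [Finset.mul_sum]
  refine Finset.sum_le_sum fun i hi => ?_
  exact hΦ.dist_le_mul _ (hS _ (hp.1 i hi).1) _ (hS _ (hp.1 i hi).2)

/-- The chain rule for `Φ` continuously differentiable on `[0, ∞)`. -/
theorem comp {U V Φ Φ' : ℝ → ℝ} (h : IsACDeriv U V) (hU : ∀ᵐ s, 0 ≤ U s)
    (hΦ : ∀ y, 0 ≤ y → HasDerivAt Φ (Φ' y) y) (hΦ' : ContinuousOn Φ' (Ici 0)) :
    IsACDeriv (fun s => Φ (U s)) (fun s => Φ' (U s) * V s) := by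
  obtain ⟨hV, c, hc⟩ := h
  set W : ℝ → ℝ := fun s => c + ∫ r in (0 : ℝ)..s, V r with hW
  have hWc : Continuous W := hV.continuous_primitive c
  have hW0 : ∀ s, 0 ≤ W s := by
    -- The sign of U is known only almost everywhere, hence on a dense set; continuity of the
    -- representative W extends it to all s, so that Φ is never evaluated at a negative number.
    have hd : Dense {s | 0 ≤ W s} := Measure.dense_of_ae (μ := volume) (by
      filter_upwards [hc, hU] with s h1 h2
      rw [h1] at h2
      exact h2)
    intro s
    have := (isClosed_le (continuous_const (y := (0 : ℝ))) hWc).closure_eq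
    have h2 := hd s
    rw [this] at h2
    exact h2
  refine IsACDeriv.congr (U := fun s => Φ (W s)) (V := fun s => Φ' (W s) * V s) ?_ ?_ ?_
  · refine of_absolutelyContinuous (fun s => ?_) ?_ ?_
    -- Between 0 and s the representative takes values in [0, R], where Φ is Lipschitz with constant
    -- max |Φ'|.
    · obtain ⟨R, hR⟩ := (isCompact_uIcc (a := 0) (b := s)).exists_bound_of_continuousOn
        hWc.continuousOn
      obtain ⟨C, hC⟩ := (isCompact_Icc (a := 0) (b := R)).exists_bound_of_continuousOn
        (hΦ'.mono Icc_subset_Ici_self)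
      refine (primitive_ac hV c s).lipschitzOn_comp (K := C.toNNReal) (S := Icc 0 R) ?_ ?_
      · refine (convex_Icc 0 R).lipschitzOnWith_of_nnnorm_hasDerivWithin_le
          (fun y hy => (hΦ y hy.1).hasDerivWithinAt) fun y hy => ?_
        rw [← NNReal.coe_le_coe]
        exact (hC y hy).trans (Real.le_coe_toNNReal C)
      · intro r hr
        exact ⟨hW0 r, (le_abs_self _).trans (hR r hr)⟩
    · exact hV.continuous_mul
        (hΦ'.comp_continuous hWc hW0)
    · filter_upwards [primitive_hasDerivAt hV c] with s hs
      exact (hΦ _ (hW0 s)).comp s hs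
  · filter_upwards [hc] with s h1
    rw [h1]
  · filter_upwards [hc] with s h1
    rw [h1]

theorem tendsto_add_inv_nat (a : ℝ) :
    Tendsto (fun n : ℕ => a + 1 / ((n : ℝ) + 1)) atTop (𝓝 a) := by
  simpa using (tendsto_const_nhds (x := a)).add (tendsto_one_div_add_atTop_nhds_zero_nat (𝕜 := ℝ))

/-- The square root is not C¹ at 0, so the chain rule is applied to √(U + 1/(n+1)). The derivatives
increase in modulus to |V|/(2√U), and `hi` makes this limit the dominating function. The reciprocal
root below is treated in the same way. -/
theorem sqrt {U V : ℝ → ℝ} (h : IsACDeriv U V) (hU : ∀ᵐ s, 0 < U s)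
    (hi : LocallyIntegrable fun s => V s / (2 * √(U s))) :
    IsACDeriv (fun s => √(U s)) (fun s => V s / (2 * √(U s))) := by
  refine of_tendsto (Un := fun n s => √(U s + 1 / ((n : ℝ) + 1)))
    (Vn := fun n s => 1 / (2 * √(U s + 1 / ((n : ℝ) + 1))) * V s) (fun n => ?_) hi.norm'
    (fun n => ?_) ?_ ?_
  · have hn : (0 : ℝ) < 1 / ((n : ℝ) + 1) := by positivity
    refine h.comp (Φ := fun y => √(y + 1 / ((n : ℝ) + 1)))
      (Φ' := fun y => 1 / (2 * √(y + 1 / ((n : ℝ) + 1)))) (hU.mono fun _ => le_of_lt)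
      (fun y hy => ?_) ?_
    · exact ((hasDerivAt_id y).add_const _).sqrt (by simp only [id]; positivity)
    · refine ContinuousOn.div continuousOn_const (by fun_prop) fun y hy => ?_
      have : 0 < y + 1 / ((n : ℝ) + 1) := add_pos_of_nonneg_of_pos hy hn
      positivity
  · filter_upwards [hU] with s hs
    rw [one_div_mul_eq_div, norm_div, norm_div]
    rw [Real.norm_of_nonneg (by positivity : (0 : ℝ) ≤ 2 * √(U s + 1 / ((n : ℝ) + 1))),
      Real.norm_of_nonneg (by positivity : (0 : ℝ) ≤ 2 * √(U s))]
    refine div_le_div_of_nonneg_left (norm_nonneg _) (by positivity) ?_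
    gcongr
    have : (0 : ℝ) ≤ 1 / ((n : ℝ) + 1) := by positivity
    linarith
  · filter_upwards with s
    exact (tendsto_add_inv_nat _).sqrt
  · filter_upwards [hU] with s hs
    have : V s / (2 * √(U s)) = 1 / (2 * √(U s)) * V s := by ring
    rw [this]
    refine (Tendsto.div tendsto_const_nhds ((tendsto_add_inv_nat _).sqrt.const_mul 2) ?_).mul_const _
    exact (mul_pos two_pos (Real.sqrt_pos.2 hs)).ne'

theorem inv_sqrt {U V : ℝ → ℝ} (h : IsACDeriv U V) (hU : ∀ᵐ s, 0 < U s)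
    (hi : LocallyIntegrable fun s => V s / (2 * U s * √(U s))) :
    IsACDeriv (fun s => (√(U s))⁻¹) (fun s => -(V s / (2 * U s * √(U s)))) := by
  refine of_tendsto (Un := fun n s => (√(U s + 1 / ((n : ℝ) + 1)))⁻¹)
    (Vn := fun n s => -(1 / (2 * (U s + 1 / ((n : ℝ) + 1)) * √(U s + 1 / ((n : ℝ) + 1)))) * V s)
    (fun n => ?_) hi.norm' (fun n => ?_) ?_ ?_
  · have hn : (0 : ℝ) < 1 / ((n : ℝ) + 1) := by positivity
    refine h.comp (Φ := fun y => (√(y + 1 / ((n : ℝ) + 1)))⁻¹)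
      (Φ' := fun y => -(1 / (2 * (y + 1 / ((n : ℝ) + 1)) * √(y + 1 / ((n : ℝ) + 1)))))
      (hU.mono fun _ => le_of_lt) (fun y hy => ?_) ?_
    · have hp : 0 < y + 1 / ((n : ℝ) + 1) := by positivity
      have := (((hasDerivAt_id y).add_const (1 / ((n : ℝ) + 1))).sqrt
        (by simp only [id]; positivity)).inv (by simp only [id]; positivity)
      refine this.congr_deriv ?_
      simp only [id]
      rw [Real.sq_sqrt hp.le]
      field_simp
    · refine (ContinuousOn.div continuousOn_const (by fun_prop) fun y hy => ?_).neg
      have : 0 < y + 1 / ((n : ℝ) + 1) := add_pos_of_nonneg_of_pos hy hn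
      positivity
  · filter_upwards [hU] with s hs
    have hn : (0 : ℝ) ≤ 1 / ((n : ℝ) + 1) := by positivity
    rw [neg_mul, norm_neg, one_div_mul_eq_div, norm_div, norm_div]
    rw [Real.norm_of_nonneg (by positivity : (0 : ℝ) ≤
        2 * (U s + 1 / ((n : ℝ) + 1)) * √(U s + 1 / ((n : ℝ) + 1))),
      Real.norm_of_nonneg (by positivity : (0 : ℝ) ≤ 2 * U s * √(U s))]
    refine div_le_div_of_nonneg_left (norm_nonneg _) (by positivity) ?_
    gcongr <;> linarith
  · filter_upwards [hU] with s hs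
    exact (tendsto_add_inv_nat _).sqrt.inv₀ (by positivity)
  · filter_upwards [hU] with s hs
    have : -(V s / (2 * U s * √(U s))) = -(1 / (2 * U s * √(U s))) * V s := by ring
    rw [this]
    refine (Tendsto.div tendsto_const_nhds
      (((tendsto_add_inv_nat _).const_mul 2).mul (tendsto_add_inv_nat _).sqrt) ?_).neg.mul_const _
    exact (mul_pos (mul_pos two_pos hs) (Real.sqrt_pos.2 hs)).ne'

end IsACDeriv

namespace IsACDeriv

theorem of_hasDerivAt {η η' : ℝ → ℝ} (hη : ∀ s, HasDerivAt η (η' s) s) (hη' : Continuous η') :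
    IsACDeriv η η' := by
  refine ⟨hη'.locallyIntegrable, η 0, Eventually.of_forall fun s => ?_⟩
  rw [intervalIntegral.integral_eq_sub_of_hasDerivAt (fun r _ => hη r)
    (hη'.intervalIntegrable _ _)]
  ring

theorem integral_eq_zero {U V : ℝ → ℝ} (h : IsACDeriv U V) (hU : HasCompactSupport U)
    (hV : HasCompactSupport V) : ∫ s, V s = 0 := by
  obtain ⟨hVi, c, hc⟩ := h
  obtain ⟨R, hR⟩ := (hU.isCompact.union hV.isCompact).isBounded.subset_closedBall 0
  have hout : ∀ s, R < |s| → U s = 0 ∧ V s = 0 := by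
    intro s hs
    have : s ∉ tsupport U ∪ tsupport V := fun h => by
      have := hR h
      rw [mem_closedBall_zero_iff, Real.norm_eq_abs] at this
      linarith
    exact ⟨image_eq_zero_of_notMem_tsupport fun h => this (Or.inl h),
      image_eq_zero_of_notMem_tsupport fun h => this (Or.inr h)⟩
  -- U equals its continuous representative only almost everywhere; the endpoints beyond the
  -- supports are picked from the dense set where it does.
  have hex : ∀ a : ℝ, ∃ s, a < s ∧ U s = c + ∫ r in (0 : ℝ)..s, V r := fun a =>
    ((Measure.dense_of_ae hc).exists_gt a).imp fun s hs => ⟨hs.2, hs.1⟩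
  have hex' : ∀ a : ℝ, ∃ s, s < a ∧ U s = c + ∫ r in (0 : ℝ)..s, V r := fun a =>
    ((Measure.dense_of_ae hc).exists_lt a).imp fun s hs => ⟨hs.2, hs.1⟩
  obtain ⟨s, hs, hs'⟩ := hex (max R 0)
  obtain ⟨t, ht, ht'⟩ := hex' (-(max R 0))
  have h0 := le_max_right R 0
  have h1 := le_max_left R 0
  have hs0 : U s = 0 := (hout s (by rw [abs_of_pos (by linarith)]; linarith)).1
  have ht0 : U t = 0 := (hout t (by rw [abs_of_neg (by linarith)]; linarith)).1
  have hts : ∫ r in t..s, V r = 0 := by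
    rw [← intervalIntegral.integral_interval_sub_left (hVi.intervalIntegrable' 0 s)
      (hVi.intervalIntegrable' 0 t)]
    linarith
  rw [← hts, intervalIntegral.integral_of_le (by linarith), setIntegral_eq_integral_of_forall_compl_eq_zero]
  intro x hx
  refine (hout x ?_).2
  by_contra hcon
  push Not at hcon
  rw [abs_le] at hcon
  exact hx ⟨by linarith, by linarith⟩

/-- Integration by parts: the product rule shows that the sum of both integrands is the derivative
of ηU, which has compact support. -/
theorem integral_mul_deriv {U V η η' : ℝ → ℝ} (h : IsACDeriv U V)
    (hη : ∀ s, HasDerivAt η (η' s) s) (hη' : Continuous η') (hc : HasCompactSupport η) :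
    ∫ s, η s * V s = -∫ s, η' s * U s := by
  have hc' : HasCompactSupport η' := by
    have : η' = deriv η := funext fun s => (hη s).deriv.symm
    rw [this]
    exact hc.deriv
  have hηc : Continuous η := continuous_iff_continuousAt.2 fun s => (hη s).continuousAt
  have hUi : LocallyIntegrable U := by
    obtain ⟨hV, c, hcc⟩ := h
    exact (hV.continuous_primitive c).locallyIntegrable.congr (hcc.mono fun _ hs => hs.symm)
  have key := ((of_hasDerivAt hη hη').mul h).integral_eq_zero hc.mul_right
    (hc'.mul_right.add hc.mul_right)
  rw [integral_add] at key
  · linarith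
  · exact hUi.integrable_smul_left_of_hasCompactSupport hη' hc'
  · exact h.1.integrable_smul_left_of_hasCompactSupport hηc hc

theorem integral_smul_deriv [CompleteSpace F] {U V : ℝ → F} {η η' : ℝ → ℝ} (h : IsACDeriv U V)
    (hη : ∀ s, HasDerivAt η (η' s) s) (hη' : Continuous η') (hc : HasCompactSupport η) :
    ∫ s, η s • V s = -∫ s, η' s • U s := by
  have hc' : HasCompactSupport η' := by
    have : η' = deriv η := funext fun s => (hη s).deriv.symm
    rw [this]
    exact hc.deriv
  have hηc : Continuous η := continuous_iff_continuousAt.2 fun s => (hη s).continuousAt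
  have hUi : LocallyIntegrable U := by
    obtain ⟨hV, c, hcc⟩ := h
    exact (hV.continuous_primitive c).locallyIntegrable.congr (hcc.mono fun _ hs => hs.symm)
  -- Continuous linear functionals separate points and commute with all integrals involved, which
  -- reduces the claim to real-valued functions.
  refine (SeparatingDual.eq_iff_forall_dual_eq (R := ℝ)).2 fun L => ?_
  rw [map_neg, ← L.integral_comp_comm (hUi.integrable_smul_left_of_hasCompactSupport hη' hc'),
    ← L.integral_comp_comm (h.1.integrable_smul_left_of_hasCompactSupport hηc hc)]
  simpa using (h.clm_apply L).integral_mul_deriv hη hη' hc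

end IsACDeriv
end Interval

/-! ### One-parameter subgroups as integral curves of left-invariant fields -/

section OneParameter

set_option linter.unusedSectionVars false
open Set Filter Topology

variable {E : Type*} [NormedAddCommGroup E] [NormedSpace ℝ E] [FiniteDimensional ℝ E]
  {G : Type*} [TopologicalSpace G] [ChartedSpace E G] [Group G]

theorem comp_one_smulRight {E F : Type*} [NormedAddCommGroup E] [NormedSpace ℝ E]
    [NormedAddCommGroup F] [NormedSpace ℝ F] (L : E →L[ℝ] F) (v : E) :
    L.comp ((1 : ℝ →L[ℝ] ℝ).smulRight v) = (1 : ℝ →L[ℝ] ℝ).smulRight (L v) := by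
  ext; simp

theorem hasDerivAt_of_comp_smulRight {E : Type*} [NormedAddCommGroup E] [NormedSpace ℝ E]
    {f : ℝ → ℝ} {t : ℝ} (L : E →L[ℝ] ℝ) (v : E)
    (h : HasFDerivAt f (L.comp ((1 : ℝ →L[ℝ] ℝ).smulRight v)) t) : HasDerivAt f (L v) t := by
  rw [comp_one_smulRight] at h
  simpa using h.hasDerivAt

/-- `γ` is the one-parameter subgroup of `G` generated by `X`. -/
structure IsOneParam (X : GroupLieAlgebra 𝓘(ℝ, E) G) (γ : ℝ → G) : Prop where
  zero : γ 0 = 1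
  add : ∀ s t, γ (s + t) = γ s * γ t
  curve : IsMIntegralCurve (I := 𝓘(ℝ, E)) γ (mulInvariantVectorField X)

variable [LieGroup 𝓘(ℝ, E) ∞ G] {X : GroupLieAlgebra 𝓘(ℝ, E) G} {γ : ℝ → G}

theorem mfderiv_mul_left_mulInvariantVectorField (X : GroupLieAlgebra 𝓘(ℝ, E) G) (x g : G) :
    mfderiv 𝓘(ℝ, E) 𝓘(ℝ, E) (x * ·) g (mulInvariantVectorField X g) =
      mulInvariantVectorField X (x * g) := by
  have h1 : MDifferentiableAt 𝓘(ℝ, E) 𝓘(ℝ, E) (x * · : G → G) (g * 1) :=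
    (contMDiff_mul_left (I := 𝓘(ℝ, E)) (n := ∞) (a := x)).mdifferentiableAt (by simp)
  have h2 : MDifferentiableAt 𝓘(ℝ, E) 𝓘(ℝ, E) (g * · : G → G) 1 :=
    (contMDiff_mul_left (I := 𝓘(ℝ, E)) (n := ∞) (a := g)).mdifferentiableAt (by simp)
  have h3 : (x * g * · : G → G) = (x * ·) ∘ (g * ·) := by
    ext y; simp [mul_assoc]
  have h4 : mfderiv 𝓘(ℝ, E) 𝓘(ℝ, E) ((x * ·) ∘ (g * ·) : G → G) 1 =
      (mfderiv 𝓘(ℝ, E) 𝓘(ℝ, E) (x * ·) (g * 1)).comp (mfderiv 𝓘(ℝ, E) 𝓘(ℝ, E) (g * ·) 1) :=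
    mfderiv_comp (I' := 𝓘(ℝ, E)) 1 h1 h2
  rw [← h3] at h4
  -- The points g·1 and g are equal but not definitionally so; viewing all tangent spaces as E
  -- allows the derivative to be transported.
  have h5 : ∀ g' : G, g' = g → (mfderiv 𝓘(ℝ, E) 𝓘(ℝ, E) (x * ·) g' : E →L[ℝ] E) =
    (mfderiv 𝓘(ℝ, E) 𝓘(ℝ, E) (x * ·) g : E →L[ℝ] E) := fun g' h => h ▸ rfl
  have h6 := congrArg (fun L : E →L[ℝ] E => L X) h4
  refine Eq.trans ?_ h6.symm
  exact congrArg (fun L : E →L[ℝ] E => L (mulInvariantVectorField X g)) (h5 (g * 1) (mul_one g)).symm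

theorem isMIntegralCurveOn_mul_left {s : Set ℝ}
    (h : IsMIntegralCurveOn (I := 𝓘(ℝ, E)) γ (mulInvariantVectorField X) s) (x : G) :
    IsMIntegralCurveOn (I := 𝓘(ℝ, E)) (fun t => x * γ t) (mulInvariantVectorField X) s := by
  intro t ht
  have h1 : MDifferentiableAt 𝓘(ℝ, E) 𝓘(ℝ, E) (x * · : G → G) (γ t) :=
    (contMDiff_mul_left (I := 𝓘(ℝ, E)) (n := ∞) (a := x)).mdifferentiableAt (by simp)
  have h3 := h1.hasMFDerivAt.comp_hasMFDerivWithinAt t (h t ht)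
  have h2 : ((1 : ℝ →L[ℝ] ℝ).smulRight (mulInvariantVectorField X (x * γ t) : E) : ℝ →L[ℝ] E) =
      ContinuousLinearMap.comp (mfderiv 𝓘(ℝ, E) 𝓘(ℝ, E) (x * ·) (γ t) : E →L[ℝ] E)
        ((1 : ℝ →L[ℝ] ℝ).smulRight (mulInvariantVectorField X (γ t) : E) : ℝ →L[ℝ] E) := by
    refine (congrArg (fun v : E => ((1 : ℝ →L[ℝ] ℝ).smulRight v : ℝ →L[ℝ] E))
      (mfderiv_mul_left_mulInvariantVectorField X x (γ t))).symm.trans ?_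
    exact (comp_one_smulRight (E := E) (F := E) _ _).symm
  exact (congrArg (fun L : ℝ →L[ℝ] E => HasMFDerivWithinAt 𝓘(ℝ, ℝ) 𝓘(ℝ, E)
    (fun t => x * γ t) s t L) h2).mpr h3

/-- Left translates of one local integral curve through 1 are integral curves through every point,
all defined for the same time ε, so the field is complete. The curves t ↦ γ(t + s) and t ↦ γ(s)γ(t)
solve the same equation with the same value at t = 0; uniqueness makes γ a homomorphism. -/
theorem exists_isOneParam [T2Space G] (X : GroupLieAlgebra 𝓘(ℝ, E) G) :
    ∃ γ : ℝ → G, IsOneParam X γ := by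
  have hM : IsManifold 𝓘(ℝ, E) 1 G := IsManifold.of_le (n := ∞) (by simp)
  have hv : ContMDiff 𝓘(ℝ, E) 𝓘(ℝ, E).tangent 1
      (fun g : G => (⟨g, mulInvariantVectorField X g⟩ : TangentBundle 𝓘(ℝ, E) G)) :=
    (contMDiff_mulInvariantVectorField (I := 𝓘(ℝ, E)) X).of_le (by
      rw [minSmoothness_of_isRCLikeNormedField]; norm_num)
  obtain ⟨γ₀, h0, hγ₀⟩ := exists_isMIntegralCurveAt_of_contMDiffAt_boundaryless
    (I := 𝓘(ℝ, E)) (t₀ := 0) (hv.contMDiffAt (x := 1))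
  obtain ⟨ε, hε, hγ₀⟩ := isMIntegralCurveAt_iff'.1 hγ₀
  rw [Real.ball_eq_Ioo, zero_sub, zero_add] at hγ₀
  obtain ⟨γ, h1, hγ⟩ := exists_isMIntegralCurve_of_isMIntegralCurveOn hv hε (fun x =>
    ⟨fun t => x * γ₀ t, by simp [h0], isMIntegralCurveOn_mul_left hγ₀ x⟩) 1
  refine ⟨γ, h1, fun s t => ?_, hγ⟩
  have ha : IsMIntegralCurve (I := 𝓘(ℝ, E)) (γ ∘ (· + s)) (mulInvariantVectorField X) :=
    hγ.comp_add s
  have hb : IsMIntegralCurve (I := 𝓘(ℝ, E)) (fun t => γ s * γ t) (mulInvariantVectorField X) :=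
    isMIntegralCurve_iff_isMIntegralCurveOn.2
      (isMIntegralCurveOn_mul_left (hγ.isMIntegralCurveOn _) _)
  have := isMIntegralCurve_Ioo_eq_of_contMDiff_boundaryless (t₀ := 0) hv ha hb (by simp [h1])
  have := congrFun this t
  simpa [add_comm] using this

namespace IsOneParam

theorem continuous (h : IsOneParam X γ) : Continuous γ := h.curve.continuous

theorem hasDerivAt (h : IsOneParam X γ) {φ : G → ℝ} {x : G} {t : ℝ}
    (hφ : MDifferentiableAt 𝓘(ℝ, E) 𝓘(ℝ, ℝ) φ (x * γ t)) :
    HasDerivAt (fun s => φ (x * γ s)) (fieldDeriv X φ (x * γ t)) t := by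
  have h1 := isMIntegralCurve_iff_isMIntegralCurveOn.2
    (isMIntegralCurveOn_mul_left (h.curve.isMIntegralCurveOn univ) x) t
  exact hasDerivAt_of_comp_smulRight (E := E) (f := fun s => φ (x * γ s)) _ _
    (hasMFDerivAt_iff_hasFDerivAt.1 (hφ.hasMFDerivAt.comp t h1))

end IsOneParam
end OneParameter

/-! ### Differentiability of the modular function and its values on one-parameter groups -/

section Modular
open Set Filter Topology

set_option linter.unusedSectionVars false

variable {E : Type*} [NormedAddCommGroup E] [NormedSpace ℝ E] [FiniteDimensional ℝ E]
  {G : Type*} [TopologicalSpace G] [ChartedSpace E G]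

/-- Joint continuity in the chart variable and the parameter bounds the derivative on compact
products. That bound is the domination needed to differentiate under the integral. -/
theorem continuousAt_fderiv_chart [IsManifold 𝓘(ℝ, E) ∞ G] {Φ : G → G → ℝ}
    (hΦ : ContMDiff (𝓘(ℝ, E).prod 𝓘(ℝ, E)) 𝓘(ℝ, ℝ) ∞ (Function.uncurry Φ)) (y₀ : G)
    {p : E × G} (hp : p.1 ∈ (extChartAt 𝓘(ℝ, E) y₀).target) :
    ContinuousAt (fun q : E × G =>
      fderiv ℝ (fun v => Φ ((extChartAt 𝓘(ℝ, E) y₀).symm v) q.2) q.1) p := by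
  have hM : IsManifold 𝓘(ℝ, E) 1 G := IsManifold.of_le (n := ∞) (by simp)
  have h1 : ContMDiffAt 𝓘(ℝ, E) 𝓘(ℝ, E) ∞ (extChartAt 𝓘(ℝ, E) y₀).symm p.1 :=
    (contMDiffOn_extChartAt_symm y₀).contMDiffAt ((isOpen_extChartAt_target y₀).mem_nhds hp)
  have h2 : ContMDiffAt ((𝓘(ℝ, E).prod 𝓘(ℝ, E)).prod 𝓘(ℝ, E)) 𝓘(ℝ, ℝ) ∞
      (Function.uncurry fun (q : E × G) v => Φ ((extChartAt 𝓘(ℝ, E) y₀).symm v) q.2)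
      (p, p.1) := by
    refine ContMDiffAt.comp (p, p.1) (hΦ _) (ContMDiffAt.prodMk ?_ ?_)
    · exact ContMDiffAt.comp (p, p.1) h1 contMDiffAt_snd
    · exact ContMDiffAt.comp (p, p.1) contMDiffAt_snd contMDiffAt_fst
  have h3 := ContMDiffAt.mfderiv (m := 0) (n := ∞) (x₀ := p)
    (fun (q : E × G) v => Φ ((extChartAt 𝓘(ℝ, E) y₀).symm v) q.2) Prod.fst h2 contMDiffAt_fst
    (by simp)
  have h4 := h3.continuousAt
  have h5 : inTangentCoordinates 𝓘(ℝ, E) 𝓘(ℝ, ℝ) Prod.fst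
      (fun q : E × G => Φ ((extChartAt 𝓘(ℝ, E) y₀).symm q.1) q.2)
      (fun q => mfderiv 𝓘(ℝ, E) 𝓘(ℝ, ℝ) (fun v => Φ ((extChartAt 𝓘(ℝ, E) y₀).symm v) q.2) q.1) p =
      (fun q => mfderiv 𝓘(ℝ, E) 𝓘(ℝ, ℝ) (fun v => Φ ((extChartAt 𝓘(ℝ, E) y₀).symm v) q.2) q.1) :=
    inTangentCoordinates_model_space (I := 𝓘(ℝ, E)) (I' := 𝓘(ℝ, ℝ)) _ _ _ p
  rw [h5] at h4
  simp only [mfderiv_eq_fderiv] at h4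
  exact h4

/-- Differentiation under the integral sign on a manifold. -/
theorem mdifferentiableAt_integral [IsManifold 𝓘(ℝ, E) ∞ G] [SecondCountableTopology G] [T2Space G]
    [MeasurableSpace G] [BorelSpace G] (μ : Measure G) [IsFiniteMeasureOnCompacts μ]
    {Φ : G → G → ℝ}
    (hΦ : ContMDiff (𝓘(ℝ, E).prod 𝓘(ℝ, E)) 𝓘(ℝ, ℝ) ∞ (Function.uncurry Φ)) (y₀ : G)
    {K : Set G} (hK : IsCompact K) (hsupp : ∀ᶠ y in 𝓝 y₀, ∀ x, x ∉ K → Φ y x = 0) :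
    MDifferentiableAt 𝓘(ℝ, E) 𝓘(ℝ, ℝ) (fun y => ∫ x, Φ y x ∂μ) y₀ := by
  have hM : IsManifold 𝓘(ℝ, E) 1 G := IsManifold.of_le (n := ∞) (by simp)
  set e := extChartAt 𝓘(ℝ, E) y₀ with he
  have htar : e.target ∈ 𝓝 (e y₀) := extChartAt_target_mem_nhds y₀
  have hsymm : ContinuousAt e.symm (e y₀) := continuousAt_extChartAt_symm y₀
  have hey : e.symm (e y₀) = y₀ := extChartAt_to_inv y₀
  have hsupp' : ∀ᶠ v in 𝓝 (e y₀), ∀ x, x ∉ K → Φ (e.symm v) x = 0 := by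
    rw [← hey] at hsupp
    exact hsymm.eventually hsupp
  -- On this closed ball both the chart inverse is defined and the integrand is supported in the
  -- fixed compact K.
  obtain ⟨r, hr, hball⟩ := Metric.nhds_basis_closedBall.mem_iff.1
    (inter_mem htar hsupp')
  have hcont : ContinuousOn (fun q : E × G => fderiv ℝ (fun v => Φ (e.symm v) q.2) q.1)
      (Metric.closedBall (e y₀) r ×ˢ K) := fun q hq =>
    (continuousAt_fderiv_chart hΦ y₀ (hball hq.1).1).continuousWithinAt
  have hprop : ProperSpace E := FiniteDimensional.proper ℝ E
  obtain ⟨C, hC⟩ := ((isCompact_closedBall (e y₀) r).prod hK).exists_bound_of_continuousOn hcont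
  have hint : ∀ v, Continuous fun x => Φ (e.symm v) x := fun v =>
    hΦ.continuous.comp (Continuous.prodMk_right (e.symm v))
  have hd : HasFDerivAt (fun v => ∫ x, Φ (e.symm v) x ∂μ)
      (∫ x, fderiv ℝ (fun v => Φ (e.symm v) x) (e y₀) ∂μ) (e y₀) := by
    refine hasFDerivAt_integral_of_dominated_of_fderiv_le (bound := K.indicator fun _ => C)
      (F' := fun v x => fderiv ℝ (fun v => Φ (e.symm v) x) v)
      (Metric.ball_mem_nhds (e y₀) hr) ?_ ?_ ?_ ?_ ?_ ?_
    · exact Eventually.of_forall fun v => (hint v).aestronglyMeasurable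
    · refine (hint _).integrable_of_hasCompactSupport (HasCompactSupport.intro hK fun x hx => ?_)
      exact (hball (Metric.mem_closedBall_self hr.le)).2 x hx
    · refine Continuous.aestronglyMeasurable (continuous_iff_continuousAt.2 fun x => ?_)
      exact ContinuousAt.comp (f := fun x : G => (e y₀, x)) (x := x)
        (continuousAt_fderiv_chart hΦ y₀ (p := (e y₀, x)) (mem_extChartAt_target y₀))
        (Continuous.prodMk_right (e y₀)).continuousAt
    · refine Eventually.of_forall fun x v hv => ?_
      by_cases hx : x ∈ K
      · rw [indicator_of_mem hx]
        exact hC (v, x) ⟨Metric.ball_subset_closedBall hv, hx⟩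
      · rw [indicator_of_notMem hx]
        have : (fun v => Φ (e.symm v) x) =ᶠ[𝓝 v] fun _ => 0 := by
          filter_upwards [Metric.isOpen_ball.mem_nhds hv] with v' hv'
          exact (hball (Metric.ball_subset_closedBall hv')).2 x hx
        rw [this.fderiv_eq]
        simp
    · exact (integrable_indicator_iff hK.measurableSet).2 (integrableOn_const hK.measure_lt_top.ne)
    · refine Eventually.of_forall fun x v hv => DifferentiableAt.hasFDerivAt ?_
      have h1 : ContMDiffAt 𝓘(ℝ, E) 𝓘(ℝ, E) ∞ e.symm v :=
        (contMDiffOn_extChartAt_symm y₀).contMDiffAt ((isOpen_extChartAt_target y₀).mem_nhds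
          (hball (Metric.ball_subset_closedBall hv)).1)
      have h2 : ContMDiffAt 𝓘(ℝ, E) 𝓘(ℝ, ℝ) ∞ (fun v => Φ (e.symm v) x) v :=
        ContMDiffAt.comp (g := Function.uncurry Φ) (f := fun v => (e.symm v, x)) v (hΦ _)
          (h1.prodMk contMDiffAt_const)
      exact (mdifferentiableAt_iff_differentiableAt.1 (h2.mdifferentiableAt (by simp)))
  have h2 : MDifferentiableAt 𝓘(ℝ, E) 𝓘(ℝ, ℝ) ((fun v => ∫ x, Φ (e.symm v) x ∂μ) ∘ e) y₀ :=
    MDifferentiableAt.comp (I' := 𝓘(ℝ, E)) y₀ hd.differentiableAt.mdifferentiableAt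
      (mdifferentiableAt_extChartAt (mem_chart_source E y₀))
  refine h2.congr_of_eventuallyEq ?_
  filter_upwards [extChartAt_source_mem_nhds (I := 𝓘(ℝ, E)) y₀] with y hy
  simp only [Function.comp]
  rw [he, (extChartAt 𝓘(ℝ, E) y₀).left_inv hy]

theorem exists_isTestFunction [IsManifold 𝓘(ℝ, E) ∞ G] [T2Space G] {x : G} {U : Set G}
    (hU : U ∈ 𝓝 x) : ∃ ρ : G → ℝ, IsTestFunction (E := E) ρ ∧ (∀ y, 0 ≤ ρ y) ∧ ρ x = 1 ∧
      tsupport ρ ⊆ U := by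
  obtain ⟨f, -, hf⟩ := (SmoothBumpFunction.nhds_basis_tsupport (I := 𝓘(ℝ, E)) x).mem_iff.1 hU
  exact ⟨f, ⟨f.contMDiff, f.hasCompactSupport⟩, fun y => f.nonneg, f.eq_one, hf⟩

variable [Group G] [LieGroup 𝓘(ℝ, E) ∞ G] [IsTopologicalGroup G] [LocallyCompactSpace G]
  [T2Space G] [SecondCountableTopology G]

theorem lintegral_mul_right_eq [MeasurableSpace G] [BorelSpace G] (μ : Measure G)
    [μ.IsHaarMeasure] (f : G → ℝ≥0∞) (y : G) :
    ∫⁻ x, f (x * y) ∂μ = Measure.modularCharacterFun y * ∫⁻ x, f x ∂μ := by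
  have h := Measure.map_right_mul_eq_modularCharacterFun_smul μ y
  rw [← MeasurableEquiv.coe_mulRight] at h
  have h2 := lintegral_map_equiv (μ := μ) f (MeasurableEquiv.mulRight y)
  rw [h, lintegral_smul_measure] at h2
  exact h2.symm

theorem integral_mul_right_eq [MeasurableSpace G] [BorelSpace G] (μ : Measure G)
    [μ.IsHaarMeasure] {F : Type*} [NormedAddCommGroup F] [NormedSpace ℝ F] (f : G → F) (y : G) :
    ∫ x, f (x * y) ∂μ = (Measure.modularCharacterFun y : ℝ) • ∫ x, f x ∂μ := by
  have h := Measure.map_right_mul_eq_modularCharacterFun_smul μ y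
  rw [← MeasurableEquiv.coe_mulRight] at h
  have h2 := integral_map_equiv (μ := μ) (MeasurableEquiv.mulRight y) f
  rw [h, integral_smul_nnreal_measure] at h2
  exact h2.symm

/-- Up to the constant ∫ρ, δ_G(y) is the integral of ρ(x y⁻¹) over x, so its regularity is inherited
from a smooth bump ρ. This is what gives `modularDeriv` its meaning: a manifold derivative is 0 by
convention where differentiability fails. -/
theorem mdifferentiableAt_modular :
    MDifferentiableAt 𝓘(ℝ, E) 𝓘(ℝ, ℝ) (modular : G → ℝ) 1 := by
  borelize G
  let μ : Measure G := Measure.haar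
  obtain ⟨ρ, hρ, hρ0, hρ1, -⟩ := exists_isTestFunction (E := E) (univ_mem : univ ∈ 𝓝 (1 : G))
  have hpos : 0 < ∫ x, ρ x ∂μ :=
    hρ.smooth.continuous.integral_pos_of_hasCompactSupport_nonneg_nonzero hρ.compact hρ0
      (by rw [hρ1]; exact one_ne_zero)
  obtain ⟨N, hN, hN1⟩ := exists_compact_mem_nhds (1 : G)
  have h1 : MDifferentiableAt 𝓘(ℝ, E) 𝓘(ℝ, ℝ) (fun y => ∫ x, ρ (x * y⁻¹) ∂μ) 1 := by
    refine mdifferentiableAt_integral μ (Φ := fun y x => ρ (x * y⁻¹)) ?_ 1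
      (hρ.compact.isCompact.mul hN) ?_
    · refine hρ.smooth.comp ?_
      exact contMDiff_snd.mul (contMDiff_fst.inv)
    · filter_upwards [hN1] with y hy x hx
      refine image_eq_zero_of_notMem_tsupport fun h => hx ?_
      exact ⟨x * y⁻¹, h, y, hy, by simp⟩
  have h2 : (modular : G → ℝ) = fun y => (∫ x, ρ x ∂μ)⁻¹ * ∫ x, ρ (x * y⁻¹) ∂μ := by
    ext y
    rw [integral_mul_right_eq μ ρ y⁻¹, modular, smul_eq_mul]
    field_simp
  rw [h2]
  exact mdifferentiableAt_const.mul h1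

/-- Along γ the modular function is a homomorphism from ℝ to the positive reals, differentiable at 0
with derivative c_X. Hence it solves g' = c_X g and is an exponential; the sign changes because
`modularCharacterFun` is its inverse. -/
theorem modularCharacterFun_oneParam {X : GroupLieAlgebra 𝓘(ℝ, E) G} {γ : ℝ → G}
    (hγ : IsOneParam X γ) (t : ℝ) :
    (Measure.modularCharacterFun (γ t) : ℝ) = Real.exp (-(modularDeriv X * t)) := by
  set g : ℝ → ℝ := fun t => modular (γ t) with hg
  have hadd : ∀ s t, g (s + t) = g s * g t := by
    intro s t
    simp only [hg, modular, hγ.add, mul_inv_rev, Measure.modularCharacterFun_map_mul]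
    push_cast; ring
  have hd0 : HasDerivAt g (modularDeriv X) 0 := by
    have := hγ.hasDerivAt (φ := modular) (x := 1) (t := 0)
      (by rw [hγ.zero, one_mul]; exact mdifferentiableAt_modular)
    simpa [hγ.zero, modularDeriv, hg] using this
  have hd : ∀ t, HasDerivAt g (modularDeriv X * g t) t := by
    intro t
    have h1 : HasDerivAt (fun s => g (s - t)) (modularDeriv X) t := by
      have h0 : HasDerivAt g (modularDeriv X) (t - t) := by rwa [sub_self]
      simpa using h0.comp_sub_const t t
    have h2 := h1.mul_const (g t)
    refine h2.congr_of_eventuallyEq (Eventually.of_forall fun s => ?_)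
    simp only
    rw [← hadd]; simp
  have hconst : ∀ t, g t * Real.exp (-(modularDeriv X * t)) = 1 := by
    have hd' : ∀ t, HasDerivAt (fun t => g t * Real.exp (-(modularDeriv X * t))) 0 t := by
      intro t
      have := (hd t).mul (((hasDerivAt_id t).const_mul (modularDeriv X)).neg.exp)
      refine this.congr_deriv ?_
      simp only [id]; ring
    intro t
    have := is_const_of_deriv_eq_zero (fun t => (hd' t).differentiableAt)
      (fun t => (hd' t).deriv) t 0
    rw [this]
    simp [hg, hγ.zero, modular, Measure.modularCharacterFun_map_one]
  have h2 : g t * Measure.modularCharacterFun (γ t) = 1 := by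
    simp only [hg, modular]
    rw [← NNReal.coe_mul, ← Measure.modularCharacterFun_map_mul, inv_mul_cancel,
      Measure.modularCharacterFun_map_one]
    simp
  have h3 : g t ≠ 0 := left_ne_zero_of_mul_eq_one h2
  exact mul_left_cancel₀ h3 (h2.trans (hconst t).symm)

/-- Joint continuity of the derivative along `X` in the first variable. -/
theorem continuous_fieldDeriv_left {Φ : G → G → ℝ}
    (hΦ : ContMDiff (𝓘(ℝ, E).prod 𝓘(ℝ, E)) 𝓘(ℝ, ℝ) ∞ (Function.uncurry Φ))
    (X : GroupLieAlgebra 𝓘(ℝ, E) G) :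
    Continuous fun p : G × G => fieldDeriv X (fun x => Φ x p.2) p.1 := by
  have hM : IsManifold 𝓘(ℝ, E) 1 G := IsManifold.of_le (n := ∞) (by simp)
  have h1 : Continuous (fun g : G =>
      (⟨g, mulInvariantVectorField X g⟩ : TangentBundle 𝓘(ℝ, E) G)) :=
    (contMDiff_mulInvariantVectorField (I := 𝓘(ℝ, E)) X).continuous
  have h0 : Continuous (fun g : G => (⟨g, 0⟩ : TangentBundle 𝓘(ℝ, E) G)) :=
    (Bundle.contMDiff_zeroSection ℝ (TangentSpace 𝓘(ℝ, E) : G → Type _) (n := 0)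
      (IB := 𝓘(ℝ, E))).continuous
  have h2 : Continuous (tangentMap (𝓘(ℝ, E).prod 𝓘(ℝ, E)) 𝓘(ℝ, ℝ) (Function.uncurry Φ)) :=
    hΦ.continuous_tangentMap (by simp)
  have h3 : Continuous (fun p : TangentBundle 𝓘(ℝ, ℝ) ℝ => (p.2 : ℝ)) :=
    (contMDiff_snd_tangentBundle_modelSpace ℝ 𝓘(ℝ, ℝ) (n := 0)).continuous
  have h4 : Continuous (equivTangentBundleProd 𝓘(ℝ, E) G 𝓘(ℝ, E) G).symm :=
    (contMDiff_equivTangentBundleProd_symm (I := 𝓘(ℝ, E)) (I' := 𝓘(ℝ, E)) (M := G) (M' := G)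
      (n := 0)).continuous
  have h5 := h3.comp (h2.comp (h4.comp ((h1.comp continuous_fst).prodMk (h0.comp continuous_snd))))
  have h6 : ∀ p : G × G, fieldDeriv X (fun x => Φ x p.2) p.1 =
      mfderiv (𝓘(ℝ, E).prod 𝓘(ℝ, E)) 𝓘(ℝ, ℝ) (Function.uncurry Φ) p
        ((mulInvariantVectorField X p.1 : E), (0 : E)) := by
    intro p
    have hd : MDifferentiableAt (𝓘(ℝ, E).prod 𝓘(ℝ, E)) 𝓘(ℝ, ℝ) (Function.uncurry Φ) p :=
      hΦ.mdifferentiableAt (by simp)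
    have h := mfderiv_prod_eq_add_apply (I := 𝓘(ℝ, E)) (I' := 𝓘(ℝ, E))
      (v := ((mulInvariantVectorField X p.1, 0) :
        TangentSpace 𝓘(ℝ, E) p.1 × TangentSpace 𝓘(ℝ, E) p.2)) hd
    refine Eq.trans ?_ h.symm
    exact ((congrArg (fun r : ℝ => fieldDeriv X (fun x => Φ x p.2) p.1 + r)
      (ContinuousLinearMap.map_zero (mfderiv 𝓘(ℝ, E) 𝓘(ℝ, ℝ) (fun z => Φ p.1 z) p.2 :
        E →L[ℝ] ℝ))).trans (add_zero _)).symm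
  have h7 : (fun p : G × G => fieldDeriv X (fun x => Φ x p.2) p.1) = _ := funext h6
  rw [h7]
  exact h5

end Modular

/-! ### Integration over flow lines; line derivatives are weak derivatives -/

section LineDeriv
open Set Filter Topology
open scoped Pointwise

set_option linter.unusedSectionVars false

variable {E : Type*} [NormedAddCommGroup E] [NormedSpace ℝ E] [FiniteDimensional ℝ E]
  {G : Type*} [TopologicalSpace G] [ChartedSpace E G] [Group G]
  [LieGroup 𝓘(ℝ, E) ∞ G] [IsTopologicalGroup G] [LocallyCompactSpace G]
  [T2Space G] [SecondCountableTopology G] [MeasurableSpace G] [BorelSpace G]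
  {μ : Measure G} [μ.IsHaarMeasure] {F : Type*} [NormedAddCommGroup F] [NormedSpace ℝ F]
  {X : GroupLieAlgebra 𝓘(ℝ, E) G} {γ : ℝ → G}

theorem integrable_mul_right {h : G → F} (hh : Integrable h μ) (y : G) :
    Integrable (fun x => h (x * y)) μ := by
  refine ⟨hh.1.comp_quasiMeasurePreserving (quasiMeasurePreserving_mul_right μ y), ?_⟩
  rw [hasFiniteIntegral_iff_enorm, lintegral_mul_right_eq μ (fun x => ‖h x‖ₑ) y]
  exact ENNReal.mul_lt_top ENNReal.coe_lt_top hh.2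

namespace IsOneParam

theorem integral_mul (hγ : IsOneParam X γ) (h : G → F) (s : ℝ) :
    ∫ x, h (x * γ s) ∂μ = Real.exp (-(modularDeriv X * s)) • ∫ x, h x ∂μ := by
  rw [integral_mul_right_eq, modularCharacterFun_oneParam hγ]

/-- Each right translation preserves null sets, so a property valid μ-almost everywhere holds at
almost every parameter of almost every flow line. -/
theorem quasiMeasurePreserving (hγ : IsOneParam X γ) :
    Measure.QuasiMeasurePreserving (fun p : G × ℝ => p.1 * γ p.2) (μ.prod volume) μ :=
  QuasiMeasurePreserving.prod_of_left
    (continuous_fst.mul (hγ.continuous.comp continuous_snd)).measurable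
    (Eventually.of_forall fun s => quasiMeasurePreserving_mul_right μ (γ s))

theorem integrable_prod (hγ : IsOneParam X γ) {k : ℝ → ℝ} {h : G → F} (hk : AEStronglyMeasurable k)
    (hk' : Integrable fun s => k s * Real.exp (-(modularDeriv X * s))) (hh : Integrable h μ) :
    Integrable (fun p : G × ℝ => k p.2 • h (p.1 * γ p.2)) (μ.prod volume) := by
  have hm : AEStronglyMeasurable (fun p : G × ℝ => k p.2 • h (p.1 * γ p.2)) (μ.prod volume) :=
    (hk.comp_snd).smul (hh.1.comp_quasiMeasurePreserving hγ.quasiMeasurePreserving)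
  refine (integrable_prod_iff' hm).2 ⟨Eventually.of_forall fun s =>
    (integrable_mul_right hh (γ s)).smul (k s), ?_⟩
  have : (fun s => ∫ x, ‖k s • h (x * γ s)‖ ∂μ) =
      fun s => ‖k s * Real.exp (-(modularDeriv X * s))‖ * ∫ x, ‖h x‖ ∂μ := by
    ext s
    simp_rw [norm_smul]
    rw [integral_const_mul, hγ.integral_mul (fun x => ‖h x‖) s, smul_eq_mul, norm_mul,
      Real.norm_of_nonneg (Real.exp_pos _).le, mul_assoc]
  simp only at this ⊢
  rw [this]
  exact hk'.norm.mul_const _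

/-- Averaging over lines with density k reproduces the integral over G up to the factor ∫ k e^{-cs}.
With k = η e^{cs} the modular factor cancels and only ∫ η is left. -/
theorem integral_prod (hγ : IsOneParam X γ) {k : ℝ → ℝ} {h : G → F} (hk : AEStronglyMeasurable k)
    (hk' : Integrable fun s => k s * Real.exp (-(modularDeriv X * s))) (hh : Integrable h μ) :
    ∫ x, (∫ s, k s • h (x * γ s)) ∂μ =
      (∫ s, k s * Real.exp (-(modularDeriv X * s))) • ∫ x, h x ∂μ := by
  rw [integral_integral_swap (f := fun (x : G) (s : ℝ) => k s • h (x * γ s))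
    (hγ.integrable_prod hk hk' hh)]
  simp_rw [integral_smul, hγ.integral_mul h, smul_smul]
  by_cases hF : CompleteSpace F
  · exact integral_smul_const _ _
  · simp [integral, hF]

theorem integrable_prod_restrict (hγ : IsOneParam X γ) {v : G → F} (hv : LocallyIntegrable v μ)
    {K : Set G} (hK : IsCompact K) {T : Set ℝ} (hT : IsCompact T) :
    Integrable (fun p : G × ℝ => v (p.1 * γ p.2)) ((μ.restrict K).prod (volume.restrict T)) := by
  have hK' : IsCompact (K * γ '' T) := hK.mul (hT.image hγ.continuous)
  -- For x ∈ K and s ∈ T the point x γ(s) stays in the compact K·γ(T), so v may be cut off there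
  -- without changing the integrand.
  have h1 := hγ.integrable_prod (μ := μ) (k := T.indicator 1)
    (h := (K * γ '' T).indicator v) (aestronglyMeasurable_one.indicator hT.measurableSet) ?_
    ((integrable_indicator_iff hK'.measurableSet).2 (hv.integrableOn_isCompact hK'))
  · rw [Measure.prod_restrict]
    refine (h1.integrableOn (s := K ×ˢ T)).congr ?_
    filter_upwards [ae_restrict_mem (hK.measurableSet.prod hT.measurableSet)] with p hp
    rw [indicator_of_mem hp.2, indicator_of_mem (mul_mem_mul hp.1 (mem_image_of_mem _ hp.2))]
    simp
  · have : (fun s => T.indicator (1 : ℝ → ℝ) s * Real.exp (-(modularDeriv X * s))) =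
        T.indicator fun s => Real.exp (-(modularDeriv X * s)) := by
      ext s
      by_cases hs : s ∈ T <;> simp [hs]
    rw [this, integrable_indicator_iff hT.measurableSet]
    exact (by fun_prop : Continuous fun s =>
      Real.exp (-(modularDeriv X * s))).continuousOn.integrableOn_compact hT

theorem ae_locallyIntegrable (hγ : IsOneParam X γ) {v : G → F} (hv : LocallyIntegrable v μ) :
    ∀ᵐ x ∂μ, LocallyIntegrable (fun s => v (x * γ s)) := by
  have h1 : ∀ n N : ℕ, ∀ᵐ x ∂μ.restrict (compactCovering G n),
      IntegrableOn (fun s => v (x * γ s)) (Icc (-(N : ℝ)) N) := fun n N =>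
    (hγ.integrable_prod_restrict hv (isCompact_compactCovering G n) isCompact_Icc).prod_right_ae
  have h2 : ∀ N : ℕ, ∀ᵐ x ∂μ, IntegrableOn (fun s => v (x * γ s)) (Icc (-(N : ℝ)) N) := by
    intro N
    have := (ae_restrict_iUnion_iff (compactCovering G) _).2 fun n => h1 n N
    rwa [iUnion_compactCovering, Measure.restrict_univ] at this
  filter_upwards [ae_all_iff.2 h2] with x hx
  refine locallyIntegrable_iff.2 fun K hK => ?_
  obtain ⟨R, hR⟩ := hK.isBounded.subset_closedBall 0
  obtain ⟨N, hN⟩ := exists_nat_ge R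
  refine (hx N).mono_set fun s hs => ?_
  have := hR hs
  rw [mem_closedBall_zero_iff, Real.norm_eq_abs, abs_le] at this
  exact ⟨by linarith, by linarith⟩

end IsOneParam

/-- On almost every flow line of the one-parameter group `γ`, the function `u` agrees almost
everywhere with a locally absolutely continuous function whose derivative is `v`. -/
def HasLineDeriv (μ : Measure G) (γ : ℝ → G) (u v : G → F) : Prop :=
  ∀ᵐ x ∂μ, IsACDeriv (fun s => u (x * γ s)) (fun s => v (x * γ s))

theorem exists_contDiff_bump : ∃ η : ℝ → ℝ, ContDiff ℝ ∞ η ∧ HasCompactSupport η ∧ ∫ s, η s = 1 := by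
  let f : ContDiffBump (0 : ℝ) := ⟨1, 2, one_pos, one_lt_two⟩
  exact ⟨f.normed volume, f.contDiff_normed, f.hasCompactSupport_normed, f.integral_normed⟩

theorem IsTestFunction.hasDerivAt {φ : G → ℝ} (hφ : IsTestFunction (E := E) φ)
    (hγ : IsOneParam X γ) (x : G) (t : ℝ) :
    HasDerivAt (fun s => φ (x * γ s)) (fieldDeriv X φ (x * γ t)) t :=
  hγ.hasDerivAt (hφ.smooth.mdifferentiableAt (by simp))

/-- The pairing of φ with v is written as an average over flow lines with density η(s) e^{cs}, ∫ η =
1, and integrated by parts on each line. The term with η' disappears since ∫ η' = 0, and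
differentiating e^{cs} produces the summand c_X φ of the formal adjoint. -/
theorem HasLineDeriv.isWeakDeriv [CompleteSpace F] (hγ : IsOneParam X γ) {u v : G → F}
    (h : HasLineDeriv μ γ u v) (hu : LocallyIntegrable u μ) (hv : LocallyIntegrable v μ) :
    IsWeakDeriv μ X u v := by
  refine ⟨hu, hv, fun φ hφ => ?_⟩
  obtain ⟨η, hη, hηc, hη1⟩ := exists_contDiff_bump
  set c := modularDeriv X with hc
  have hηd : ∀ s, HasDerivAt η (deriv η s) s := fun s =>
    (hη.differentiable (by simp)).differentiableAt.hasDerivAt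
  have hηc' : Continuous (deriv η) := hη.continuous_deriv (by simp)
  have hη0 : ∫ s, deriv η s = 0 :=
    (IsACDeriv.of_hasDerivAt hηd hηc').integral_eq_zero hηc hηc.deriv
  have hXφ := hφ.continuous_fieldDeriv X
  have hline : ∀ᵐ x ∂μ, ∫ s, (η s * Real.exp (c * s)) • (φ (x * γ s) • v (x * γ s)) =
      -∫ s, ((deriv η s * Real.exp (c * s)) • (φ (x * γ s) • u (x * γ s)) +
        (η s * Real.exp (c * s)) •
          ((fieldDeriv X φ (x * γ s) + c * φ (x * γ s)) • u (x * γ s))) := by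
    filter_upwards [h] with x hx
    have hcγ : Continuous fun s => x * γ s := continuous_const.mul hγ.continuous
    have := hx.integral_smul_deriv (η := fun s => η s * Real.exp (c * s) * φ (x * γ s))
      (η' := fun s => (deriv η s * Real.exp (c * s) + η s * (Real.exp (c * s) * c)) * φ (x * γ s) +
        η s * Real.exp (c * s) * fieldDeriv X φ (x * γ s)) ?_ ?_ ?_
    · simp_rw [mul_smul] at this
      simp_rw [mul_smul]
      rw [this]
      congr 2
      ext s
      module
    · intro s
      have he : HasDerivAt (fun s => Real.exp (c * s)) (Real.exp (c * s) * c) s := by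
        simpa using ((hasDerivAt_id s).const_mul c).exp
      exact ((hηd s).mul he).mul (hφ.hasDerivAt hγ x s)
    · have h1 := hφ.smooth.continuous.comp hcγ
      have h2 := hXφ.comp hcγ
      have h3 := hη.continuous
      have h4 : Continuous fun s : ℝ => Real.exp (c * s) := by fun_prop
      exact (((hηc'.mul h4).add (h3.mul (h4.mul_const c))).mul h1).add ((h3.mul h4).mul h2)
    · exact (hηc.mul_right).mul_right
  -- The factor e^{cs} is chosen so that it cancels the e^{-cs} created by right translation of the
  -- left Haar measure.
  have hint : ∀ k : ℝ → ℝ, Continuous k → HasCompactSupport k →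
      AEStronglyMeasurable (fun s => k s * Real.exp (c * s)) ∧
      Integrable (fun s => k s * Real.exp (c * s) * Real.exp (-(c * s))) ∧
      ∫ s, k s * Real.exp (c * s) * Real.exp (-(c * s)) = ∫ s, k s := by
    intro k hk hkc
    have : (fun s => k s * Real.exp (c * s) * Real.exp (-(c * s))) = k := by
      ext s
      rw [mul_assoc, ← Real.exp_add, add_neg_cancel, Real.exp_zero, mul_one]
    rw [this]
    exact ⟨(by fun_prop : Continuous _).aestronglyMeasurable,
      hk.integrable_of_hasCompactSupport hkc, rfl⟩
  obtain ⟨hm1, hi1, he1⟩ := hint η hη.continuous hηc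
  obtain ⟨hm2, hi2, he2⟩ := hint (deriv η) hηc' hηc.deriv
  have hA := hγ.integral_prod hm1 hi1 (hφ.integrable_smul hv)
  have hB := hγ.integral_prod hm2 hi2 (hφ.integrable_smul hu)
  have hC := hγ.integral_prod hm1 hi1 (hφ.integrable_adjoint_smul (X := X) hu)
  have hBi := hγ.integrable_prod hm2 hi2 (hφ.integrable_smul hu)
  have hCi := hγ.integrable_prod hm1 hi1 (hφ.integrable_adjoint_smul (X := X) hu)
  rw [← hc, he1, hη1, one_smul] at hA hC
  rw [← hc, he2, hη0, zero_smul] at hB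
  rw [← hA, integral_congr_ae hline, integral_neg, ← hC]
  congr 1
  have hsum : ∀ᵐ x ∂μ, ∫ s, ((deriv η s * Real.exp (c * s)) • (φ (x * γ s) • u (x * γ s)) +
        (η s * Real.exp (c * s)) •
          ((fieldDeriv X φ (x * γ s) + c * φ (x * γ s)) • u (x * γ s))) =
      (∫ s, (deriv η s * Real.exp (c * s)) • (φ (x * γ s) • u (x * γ s))) +
      ∫ s, (η s * Real.exp (c * s)) •
          ((fieldDeriv X φ (x * γ s) + c * φ (x * γ s)) • u (x * γ s)) := by
    filter_upwards [hBi.prod_right_ae, hCi.prod_right_ae] with x h1 h2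
    exact integral_add h1 h2
  refine (integral_congr_ae hsum).trans ((integral_add hBi.integral_prod_left
    hCi.integral_prod_left).trans ?_)
  exact (congrArg (fun z : F => z + _) hB).trans (zero_add _)

end LineDeriv

/-! ### Weak derivatives are line derivatives -/

section LineDerivOfWeak
open Set Filter Topology
open scoped Pointwise

set_option linter.unusedSectionVars false

variable {E : Type*} [NormedAddCommGroup E] [NormedSpace ℝ E] [FiniteDimensional ℝ E]
  {G : Type*} [TopologicalSpace G] [ChartedSpace E G] [Group G]
  [LieGroup 𝓘(ℝ, E) ∞ G] [IsTopologicalGroup G] [LocallyCompactSpace G]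
  [T2Space G] [SecondCountableTopology G] [MeasurableSpace G] [BorelSpace G]
  {μ : Measure G} [μ.IsHaarMeasure] {F : Type*} [NormedAddCommGroup F] [NormedSpace ℝ F]
  {X : GroupLieAlgebra 𝓘(ℝ, E) G} {γ : ℝ → G}

theorem IsTestFunction.comp_mul_right {φ : G → ℝ} (hφ : IsTestFunction (E := E) φ) (y : G) :
    IsTestFunction (E := E) fun x => φ (x * y) where
  smooth := hφ.smooth.comp (contMDiff_mul_right (a := y))
  compact := hφ.compact.comp_homeomorph (Homeomorph.mulRight y)

theorem IsTestFunction.fieldDeriv_comp_oneParam {φ : G → ℝ} (hφ : IsTestFunction (E := E) φ)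
    (hγ : IsOneParam X γ) (t : ℝ) (x : G) :
    fieldDeriv X (fun x => φ (x * γ t)) x = fieldDeriv X φ (x * γ t) := by
  have h1 := (hφ.comp_mul_right (γ t)).hasDerivAt hγ x 0
  have h2 := hφ.hasDerivAt hγ x (0 + t)
  rw [hγ.zero, mul_one] at h1
  have h3 := h2.comp_add_const 0 t
  rw [zero_add] at h3
  refine h1.unique (h3.congr_of_eventuallyEq (Eventually.of_forall fun s => ?_))
  simp [hγ.add, mul_assoc]

/-- Right translation by γ(t) is moved from u to φ at the price of an exponential factor; the smooth
φ can then be differentiated under the integral although u is only locally integrable. -/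
theorem IsTestFunction.hasDerivAt_integral {φ : G → ℝ} (hφ : IsTestFunction (E := E) φ)
    (hγ : IsOneParam X γ) {u : G → F} (hu : LocallyIntegrable u μ) (t : ℝ) :
    HasDerivAt (fun t => ∫ x, φ x • u (x * γ t) ∂μ)
      (-(Real.exp (-(modularDeriv X * t)) •
        ∫ x, (fieldDeriv X (fun x => φ (x * γ (-t))) x +
          modularDeriv X * φ (x * γ (-t))) • u x ∂μ)) t := by
  set c := modularDeriv X with hc
  have heq : (fun t => ∫ x, φ x • u (x * γ t) ∂μ) =
      fun t => Real.exp (-(c * t)) • ∫ x, φ (x * γ (-t)) • u x ∂μ := by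
    ext t
    rw [hc, ← hγ.integral_mul (fun x => φ (x * γ (-t)) • u x) t]
    simp_rw [mul_assoc, ← hγ.add, add_neg_cancel, hγ.zero, mul_one]
  have hXφ := hφ.continuous_fieldDeriv X
  have hXc := hφ.hasCompactSupport_fieldDeriv X
  obtain ⟨C, hC⟩ := hXφ.bounded_above_of_compact_support hXc
  -- One compact set that contains the supports of all translates with parameter within distance 1
  -- of t, so a single integrable bound serves them all.
  set K : Set G := tsupport (fieldDeriv X φ) * γ '' Icc (t - 1) (t + 1) with hK
  have hKc : IsCompact K := hXc.isCompact.mul (isCompact_Icc.image hγ.continuous)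
  have hmain : HasDerivAt (fun t => ∫ x, φ (x * γ (-t)) • u x ∂μ)
      (∫ x, (-fieldDeriv X φ (x * γ (-t))) • u x ∂μ) t := by
    refine (hasDerivAt_integral_of_dominated_loc_of_deriv_le
      (F' := fun t x => (-fieldDeriv X φ (x * γ (-t))) • u x)
      (bound := K.indicator fun x => C * ‖u x‖)
      (Ioo_mem_nhds (by linarith : t - 1 < t) (by linarith : t < t + 1)) ?_ ?_ ?_ ?_ ?_ ?_).2
    · exact Eventually.of_forall fun s => ((hφ.comp_mul_right _).integrable_smul hu).1
    · exact (hφ.comp_mul_right _).integrable_smul hu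
    · exact ((hXφ.comp (continuous_mul_const (γ (-t)))).neg.aestronglyMeasurable).smul
        hu.aestronglyMeasurable
    · refine Eventually.of_forall fun x s hs => ?_
      by_cases hx : x ∈ K
      · rw [indicator_of_mem hx, norm_smul, norm_neg]
        gcongr
        exact hC _
      · rw [indicator_of_notMem hx]
        have : fieldDeriv X φ (x * γ (-s)) = 0 := by
          refine image_eq_zero_of_notMem_tsupport fun h => hx ?_
          refine ⟨_, h, γ s, ⟨s, ⟨hs.1.le, hs.2.le⟩, rfl⟩, ?_⟩
          simp [mul_assoc, ← hγ.add, hγ.zero]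
        simp [this]
    · exact (integrable_indicator_iff hKc.measurableSet).2
        ((hu.norm'.integrableOn_isCompact hKc).const_mul C)
    · refine Eventually.of_forall fun x s _ => ?_
      have h1 := (hφ.hasDerivAt hγ x (-s)).comp s (hasDerivAt_neg s)
      rw [mul_neg_one] at h1
      exact h1.smul_const _
  have he : HasDerivAt (fun t => Real.exp (-(c * t))) (Real.exp (-(c * t)) * -c) t := by
    simpa using (((hasDerivAt_id t).const_mul c).neg).exp
  rw [heq]
  refine (he.smul hmain).congr_deriv ?_
  have h1 : Integrable (fun x => fieldDeriv X φ (x * γ (-t)) • u x) μ := by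
    have := hu.integrable_smul_left_of_hasCompactSupport
      (hXφ.comp (continuous_mul_const (γ (-t)))) (hXc.comp_homeomorph (Homeomorph.mulRight (γ (-t))))
    exact this
  have h2 : Integrable (fun x => φ (x * γ (-t)) • u x) μ :=
    (hφ.comp_mul_right _).integrable_smul hu
  simp_rw [hφ.fieldDeriv_comp_oneParam hγ, add_smul, neg_smul, mul_smul]
  have h3 : Integrable (fun x => c • φ (x * γ (-t)) • u x) μ := h2.smul c
  rw [integral_add h1 h3, integral_neg, integral_smul]
  module

theorem IsWeakDeriv.hasDerivAt_integral {u v : G → F} (h : IsWeakDeriv μ X u v) {φ : G → ℝ}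
    (hφ : IsTestFunction (E := E) φ) (hγ : IsOneParam X γ) (t : ℝ) :
    HasDerivAt (fun t => ∫ x, φ x • u (x * γ t) ∂μ) (∫ x, φ x • v (x * γ t) ∂μ) t := by
  refine (hφ.hasDerivAt_integral hγ h.locInt t).congr_deriv ?_
  rw [← smul_neg, ← h.integral_eq _ (hφ.comp_mul_right (γ (-t))),
    ← hγ.integral_mul (fun x => φ (x * γ (-t)) • v x) t]
  simp_rw [mul_assoc, ← hγ.add, add_neg_cancel, hγ.zero, mul_one]

theorem locallyIntegrable_comp_mul_right {u : G → F} (hu : LocallyIntegrable u μ) (y : G) :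
    LocallyIntegrable (fun x => u (x * y)) μ := by
  refine locallyIntegrable_iff.2 fun K hK => ?_
  have hK' : IsCompact (K * {y}) := hK.mul isCompact_singleton
  have h1 := integrable_mul_right
    ((integrable_indicator_iff hK'.measurableSet).2 (hu.integrableOn_isCompact hK')) y
  refine (h1.integrableOn (s := K)).congr_fun (fun x hx => ?_) hK.measurableSet
  simp only
  rw [indicator_of_mem (mul_mem_mul hx (mem_singleton y))]

theorem IsOneParam.locallyIntegrable_primitive (hγ : IsOneParam X γ) {v : G → F}
    (hv : LocallyIntegrable v μ) (t : ℝ) :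
    LocallyIntegrable (fun x => ∫ s in (0 : ℝ)..t, v (x * γ s)) μ := by
  have key : ∀ a b : ℝ, LocallyIntegrable (fun x => ∫ s in Ioc a b, v (x * γ s)) μ := by
    intro a b
    refine locallyIntegrable_iff.2 fun K hK => ?_
    have := (hγ.integrable_prod_restrict hv hK (isCompact_Icc (a := a) (b := b)))
    rw [← Measure.restrict_congr_set Ioc_ae_eq_Icc] at this
    exact this.integral_prod_left
  exact (key 0 t).sub (key t 0)

/-- After pairing with a test function, t ↦ ∫ φ(x) u(xγ(t)) is differentiable with derivative ∫ φ(x)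
v(xγ(t)). The fundamental theorem of calculus and Fubini give the claim weakly, and test functions
separate locally integrable functions. -/
theorem IsWeakDeriv.ae_sub_eq [CompleteSpace F] {u v : G → F} (h : IsWeakDeriv μ X u v)
    (hγ : IsOneParam X γ) (t : ℝ) :
    ∀ᵐ x ∂μ, u (x * γ t) - u x = ∫ s in (0 : ℝ)..t, v (x * γ s) := by
  refine ae_eq_of_integral_contMDiff_smul_eq 𝓘(ℝ, E)
    ((locallyIntegrable_comp_mul_right h.locInt (γ t)).sub h.locInt)
    (hγ.locallyIntegrable_primitive h.locInt_deriv t) fun φ hφs hφc => ?_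
  have hφ : IsTestFunction (E := E) φ := ⟨hφs, hφc⟩
  simp_rw [smul_sub]
  rw [integral_sub (hφ.integrable_smul (locallyIntegrable_comp_mul_right h.locInt (γ t)))
    (hφ.integrable_smul h.locInt)]
  have hcont : Continuous fun t => ∫ x, φ x • v (x * γ t) ∂μ :=
    continuous_iff_continuousAt.2 fun t =>
      (hφ.hasDerivAt_integral hγ h.locInt_deriv t).continuousAt
  have hftc := intervalIntegral.integral_eq_sub_of_hasDerivAt (a := 0) (b := t)
    (fun s _ => h.hasDerivAt_integral hφ hγ s) (hcont.intervalIntegrable _ _)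
  simp only [hγ.zero, mul_one] at hftc
  rw [← hftc, intervalIntegral_integral_swap]
  · simp_rw [intervalIntegral.integral_smul]
  · obtain ⟨C, hC⟩ := hφ.smooth.continuous.bounded_above_of_compact_support hφ.compact
    have h1 := hγ.integrable_prod_restrict h.locInt_deriv hφ.compact.isCompact
      (isCompact_uIcc (a := 0) (b := t))
    rw [uIcc, ← Measure.restrict_congr_set Ioc_ae_eq_Icc] at h1
    have h2 := h1.bdd_smul C (φ := fun p : G × ℝ => φ p.1)
      (hφ.smooth.continuous.comp continuous_fst).aestronglyMeasurable
      (Eventually.of_forall fun p => hC p.1)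
    rw [← Measure.restrict_univ (μ := volume.restrict (Ioc (min 0 t) (max 0 t))),
      Measure.prod_restrict] at h2
    refine Integrable.swap (f := fun p : G × ℝ => φ p.1 • v (p.1 * γ p.2)) ?_
    refine (integrableOn_iff_integrable_of_support_subset (s := tsupport φ ×ˢ univ) ?_).1 h2
    intro p hp
    refine ⟨subset_tsupport _ fun h0 => hp ?_, mem_univ _⟩
    simp [h0]

/-- The increment formula is known for each s outside a null set of x depending on s. Fubini,
applied to the set where the defect `g` vanishes, exchanges the quantifiers; this requires joint
measurability of `g`. -/
theorem IsWeakDeriv.hasLineDeriv [CompleteSpace F] {u v : G → F} (h : IsWeakDeriv μ X u v)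
    (hγ : IsOneParam X γ) : HasLineDeriv μ γ u v := by
  have hT := hγ.quasiMeasurePreserving (μ := μ)
  set g : G × ℝ → F := fun p => u (p.1 * γ p.2) - u p.1 - ∫ s in (0 : ℝ)..p.2, v (p.1 * γ s) with hg
  have hgm : AEStronglyMeasurable g (μ.prod volume) := by
    refine ((h.locInt.aestronglyMeasurable.comp_quasiMeasurePreserving hT).sub
      h.locInt.aestronglyMeasurable.comp_fst).sub ?_
    have h1 : AEStronglyMeasurable (fun q : (G × ℝ) × ℝ => v (q.1.1 * γ q.2))
        ((μ.prod volume).prod volume) := by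
      refine h.locInt_deriv.aestronglyMeasurable.comp_quasiMeasurePreserving
        (f := fun q : (G × ℝ) × ℝ => q.1.1 * γ q.2) ?_
      exact QuasiMeasurePreserving.prod_of_left
        ((continuous_fst.comp continuous_fst).mul (hγ.continuous.comp continuous_snd)).measurable
        (Eventually.of_forall fun s => (quasiMeasurePreserving_mul_right μ (γ s)).comp
          Measure.quasiMeasurePreserving_fst)
    -- The interval integral with variable endpoint is a difference of integrals over fixed ℝ of
    -- indicators, which makes it measurable in (x, s).
    have hm1 : MeasurableSet {q : (G × ℝ) × ℝ | q.2 ∈ Ioc 0 q.1.2} :=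
      (measurableSet_lt measurable_const measurable_snd).inter
        (measurableSet_le measurable_snd (measurable_snd.comp measurable_fst))
    have hm2 : MeasurableSet {q : (G × ℝ) × ℝ | q.2 ∈ Ioc q.1.2 0} :=
      (measurableSet_lt (measurable_snd.comp measurable_fst) measurable_snd).inter
        (measurableSet_le measurable_snd measurable_const)
    refine AEStronglyMeasurable.sub ?_ ?_
    · refine (h1.indicator hm1).integral_prod_right'.congr (Eventually.of_forall fun p => ?_)
      simp only
      rw [← integral_indicator measurableSet_Ioc]
      rfl
    · refine (h1.indicator hm2).integral_prod_right'.congr (Eventually.of_forall fun p => ?_)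
      simp only
      rw [← integral_indicator measurableSet_Ioc]
      rfl
  have hg0 : ∀ᵐ s : ℝ, ∀ᵐ x ∂μ, hgm.mk g (x, s) = 0 := by
    have h1 := hgm.ae_eq_mk
    have h2 : ∀ᵐ p ∂((volume : Measure ℝ).prod μ), g p.swap = hgm.mk g p.swap :=
      (Measure.measurePreserving_swap (μ := volume) (ν := μ)).quasiMeasurePreserving.ae h1
    filter_upwards [Measure.ae_ae_of_ae_prod h2] with s hs
    filter_upwards [hs, h.ae_sub_eq hγ s] with x hx hx'
    simp only [Prod.swap_prod_mk] at hx
    rw [← hx, hg]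
    simp only
    rw [hx', sub_self]
  have hmeas : MeasurableSet {q : G × ℝ | hgm.mk g (q.1, q.2) = 0} :=
    hgm.stronglyMeasurable_mk.measurableSet_eq_fun stronglyMeasurable_const
  have hg1 := (Measure.ae_ae_comm (μ := μ) (ν := volume) (p := fun x s => hgm.mk g (x, s) = 0)
    hmeas).2 hg0
  filter_upwards [hg1, Measure.ae_ae_of_ae_prod hgm.ae_eq_mk,
    hγ.ae_locallyIntegrable h.locInt_deriv] with x h1 h2 h3
  -- The constant of integration is the value of u at the base point s = 0.
  refine ⟨h3, u x, ?_⟩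
  filter_upwards [h1, h2] with s hs1 hs2
  rw [hs1, hg] at hs2
  simp only at hs2
  rw [sub_sub, sub_eq_zero] at hs2
  exact hs2

end LineDerivOfWeak

/-! ### Product and chain rules on the group -/

section LineCalculus
open Set Filter Topology
open scoped Pointwise

set_option linter.unusedSectionVars false

variable {E : Type*} [NormedAddCommGroup E] [NormedSpace ℝ E] [FiniteDimensional ℝ E]
  {G : Type*} [TopologicalSpace G] [ChartedSpace E G] [Group G]
  [LieGroup 𝓘(ℝ, E) ∞ G] [IsTopologicalGroup G] [LocallyCompactSpace G]
  [T2Space G] [SecondCountableTopology G] [MeasurableSpace G] [BorelSpace G]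
  {μ : Measure G} [μ.IsHaarMeasure] {F : Type*} [NormedAddCommGroup F] [NormedSpace ℝ F]
  {X : GroupLieAlgebra 𝓘(ℝ, E) G} {γ : ℝ → G}

theorem IsOneParam.ae_line (hγ : IsOneParam X γ) {p : G → Prop} (h : ∀ᵐ x ∂μ, p x) :
    ∀ᵐ x ∂μ, ∀ᵐ s : ℝ, p (x * γ s) :=
  Measure.ae_ae_of_ae_prod (hγ.quasiMeasurePreserving.ae h)

namespace HasLineDeriv

theorem add {u₁ v₁ u₂ v₂ : G → F} (h₁ : HasLineDeriv μ γ u₁ v₁) (h₂ : HasLineDeriv μ γ u₂ v₂) :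
    HasLineDeriv μ γ (fun x => u₁ x + u₂ x) (fun x => v₁ x + v₂ x) := by
  filter_upwards [h₁, h₂] with x h1 h2 using h1.add h2

theorem clm_apply [CompleteSpace F] {F' : Type*} [NormedAddCommGroup F'] [NormedSpace ℝ F']
    [CompleteSpace F'] (L : F →L[ℝ] F') {u v : G → F} (h : HasLineDeriv μ γ u v) :
    HasLineDeriv μ γ (fun x => L (u x)) (fun x => L (v x)) := by
  filter_upwards [h] with x h1 using h1.clm_apply L

theorem mul {u₁ v₁ u₂ v₂ : G → ℝ} (h₁ : HasLineDeriv μ γ u₁ v₁) (h₂ : HasLineDeriv μ γ u₂ v₂) :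
    HasLineDeriv μ γ (fun x => u₁ x * u₂ x) (fun x => v₁ x * u₂ x + u₁ x * v₂ x) := by
  filter_upwards [h₁, h₂] with x h1 h2 using h1.mul h2

theorem comp (hγ : IsOneParam X γ) {u v : G → ℝ} {Φ Φ' : ℝ → ℝ} (h : HasLineDeriv μ γ u v)
    (hu : ∀ᵐ x ∂μ, 0 ≤ u x) (hΦ : ∀ y, 0 ≤ y → HasDerivAt Φ (Φ' y) y)
    (hΦ' : ContinuousOn Φ' (Ici 0)) :
    HasLineDeriv μ γ (fun x => Φ (u x)) (fun x => Φ' (u x) * v x) := by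
  filter_upwards [h, hγ.ae_line hu] with x h1 h2 using h1.comp h2 hΦ hΦ'

theorem sqrt (hγ : IsOneParam X γ) {u v : G → ℝ} (h : HasLineDeriv μ γ u v)
    (hu : ∀ᵐ x ∂μ, 0 < u x) (hi : LocallyIntegrable (fun x => v x / (2 * √(u x))) μ) :
    HasLineDeriv μ γ (fun x => √(u x)) (fun x => v x / (2 * √(u x))) := by
  filter_upwards [h, hγ.ae_line hu, hγ.ae_locallyIntegrable hi] with x h1 h2 h3
  exact h1.sqrt h2 h3

theorem inv_sqrt (hγ : IsOneParam X γ) {u v : G → ℝ} (h : HasLineDeriv μ γ u v)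
    (hu : ∀ᵐ x ∂μ, 0 < u x) (hi : LocallyIntegrable (fun x => v x / (2 * u x * √(u x))) μ) :
    HasLineDeriv μ γ (fun x => (√(u x))⁻¹) (fun x => -(v x / (2 * u x * √(u x)))) := by
  filter_upwards [h, hγ.ae_line hu, hγ.ae_locallyIntegrable hi] with x h1 h2 h3
  exact h1.inv_sqrt h2 h3

theorem re {f f' : G → ℂ} (h : HasLineDeriv μ γ f f') :
    HasLineDeriv μ γ (fun x => (f x).re) (fun x => (f' x).re) := h.clm_apply Complex.reCLM

theorem im {f f' : G → ℂ} (h : HasLineDeriv μ γ f f') :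
    HasLineDeriv μ γ (fun x => (f x).im) (fun x => (f' x).im) := h.clm_apply Complex.imCLM

/-- The product rule for a complex and a real function. -/
theorem mul_ofReal {f f' : G → ℂ} {h h' : G → ℝ} (hf : HasLineDeriv μ γ f f')
    (hh : HasLineDeriv μ γ h h') :
    HasLineDeriv μ γ (fun x => f x * (h x : ℂ)) (fun x => f' x * (h x : ℂ) + f x * (h' x : ℂ)) := by
  have h1 := (hf.re.mul hh).clm_apply Complex.ofRealCLM
  have h2 := ((hf.im.mul hh).clm_apply Complex.ofRealCLM).clm_apply
    (ContinuousLinearMap.mul ℝ ℂ Complex.I)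
  refine Filter.Eventually.mono (h1.add h2) fun x hx => ?_
  have e1 : ∀ (z : ℂ) (r : ℝ), Complex.ofRealCLM (z.re * r) +
      (ContinuousLinearMap.mul ℝ ℂ Complex.I) (Complex.ofRealCLM (z.im * r)) = z * r := by
    intro z r
    apply Complex.ext <;> simp
  have e2 : ∀ (z z' : ℂ) (r r' : ℝ), Complex.ofRealCLM (z'.re * r + z.re * r') +
      (ContinuousLinearMap.mul ℝ ℂ Complex.I) (Complex.ofRealCLM (z'.im * r + z.im * r')) =
      z' * r + z * r' := by
    intro z z' r r'
    apply Complex.ext <;> simp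
  simp only [e1, e2] at hx
  exact hx

/-- The derivative of `|f|²`. -/
theorem normSq {f f' : G → ℂ} (hf : HasLineDeriv μ γ f f') :
    HasLineDeriv μ γ (fun x => ‖f x‖ ^ 2)
      (fun x => 2 * ((f x).re * (f' x).re + (f x).im * (f' x).im)) := by
  refine Filter.Eventually.mono ((hf.re.mul hf.re).add (hf.im.mul hf.im)) fun x hx => ?_
  convert hx using 2 with s s
  · exact (Complex.sq_norm _).trans (Complex.normSq_apply _)
  · ring

theorem of_hasDerivAt (hγ : IsOneParam X γ) {u v : G → ℝ}
    (h : ∀ x t, HasDerivAt (fun s => u (x * γ s)) (v (x * γ t)) t) (hv : Continuous v) :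
    HasLineDeriv μ γ u v :=
  Eventually.of_forall fun x => IsACDeriv.of_hasDerivAt (h x)
    (hv.comp (continuous_const.mul hγ.continuous))

end HasLineDeriv

end LineCalculus

/-! ### Integral operators with smooth, properly supported kernels -/

section Kernels
open Set Filter Topology
open scoped Pointwise

set_option linter.unusedSectionVars false

variable {E : Type*} [NormedAddCommGroup E] [NormedSpace ℝ E] [FiniteDimensional ℝ E]
  {G : Type*} [TopologicalSpace G] [ChartedSpace E G] [Group G]
  [LieGroup 𝓘(ℝ, E) ∞ G] [IsTopologicalGroup G] [LocallyCompactSpace G]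
  [T2Space G] [SecondCountableTopology G] [MeasurableSpace G] [BorelSpace G]
  {μ : Measure G} [μ.IsHaarMeasure] {X : GroupLieAlgebra 𝓘(ℝ, E) G} {γ : ℝ → G}

/-- `Φ x z` vanishes for `z` outside of a compact set, locally uniformly in `x`. -/
def ProperKernel (Φ : G → G → ℝ) : Prop :=
  ∀ K : Set G, IsCompact K → ∃ K' : Set G, IsCompact K' ∧ ∀ x ∈ K, ∀ z, z ∉ K' → Φ x z = 0

theorem fieldDeriv_eq_zero {φ : G → ℝ} {x : G} (h : φ =ᶠ[𝓝 x] fun _ => (0 : ℝ))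
    (X : GroupLieAlgebra 𝓘(ℝ, E) G) : fieldDeriv X φ x = 0 := by
  unfold fieldDeriv
  rw [h.mfderiv_eq, mfderiv_const]
  rfl

theorem ProperKernel.fieldDeriv {Φ : G → G → ℝ} (h : ProperKernel Φ)
    (X : GroupLieAlgebra 𝓘(ℝ, E) G) :
    ProperKernel fun x z => SubLap.fieldDeriv X (fun x => Φ x z) x := by
  intro K hK
  -- A derivative at x sees a neighbourhood of x, so the support condition is taken from a compact
  -- neighbourhood of K.
  obtain ⟨K₂, hK₂, hKK₂⟩ := exists_compact_superset hK
  obtain ⟨K', hK', h'⟩ := h K₂ hK₂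
  refine ⟨K', hK', fun x hx z hz => ?_⟩
  refine fieldDeriv_eq_zero ?_ X
  filter_upwards [isOpen_interior.mem_nhds (hKK₂ hx)] with y hy
  exact h' y (interior_subset hy) z hz

theorem ProperKernel.exists_bound {Φ : G → G → ℝ} (h : ProperKernel Φ)
    (hc : Continuous (Function.uncurry Φ)) {k : G → ℝ} (hk : LocallyIntegrable k μ)
    {K : Set G} (hK : IsCompact K) :
    ∃ B : G → ℝ, Integrable B μ ∧ ∀ x ∈ K, ∀ z, ‖Φ x z * k z‖ ≤ B z := by
  obtain ⟨K', hK', h'⟩ := h K hK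
  obtain ⟨C, hC⟩ := (hK.prod hK').exists_bound_of_continuousOn hc.continuousOn
  refine ⟨K'.indicator fun z => C * ‖k z‖, (integrable_indicator_iff hK'.measurableSet).2
    ((hk.norm'.integrableOn_isCompact hK').const_mul C), fun x hx z => ?_⟩
  by_cases hz : z ∈ K'
  · rw [indicator_of_mem hz, norm_mul]
    gcongr
    exact hC (x, z) ⟨hx, hz⟩
  · rw [indicator_of_notMem hz, h' x hx z hz]
    simp

theorem ProperKernel.integrable {Φ : G → G → ℝ} (h : ProperKernel Φ)
    (hc : Continuous (Function.uncurry Φ)) {k : G → ℝ} (hk : LocallyIntegrable k μ) (x : G) :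
    Integrable (fun z => Φ x z * k z) μ := by
  obtain ⟨B, hB, hb⟩ := h.exists_bound hc hk (isCompact_singleton (x := x))
  exact hB.mono' ((hc.comp (Continuous.prodMk_right x)).aestronglyMeasurable.mul
    hk.aestronglyMeasurable) (Eventually.of_forall (hb x rfl))

theorem ProperKernel.continuous_integral {Φ : G → G → ℝ} (h : ProperKernel Φ)
    (hc : Continuous (Function.uncurry Φ)) {k : G → ℝ} (hk : LocallyIntegrable k μ) :
    Continuous fun x => ∫ z, Φ x z * k z ∂μ := by
  refine continuous_iff_continuousAt.2 fun x => ?_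
  obtain ⟨N, hN, hxN⟩ := exists_compact_mem_nhds x
  obtain ⟨B, hB, hb⟩ := h.exists_bound hc hk hN
  refine continuousAt_of_dominated (bound := B) ?_ ?_ hB ?_
  · exact Eventually.of_forall fun y => (h.integrable hc hk y).1
  · filter_upwards [hxN] with y hy
    exact Eventually.of_forall (hb y hy)
  · exact Eventually.of_forall fun z =>
      ((hc.comp (Continuous.prodMk_left z)).mul continuous_const).continuousAt

theorem ProperKernel.hasDerivAt_integral {Φ : G → G → ℝ} (h : ProperKernel Φ)
    (hΦ : ContMDiff (𝓘(ℝ, E).prod 𝓘(ℝ, E)) 𝓘(ℝ, ℝ) ∞ (Function.uncurry Φ))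
    (hγ : IsOneParam X γ) {k : G → ℝ} (hk : LocallyIntegrable k μ) (x : G) (t : ℝ) :
    HasDerivAt (fun s => ∫ z, Φ (x * γ s) z * k z ∂μ)
      (∫ z, SubLap.fieldDeriv X (fun x => Φ x z) (x * γ t) * k z ∂μ) t := by
  have hc := hΦ.continuous
  have hXc := continuous_fieldDeriv_left hΦ X
  have hcomp : IsCompact ((fun s => x * γ s) '' Icc (t - 1) (t + 1)) :=
    isCompact_Icc.image (continuous_const.mul hγ.continuous)
  obtain ⟨B, hB, hb⟩ := (h.fieldDeriv X).exists_bound hXc hk hcomp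
  refine (hasDerivAt_integral_of_dominated_loc_of_deriv_le (bound := B)
      (F' := fun s z => SubLap.fieldDeriv X (fun x => Φ x z) (x * γ s) * k z)
      (Ioo_mem_nhds (by linarith : t - 1 < t) (by linarith : t < t + 1)) ?_ ?_ ?_ ?_ hB ?_).2
  · exact Eventually.of_forall fun s => (h.integrable hc hk _).1
  · exact h.integrable hc hk _
  · exact ((h.fieldDeriv X).integrable hXc hk _).1
  · exact Eventually.of_forall fun z s hs => hb _ ⟨s, ⟨hs.1.le, hs.2.le⟩, rfl⟩ z
  · refine Eventually.of_forall fun z s _ => HasDerivAt.mul_const ?_ (k z)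
    refine hγ.hasDerivAt (φ := fun x => Φ x z) (ContMDiff.mdifferentiableAt (n := ∞) ?_ (by simp))
    exact hΦ.comp (contMDiff_id.prodMk contMDiff_const)

theorem ProperKernel.hasLineDeriv {Φ : G → G → ℝ} (h : ProperKernel Φ)
    (hΦ : ContMDiff (𝓘(ℝ, E).prod 𝓘(ℝ, E)) 𝓘(ℝ, ℝ) ∞ (Function.uncurry Φ))
    (hγ : IsOneParam X γ) {k : G → ℝ} (hk : LocallyIntegrable k μ) :
    HasLineDeriv μ γ (fun x => ∫ z, Φ x z * k z ∂μ)
      (fun x => ∫ z, SubLap.fieldDeriv X (fun x => Φ x z) x * k z ∂μ) :=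
  HasLineDeriv.of_hasDerivAt hγ (h.hasDerivAt_integral hΦ hγ hk)
    ((h.fieldDeriv X).continuous_integral (continuous_fieldDeriv_left hΦ X) hk)

end Kernels

/-! ### Cutoff functions with uniformly bounded horizontal derivatives -/

section Cutoff
open Set Filter Topology
open scoped Pointwise

set_option linter.unusedSectionVars false

variable {E : Type*} [NormedAddCommGroup E] [NormedSpace ℝ E] [FiniteDimensional ℝ E]
  {G : Type*} [TopologicalSpace G] [ChartedSpace E G] [Group G]
  [LieGroup 𝓘(ℝ, E) ∞ G] [IsTopologicalGroup G] [LocallyCompactSpace G]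
  [T2Space G] [SecondCountableTopology G] [MeasurableSpace G] [BorelSpace G]

theorem IsTestFunction.fieldDeriv_mul_left {X : GroupLieAlgebra 𝓘(ℝ, E) G} {φ : G → ℝ}
    (hφ : IsTestFunction (E := E) φ) (y x : G) :
    fieldDeriv X (fun x => φ (y * x)) x = fieldDeriv X φ (y * x) := by
  obtain ⟨γ, hγ⟩ := exists_isOneParam X
  have h1 := hγ.hasDerivAt (φ := fun x => φ (y * x)) (x := x) (t := 0)
    ((hφ.smooth.comp (contMDiff_mul_left (a := y))).mdifferentiableAt (by simp))
  have h2 := hφ.hasDerivAt hγ (y * x) 0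
  rw [hγ.zero, mul_one] at h1 h2
  simp_rw [← mul_assoc] at h1
  exact h1.unique h2

theorem IsTestFunction.const_mul {φ : G → ℝ} (hφ : IsTestFunction (E := E) φ) (a : ℝ) :
    IsTestFunction (E := E) fun x => a * φ x where
  smooth := contMDiff_const.mul hφ.smooth
  compact := hφ.compact.mul_left

variable (μ : Measure G) [μ.IsHaarMeasure]

/-- The cutoffs are convolutions χ_n(x) = ∫ ρ(y⁻¹x) 1_{K_n}(y) dμ(y) over a compact exhaustion. A
left-invariant field falls on ρ alone, so |X_j χ_n| ≤ ∫ |X_j ρ(y⁻¹)| dμ(y) for every n, and no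
distance function is needed. -/
theorem exists_cutoff {ι : Type*} [Finite ι] (X : ι → GroupLieAlgebra 𝓘(ℝ, E) G)
    {γ : ι → ℝ → G} (hγ : ∀ j, IsOneParam (X j) (γ j)) :
    ∃ (χ : ℕ → G → ℝ) (D : ℕ → ι → G → ℝ) (C : ℝ),
      (∀ n, Continuous (χ n)) ∧ (∀ n j, Continuous (D n j)) ∧
      (∀ n x, 0 ≤ χ n x ∧ χ n x ≤ 1) ∧ (∀ n j x, |D n j x| ≤ C) ∧
      (∀ n, ∃ K, IsCompact K ∧ ∀ x, x ∉ K → χ n x = 0 ∧ ∀ j, D n j x = 0) ∧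
      (∀ x, ∀ᶠ n in atTop, χ n x = 1 ∧ ∀ j, D n j x = 0) ∧
      ∀ n j, HasLineDeriv μ (γ j) (χ n) (D n j) := by
  obtain ⟨ρ₀, hρ₀, hρ₀0, hρ₀1, -⟩ := exists_isTestFunction (E := E) (univ_mem : univ ∈ 𝓝 (1 : G))
  have hN : 0 < ∫ y, ρ₀ y⁻¹ ∂μ := by
    refine (hρ₀.smooth.continuous.comp continuous_inv).integral_pos_of_hasCompactSupport_nonneg_nonzero
      (hρ₀.compact.comp_homeomorph (Homeomorph.inv G)) (fun y => hρ₀0 _) (x := 1) ?_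
    simp [hρ₀1]
  -- Normalisation by N gives ∫ ρ(y⁻¹) = 1, so χ_n ≤ 1 with equality once K_n contains x·supp(ρ)⁻¹.
  set N := ∫ y, ρ₀ y⁻¹ ∂μ
  set ρ : G → ℝ := fun x => N⁻¹ * ρ₀ x with hρdef
  have hρ : IsTestFunction (E := E) ρ := hρ₀.const_mul _
  have hρ0 : ∀ y, 0 ≤ ρ y := fun y => mul_nonneg (inv_nonneg.2 hN.le) (hρ₀0 y)
  have hρ1 : ∫ y, ρ y⁻¹ ∂μ = 1 := by
    rw [hρdef, integral_const_mul]
    exact inv_mul_cancel₀ hN.ne'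
  set Φ : G → G → ℝ := fun x y => ρ (y⁻¹ * x) with hΦdef
  have hΦ : ContMDiff (𝓘(ℝ, E).prod 𝓘(ℝ, E)) 𝓘(ℝ, ℝ) ∞ (Function.uncurry Φ) :=
    hρ.smooth.comp (contMDiff_snd.inv.mul contMDiff_fst)
  have hsup : ∀ x y, y ∉ ({x} * (tsupport ρ)⁻¹ : Set G) → y⁻¹ * x ∉ tsupport ρ := by
    intro x y hy h
    exact hy ⟨x, rfl, x⁻¹ * y, by simpa using h, by simp⟩
  have hprop : ProperKernel Φ := by
    intro K hK
    refine ⟨K * (tsupport ρ)⁻¹, hK.mul hρ.compact.isCompact.inv, fun x hx y hy => ?_⟩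
    exact image_eq_zero_of_notMem_tsupport (f := ρ)
      (hsup x y fun h => hy (mul_subset_mul_right (singleton_subset_iff.2 hx) h))
  have hD : ∀ j x y, fieldDeriv (X j) (fun x => Φ x y) x = fieldDeriv (X j) ρ (y⁻¹ * x) :=
    fun j x y => hρ.fieldDeriv_mul_left y⁻¹ x
  let Ks : CompactExhaustion G := CompactExhaustion.choice G
  have hKm : ∀ n, MeasurableSet (Ks n) := fun n => (Ks.isCompact n).measurableSet
  have hk1 : LocallyIntegrable (fun _ : G => (1 : ℝ)) μ := locallyIntegrable_const 1
  have hk : ∀ n, LocallyIntegrable ((Ks n).indicator fun _ => (1 : ℝ)) μ := fun n =>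
    hk1.indicator (hKm n)
  -- left invariance
  have hinv : ∀ (q : G → ℝ) x, ∫ y, q (y⁻¹ * x) ∂μ = ∫ y, q y⁻¹ ∂μ := by
    intro q x
    rw [← integral_mul_left_eq_self (μ := μ) (fun y => q (y⁻¹ * x)) x]
    simp
  -- Differentiating the constant function x ↦ ∫ ρ(y⁻¹x) = 1. This makes the derivatives of χ_n at a
  -- given point vanish for large n.
  have hD0 : ∀ j, ∫ y, fieldDeriv (X j) ρ y⁻¹ ∂μ = 0 := by
    intro j
    have h1 := hprop.hasDerivAt_integral hΦ (hγ j) hk1 1 0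
    have e1 : (fun s => ∫ z, Φ (1 * γ j s) z * 1 ∂μ) = fun _ => 1 := by
      funext s
      simp only [mul_one]
      exact (hinv ρ _).trans hρ1
    rw [e1] at h1
    have h2 := h1.unique (hasDerivAt_const _ _)
    simp only [mul_one] at h2
    refine Eq.trans ?_ h2
    rw [← hinv (fieldDeriv (X j) ρ) (1 * γ j 0)]
    exact integral_congr_ae (Eventually.of_forall fun y => (hD j _ y).symm)
  have hint : ∀ q : G → ℝ, Continuous q → HasCompactSupport q → ∀ x,
      Integrable (fun y => q (y⁻¹ * x)) μ := by
    intro q hq hqc x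
    refine (hq.comp (continuous_inv.mul continuous_const)).integrable_of_hasCompactSupport ?_
    exact hqc.comp_homeomorph ((Homeomorph.inv G).trans (Homeomorph.mulRight x))
  have hXc := fun j => hρ.continuous_fieldDeriv (X j)
  have hXs := fun j => hρ.hasCompactSupport_fieldDeriv (X j)
  refine ⟨fun n x => ∫ y, Φ x y * (Ks n).indicator (fun _ => 1) y ∂μ,
    fun n j x => ∫ y, fieldDeriv (X j) (fun x => Φ x y) x * (Ks n).indicator (fun _ => 1) y ∂μ,
    ∑ᶠ j, ∫ y, |fieldDeriv (X j) ρ y⁻¹| ∂μ, ?_, ?_, ?_, ?_, ?_, ?_, ?_⟩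
  · exact fun n => hprop.continuous_integral hΦ.continuous (hk n)
  · exact fun n j => (hprop.fieldDeriv (X j)).continuous_integral
      (continuous_fieldDeriv_left hΦ (X j)) (hk n)
  · refine fun n x => ⟨integral_nonneg fun y => mul_nonneg (hρ0 _)
      (indicator_nonneg (fun _ _ => zero_le_one) _), ?_⟩
    refine le_trans ?_ ((hinv ρ x).trans hρ1).le
    refine integral_mono (hprop.integrable hΦ.continuous (hk n) x)
      (hint ρ hρ.smooth.continuous hρ.compact x) fun y => ?_
    refine mul_le_of_le_one_right (hρ0 _) (indicator_le_self' (fun _ _ => zero_le_one) _)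
  · intro n j x
    have hfin : (Function.support fun j => ∫ y, |fieldDeriv (X j) ρ y⁻¹| ∂μ).Finite :=
      Set.toFinite _
    refine le_trans ?_ (single_le_finsum j hfin fun i => integral_nonneg fun y => abs_nonneg _)
    rw [← hinv (fun z => |fieldDeriv (X j) ρ z|) x]
    refine abs_integral_le_integral_abs.trans (integral_mono_of_nonneg
      (Eventually.of_forall fun y => abs_nonneg _) (hint _ (hXc j) (hXs j) x).abs
      (Eventually.of_forall fun y => ?_))
    simp only [hD, abs_mul]
    refine mul_le_of_le_one_right (abs_nonneg _) ?_
    by_cases hy : y ∈ Ks n <;> simp [hy]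
  · intro n
    refine ⟨Ks n * tsupport ρ, (Ks.isCompact n).mul hρ.compact.isCompact, fun x hx => ?_⟩
    have hz : ∀ y, y ∈ Ks n → y⁻¹ * x ∉ tsupport ρ := fun y hy h => hx ⟨y, hy, _, h, by simp⟩
    refine ⟨integral_eq_zero_of_ae (Eventually.of_forall fun y => ?_), fun j =>
      integral_eq_zero_of_ae (Eventually.of_forall fun y => ?_)⟩
    · by_cases hy : y ∈ Ks n
      · simp [hΦdef, image_eq_zero_of_notMem_tsupport (hz y hy)]
      · simp [hy]
    · by_cases hy : y ∈ Ks n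
      · have : fieldDeriv (X j) ρ (y⁻¹ * x) = 0 :=
          fieldDeriv_eq_zero (notMem_tsupport_iff_eventuallyEq.1 (hz y hy)) _
        simp [hD, this]
      · simp [hy]
  · intro x
    obtain ⟨n₀, hn₀⟩ := Ks.exists_superset_of_isCompact
      ((isCompact_singleton (x := x)).mul hρ.compact.isCompact.inv)
    filter_upwards [eventually_ge_atTop n₀] with n hn
    have hout : ∀ y, y ∉ Ks n → y⁻¹ * x ∉ tsupport ρ := fun y hy =>
      hsup x y fun h => hy (Ks.subset hn (hn₀ h))
    refine ⟨?_, fun j => ?_⟩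
    · refine Eq.trans ?_ ((hinv ρ x).trans hρ1)
      refine integral_congr_ae (Eventually.of_forall fun y => ?_)
      by_cases hy : y ∈ Ks n
      · simp [hy, hΦdef]
      · simp [hy, image_eq_zero_of_notMem_tsupport (hout y hy)]
    · rw [← hD0 j, ← hinv (fieldDeriv (X j) ρ) x]
      refine integral_congr_ae (Eventually.of_forall fun y => ?_)
      by_cases hy : y ∈ Ks n
      · simp [hy, hD]
      · have : fieldDeriv (X j) ρ (y⁻¹ * x) = 0 :=
          fieldDeriv_eq_zero (notMem_tsupport_iff_eventuallyEq.1 (hout y hy)) _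
        simp [hy, this]
  · exact fun n j => hprop.hasLineDeriv hΦ (hγ j) (hk n)

end Cutoff

/-! ### Left-invariant derivatives of test functions are test functions -/

section SmoothDerivative
open Set Filter Topology

set_option linter.unusedSectionVars false

variable {E : Type*} [NormedAddCommGroup E] [NormedSpace ℝ E] [FiniteDimensional ℝ E]
  {G : Type*} [TopologicalSpace G] [ChartedSpace E G] [Group G]
  [LieGroup 𝓘(ℝ, E) ∞ G]

/-- By left invariance the derivative at x can be taken at the identity in one fixed chart, with x
entering only as a parameter of u ↦ φ(x·e⁻¹(u)). Smoothness in x is then smooth dependence on a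
parameter. -/
theorem fieldDeriv_eq_fderiv (X : GroupLieAlgebra 𝓘(ℝ, E) G) {φ : G → ℝ}
    (hφ : ContMDiff 𝓘(ℝ, E) 𝓘(ℝ, ℝ) ∞ φ) (x : G) :
    fieldDeriv X φ x = (fderiv ℝ (fun u => φ (x * (extChartAt 𝓘(ℝ, E) (1 : G)).symm u))
      (extChartAt 𝓘(ℝ, E) (1 : G) 1) : E →L[ℝ] ℝ) (X : E) := by
  have hL : MDifferentiableAt 𝓘(ℝ, E) 𝓘(ℝ, E) (fun v : G => x * v) 1 :=
    (contMDiff_mul_left (I := 𝓘(ℝ, E)) (n := ∞) (a := x)).mdifferentiableAt (by simp)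
  have h0 : ∀ z, z = x → HasMFDerivAt 𝓘(ℝ, E) 𝓘(ℝ, ℝ) φ z
      (mfderiv 𝓘(ℝ, E) 𝓘(ℝ, ℝ) φ x : E →L[ℝ] ℝ) := by
    rintro _ rfl
    exact (hφ.mdifferentiableAt (by simp)).hasMFDerivAt
  have h1 := ((h0 (x * 1) (mul_one x)).comp 1 hL.hasMFDerivAt).mfderiv
  have h2 : MDifferentiableAt 𝓘(ℝ, E) 𝓘(ℝ, ℝ) (φ ∘ fun v : G => x * v) 1 :=
    (hφ.comp (contMDiff_mul_left (n := ∞) (a := x))).mdifferentiableAt (by simp)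
  have h3 : (mfderiv 𝓘(ℝ, E) 𝓘(ℝ, ℝ) (φ ∘ fun v : G => x * v) 1 : E →L[ℝ] ℝ) =
      fderiv ℝ (fun u => φ (x * (extChartAt 𝓘(ℝ, E) (1 : G)).symm u))
        (extChartAt 𝓘(ℝ, E) (1 : G) 1) := by
    rw [h2.mfderiv]
    simp only [modelWithCornersSelf_coe, range_id, fderivWithin_univ]
    rfl
  rw [← h3]
  exact (congrArg (fun L : E →L[ℝ] ℝ => L (X : E)) h1).symm

theorem IsTestFunction.isTestFunction_fieldDeriv {φ : G → ℝ} (hφ : IsTestFunction (E := E) φ)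
    (X : GroupLieAlgebra 𝓘(ℝ, E) G) : IsTestFunction (E := E) (fieldDeriv X φ) where
  compact := hφ.hasCompactSupport_fieldDeriv X
  smooth := fun x₀ => by
    have hM : IsManifold 𝓘(ℝ, E) 1 G := IsManifold.of_le (n := ∞) (by simp)
    set e := extChartAt 𝓘(ℝ, E) (1 : G) with he
    have h1 : ContMDiffAt 𝓘(ℝ, E) 𝓘(ℝ, E) ∞ e.symm (e 1) :=
      (contMDiffOn_extChartAt_symm (1 : G)).contMDiffAt
        ((isOpen_extChartAt_target (1 : G)).mem_nhds (mem_extChartAt_target (1 : G)))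
    have h2 : ContMDiffAt (𝓘(ℝ, E).prod 𝓘(ℝ, E)) 𝓘(ℝ, ℝ) ∞
        (Function.uncurry fun (x : G) u => φ (x * e.symm u)) (x₀, e 1) := by
      refine ContMDiffAt.comp (x₀, e 1) (hφ.smooth _) (ContMDiffAt.mul contMDiffAt_fst ?_)
      exact ContMDiffAt.comp (x₀, e 1) h1 contMDiffAt_snd
    have h3 := ContMDiffAt.mfderiv (m := ∞) (n := ∞) (x₀ := x₀)
      (fun (x : G) u => φ (x * e.symm u)) (fun _ => e 1) h2 contMDiffAt_const (by simp)
    have h5 : inTangentCoordinates 𝓘(ℝ, E) 𝓘(ℝ, ℝ) (fun _ => e 1)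
        (fun x : G => φ (x * e.symm (e 1)))
        (fun x => mfderiv 𝓘(ℝ, E) 𝓘(ℝ, ℝ) (fun u => φ (x * e.symm u)) (e 1)) x₀ =
        (fun x => mfderiv 𝓘(ℝ, E) 𝓘(ℝ, ℝ) (fun u => φ (x * e.symm u)) (e 1)) :=
      inTangentCoordinates_model_space (I := 𝓘(ℝ, E)) (I' := 𝓘(ℝ, ℝ)) _ _ _ x₀
    rw [h5] at h3
    simp only [mfderiv_eq_fderiv] at h3
    have h6 : fieldDeriv X φ = fun x => (fderiv ℝ (fun u => φ (x * e.symm u)) (e 1) : E →L[ℝ] ℝ)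
        (X : E) := funext fun x => fieldDeriv_eq_fderiv X hφ.smooth x
    rw [h6]
    exact h3.clm_apply contMDiffAt_const

end SmoothDerivative

/-! ### Mollification by left convolution -/

section Mollifier
open Set Filter Topology
open scoped Pointwise

set_option linter.unusedSectionVars false

variable {E : Type*} [NormedAddCommGroup E] [NormedSpace ℝ E] [FiniteDimensional ℝ E]
  {G : Type*} [TopologicalSpace G] [ChartedSpace E G] [Group G]
  [LieGroup 𝓘(ℝ, E) ∞ G] [IsTopologicalGroup G] [LocallyCompactSpace G]
  [T2Space G] [SecondCountableTopology G] [MeasurableSpace G] [BorelSpace G]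
  {μ : Measure G} [μ.IsHaarMeasure] {X : GroupLieAlgebra 𝓘(ℝ, E) G} {γ : ℝ → G}

/-- Left convolution of `g` with the weight `κ`. -/
noncomputable def mollify (μ : Measure G) (κ g : G → ℝ) (x : G) : ℝ := ∫ y, κ y * g (y * x) ∂μ

theorem integral_mollify_integrand_aux {κ p g : G → ℝ} (hκ : Continuous κ)
    (hκc : HasCompactSupport κ) (hp : Continuous p) (hpc : HasCompactSupport p)
    (hg : LocallyIntegrable g μ) :
    Integrable (fun q : G × G => p q.1 * (κ q.2 * g (q.2 * q.1))) (μ.prod μ) := by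
  have hT : Measure.QuasiMeasurePreserving (fun q : G × G => q.2 * q.1) (μ.prod μ) μ :=
    QuasiMeasurePreserving.prod_of_left (continuous_snd.mul continuous_fst).measurable
      (Eventually.of_forall fun y => (measurePreserving_mul_left μ y).quasiMeasurePreserving)
  have hm : AEStronglyMeasurable (fun q : G × G => p q.1 * (κ q.2 * g (q.2 * q.1))) (μ.prod μ) :=
    (hp.comp continuous_fst).aestronglyMeasurable.mul
      ((hκ.comp continuous_snd).aestronglyMeasurable.mul
        (hg.aestronglyMeasurable.comp_quasiMeasurePreserving hT))
  obtain ⟨Cp, hCp⟩ := hpc.exists_bound_of_continuous hp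
  obtain ⟨Ck, hCk⟩ := hκc.exists_bound_of_continuous hκ
  -- Wherever the integrand is nonzero, y x lies in this compact product; g is locally integrable,
  -- hence integrable there.
  set K := tsupport κ * tsupport p with hK
  have hKc : IsCompact K := hκc.isCompact.mul hpc.isCompact
  have hgK : Integrable (K.indicator g) μ :=
    (integrable_indicator_iff hKc.measurableSet).2 (hg.integrableOn_isCompact hKc)
  have hb : Integrable (fun q : G × G => (tsupport κ).indicator (fun _ => Cp * Ck) q.2 *
      ‖K.indicator g (q.2 * q.1)‖) (μ.prod μ) := by
    have hm2 : AEStronglyMeasurable (fun q : G × G => (tsupport κ).indicator (fun _ => Cp * Ck) q.2 *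
      ‖K.indicator g (q.2 * q.1)‖) (μ.prod μ) := by
      refine AEStronglyMeasurable.mul ?_ (hgK.1.comp_quasiMeasurePreserving hT).norm
      exact ((aestronglyMeasurable_const (μ := μ)).indicator
        (isClosed_tsupport κ).measurableSet).comp_snd
    refine (integrable_prod_iff' hm2).2 ⟨Eventually.of_forall fun y => ?_, ?_⟩
    · exact Integrable.const_mul (f := fun x => ‖K.indicator g (y * x)‖)
        (hgK.norm.comp_mul_left y) ((tsupport κ).indicator (fun _ => Cp * Ck) y)
    · have e : ∀ y, ∫ x, ‖(tsupport κ).indicator (fun _ => Cp * Ck) y *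
          ‖K.indicator g (y * x)‖‖ ∂μ = ‖(tsupport κ).indicator (fun _ => Cp * Ck) y‖ *
            ∫ x, ‖K.indicator g x‖ ∂μ := by
        intro y
        simp_rw [norm_mul, norm_norm, integral_const_mul]
        rw [integral_mul_left_eq_self (μ := μ) (fun x => ‖K.indicator g x‖) y]
      simp_rw [e]
      refine Integrable.mul_const (Integrable.norm ?_) _
      exact (integrable_indicator_iff (isClosed_tsupport κ).measurableSet).2
        (continuous_const.locallyIntegrable.integrableOn_isCompact hκc.isCompact)
  refine hb.mono' hm (Eventually.of_forall fun q => ?_)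
  by_cases h1 : q.2 ∈ tsupport κ
  · by_cases h2 : q.1 ∈ tsupport p
    · have h3 : q.2 * q.1 ∈ K := mul_mem_mul h1 h2
      rw [indicator_of_mem h1, indicator_of_mem h3, norm_mul, norm_mul, ← mul_assoc]
      exact mul_le_mul_of_nonneg_right (mul_le_mul (hCp _) (hCk _) (norm_nonneg _)
        ((norm_nonneg _).trans (hCp q.1))) (norm_nonneg _)
    · rw [image_eq_zero_of_notMem_tsupport h2, zero_mul, norm_zero]
      rw [indicator_of_mem h1]
      exact mul_nonneg (mul_nonneg ((norm_nonneg _).trans (hCp 1)) ((norm_nonneg _).trans (hCk 1)))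
        (norm_nonneg _)
  · rw [image_eq_zero_of_notMem_tsupport h1, zero_mul, mul_zero, norm_zero,
      indicator_of_notMem h1, zero_mul]

/-- Fubini and left invariance of μ turn the mollification of g into an average over left translates
of p. Left-invariant derivatives commute with these translates. -/
theorem integral_mul_mollify {κ p g : G → ℝ} (hκ : Continuous κ)
    (hκc : HasCompactSupport κ) (hp : Continuous p) (hpc : HasCompactSupport p)
    (hg : LocallyIntegrable g μ) :
    ∫ x, p x * mollify μ κ g x ∂μ = ∫ y, κ y * (∫ x, p (y⁻¹ * x) * g x ∂μ) ∂μ := by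
  simp_rw [mollify, ← integral_const_mul]
  rw [integral_integral_swap (f := fun x y => p x * (κ y * g (y * x)))
    (integral_mollify_integrand_aux hκ hκc hp hpc hg)]
  refine integral_congr_ae (Eventually.of_forall fun y => ?_)
  have := integral_mul_left_eq_self (μ := μ) (fun x => κ y * (p (y⁻¹ * x) * g x)) y
  simp only [inv_mul_cancel_left] at this
  simp only
  rw [← this]
  exact integral_congr_ae (Eventually.of_forall fun x => by simp only; ring)

theorem continuous_modularCharacterFun : Continuous fun z : G =>
    (Measure.modularCharacterFun z : ℝ) := by
  let μ : Measure G := Measure.haar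
  obtain ⟨ρ, hρc, hρ0, hρ1⟩ := exists_continuous_nonneg_pos (1 : G)
  have hpos : 0 < ∫ x, ρ x ∂μ :=
    ρ.continuous.integral_pos_of_hasCompactSupport_nonneg_nonzero hρc hρ0 hρ1
  have hprop : ProperKernel fun y x : G => ρ (x * y) := by
    intro K hK
    refine ⟨tsupport ρ * K⁻¹, hρc.isCompact.mul hK.inv, fun y hy x hx => ?_⟩
    exact image_eq_zero_of_notMem_tsupport (f := ρ) fun h => hx ⟨_, h, y⁻¹, by simpa using hy, by simp⟩
  have hc := hprop.continuous_integral (μ := μ) (k := fun _ => 1)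
    (ρ.continuous.comp (continuous_snd.mul continuous_fst)) (locallyIntegrable_const 1)
  have : (fun z : G => (Measure.modularCharacterFun z : ℝ)) =
      fun z => (∫ x, ρ (x * z) * 1 ∂μ) / ∫ x, ρ x ∂μ := by
    funext z
    simp only [mul_one]
    rw [integral_mul_right_eq μ ρ z, smul_eq_mul, mul_div_cancel_right₀ _ hpos.ne']
  rw [this]
  exact hc.div_const _

/-- Substituting z = yx moves the dependence on x from g to the smooth factor ρ(z x⁻¹). The modular
factor built into the weight absorbs the Jacobian, so the mollification of a locally integrable
function is differentiable. -/
theorem mollify_eq_kernel {ρ g : G → ℝ} (x : G) :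
    mollify μ (fun y => ρ y * Measure.modularCharacterFun y) g x =
      ∫ z, ρ (z * x⁻¹) * ((Measure.modularCharacterFun z : ℝ) * g z) ∂μ := by
  have h := integral_mul_right_eq μ
    (fun z => ρ (z * x⁻¹) * (Measure.modularCharacterFun (z * x⁻¹) : ℝ) * g z) x
  simp only [mul_inv_cancel_right] at h
  refine h.trans ?_
  rw [smul_eq_mul, ← integral_const_mul]
  refine integral_congr_ae (Eventually.of_forall fun z => ?_)
  have hx : (Measure.modularCharacterFun x : ℝ) * Measure.modularCharacterFun x⁻¹ = 1 := by
    rw [← NNReal.coe_mul, ← Measure.modularCharacterFun_map_mul, mul_inv_cancel,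
      Measure.modularCharacterFun_map_one, NNReal.coe_one]
  simp only [Measure.modularCharacterFun_map_mul, NNReal.coe_mul]
  linear_combination (ρ (z * x⁻¹) * Measure.modularCharacterFun z * g z) * hx

theorem contMDiff_mollify_kernel {ρ : G → ℝ} (hρ : IsTestFunction (E := E) ρ) :
    ContMDiff (𝓘(ℝ, E).prod 𝓘(ℝ, E)) 𝓘(ℝ, ℝ) ∞ (Function.uncurry fun x z : G => ρ (z * x⁻¹)) :=
  hρ.smooth.comp (contMDiff_snd.mul contMDiff_fst.inv)

theorem properKernel_mollify_kernel {ρ : G → ℝ} (hρ : HasCompactSupport ρ) :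
    ProperKernel fun x z : G => ρ (z * x⁻¹) := by
  intro K hK
  refine ⟨tsupport ρ * K, hρ.isCompact.mul hK, fun x hx z hz => ?_⟩
  exact image_eq_zero_of_notMem_tsupport (f := ρ) fun h => hz ⟨_, h, x, hx, by simp⟩

theorem locallyIntegrable_modular_mul {g : G → ℝ} (hg : LocallyIntegrable g μ) :
    LocallyIntegrable (fun z => (Measure.modularCharacterFun z : ℝ) * g z) μ := by
  refine locallyIntegrable_iff.2 fun K hK => ?_
  exact (hg.integrableOn_isCompact hK).continuousOn_mul continuous_modularCharacterFun.continuousOn hK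

theorem continuous_mollify {ρ g : G → ℝ} (hρ : IsTestFunction (E := E) ρ)
    (hg : LocallyIntegrable g μ) :
    Continuous (mollify μ (fun y => ρ y * Measure.modularCharacterFun y) g) := by
  have := (properKernel_mollify_kernel hρ.compact).continuous_integral
    (contMDiff_mollify_kernel hρ).continuous (locallyIntegrable_modular_mul hg)
  simpa only [← mollify_eq_kernel] using this

theorem exists_hasLineDeriv_mollify {ρ g : G → ℝ} (hρ : IsTestFunction (E := E) ρ)
    (hg : LocallyIntegrable g μ) (hγ : IsOneParam X γ) : ∃ P : G → ℝ, Continuous P ∧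
      HasLineDeriv μ γ (mollify μ (fun y => ρ y * Measure.modularCharacterFun y) g) P := by
  have h := (properKernel_mollify_kernel hρ.compact).hasLineDeriv
    (contMDiff_mollify_kernel hρ) hγ (locallyIntegrable_modular_mul hg)
  simp only [← mollify_eq_kernel] at h
  exact ⟨_, ((properKernel_mollify_kernel hρ.compact).fieldDeriv X).continuous_integral
    (continuous_fieldDeriv_left (contMDiff_mollify_kernel hρ) X)
    (locallyIntegrable_modular_mul hg), h⟩

theorem IsTestFunction.comp_mul_left {φ : G → ℝ} (hφ : IsTestFunction (E := E) φ) (y : G) :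
    IsTestFunction (E := E) fun x => φ (y * x) where
  smooth := hφ.smooth.comp (contMDiff_mul_left (a := y))
  compact := hφ.compact.comp_homeomorph (Homeomorph.mulLeft y)

theorem IsWeakDeriv.mollify_apply {ρ g v : G → ℝ} (hρ : IsTestFunction (E := E) ρ)
    (h : IsWeakDeriv μ X g v) :
    IsWeakDeriv μ X (mollify μ (fun y => ρ y * Measure.modularCharacterFun y) g)
      (mollify μ (fun y => ρ y * Measure.modularCharacterFun y) v) where
  locInt := (continuous_mollify hρ h.locInt).locallyIntegrable
  locInt_deriv := (continuous_mollify hρ h.locInt_deriv).locallyIntegrable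
  integral_eq φ hφ := by
    have hκ : Continuous fun y => ρ y * (Measure.modularCharacterFun y : ℝ) :=
      hρ.smooth.continuous.mul continuous_modularCharacterFun
    simp only [smul_eq_mul]
    rw [integral_mul_mollify hκ hρ.compact.mul_right hφ.smooth.continuous hφ.compact h.locInt_deriv,
      integral_mul_mollify (p := fun x => fieldDeriv X φ x + modularDeriv X * φ x)
        hκ hρ.compact.mul_right
        ((hφ.continuous_fieldDeriv X).add (continuous_const.mul hφ.smooth.continuous))
        ((hφ.hasCompactSupport_fieldDeriv X).add hφ.compact.mul_left) h.locInt,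
      ← integral_neg]
    refine integral_congr_ae (Eventually.of_forall fun y => ?_)
    have h1 := h.integral_eq _ (hφ.comp_mul_left y⁻¹)
    simp only [smul_eq_mul, hφ.fieldDeriv_mul_left] at h1
    simp only [h1, mul_neg]

end Mollifier

/-! ### The equation of a mollified weight, tested against nonsmooth functions -/

section SubLaplacian
open Set Filter Topology
open scoped Pointwise

set_option linter.unusedSectionVars false

variable {E : Type*} [NormedAddCommGroup E] [NormedSpace ℝ E] [FiniteDimensional ℝ E]
  {G : Type*} [TopologicalSpace G] [ChartedSpace E G] [Group G]
  [LieGroup 𝓘(ℝ, E) ∞ G] [IsTopologicalGroup G] [LocallyCompactSpace G]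
  [T2Space G] [SecondCountableTopology G] [MeasurableSpace G] [BorelSpace G]
  {μ : Measure G} [μ.IsHaarMeasure] {S : SubRiemannian E G}

/-- Divergence form of the equation: X_j φ is itself a test function, and the adjoint of X_j applied
to it produces the j-th summand of Lφ. -/
theorem IsWeakSubLaplacian.sum_integral_fieldDeriv {w Lw : G → ℝ} {Dw : Fin S.dim → G → ℝ}
    (hL : IsWeakSubLaplacian S μ w Lw) (hD : ∀ j, IsWeakDeriv μ (S.X j) w (Dw j)) {φ : G → ℝ}
    (hφ : IsTestFunction (E := E) φ) :
    ∑ j, ∫ x, fieldDeriv (S.X j) φ x * Dw j x ∂μ = ∫ x, φ x * Lw x ∂μ := by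
  have h1 := fun j => (hD j).integral_eq _ (hφ.isTestFunction_fieldDeriv (S.X j))
  simp only [smul_eq_mul] at h1
  have h2 := fun j => (hφ.isTestFunction_fieldDeriv (S.X j)).integrable_adjoint_smul
    (X := S.X j) hL.locInt
  simp only [smul_eq_mul] at h2
  rw [hL.integral_eq φ hφ]
  simp_rw [h1, subLaplacian, neg_mul, Finset.sum_mul]
  rw [integral_neg, integral_finsetSum _ fun j _ => h2 j, Finset.sum_neg_distrib]

theorem IsWeakSubLaplacian.sum_integral_mollify_fieldDeriv {w Lw : G → ℝ} {Dw : Fin S.dim → G → ℝ}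
    (hL : IsWeakSubLaplacian S μ w Lw) (hD : ∀ j, IsWeakDeriv μ (S.X j) w (Dw j)) {ρ φ : G → ℝ}
    (hρ : IsTestFunction (E := E) ρ) (hφ : IsTestFunction (E := E) φ) :
    ∑ j, ∫ x, fieldDeriv (S.X j) φ x *
        mollify μ (fun y => ρ y * Measure.modularCharacterFun y) (Dw j) x ∂μ =
      ∫ x, φ x * mollify μ (fun y => ρ y * Measure.modularCharacterFun y) Lw x ∂μ := by
  have hκ : Continuous fun y => ρ y * (Measure.modularCharacterFun y : ℝ) :=
    hρ.smooth.continuous.mul continuous_modularCharacterFun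
  have hκc : HasCompactSupport fun y => ρ y * (Measure.modularCharacterFun y : ℝ) :=
    hρ.compact.mul_right
  have hi : ∀ j, Integrable (fun y => ρ y * (Measure.modularCharacterFun y : ℝ) *
      ∫ x, fieldDeriv (S.X j) φ (y⁻¹ * x) * Dw j x ∂μ) μ := by
    intro j
    have := (integral_mollify_integrand_aux hκ hκc (hφ.continuous_fieldDeriv (S.X j))
      (hφ.hasCompactSupport_fieldDeriv (S.X j)) (hD j).locInt_deriv).integral_prod_right
    refine this.congr (Eventually.of_forall fun y => ?_)
    have h := integral_mul_left_eq_self (μ := μ) (fun x => ρ y * (Measure.modularCharacterFun y : ℝ)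
      * (fieldDeriv (S.X j) φ (y⁻¹ * x) * Dw j x)) y
    simp only [inv_mul_cancel_left] at h
    refine Eq.trans ?_ (h.trans (integral_const_mul _ _))
    exact integral_congr_ae (Eventually.of_forall fun x => by simp only; ring)
  rw [integral_mul_mollify hκ hκc hφ.smooth.continuous hφ.compact hL.locInt_subLaplacian]
  simp_rw [fun j => integral_mul_mollify hκ hκc (hφ.continuous_fieldDeriv (S.X j))
      (hφ.hasCompactSupport_fieldDeriv (S.X j)) (hD j).locInt_deriv]
  rw [← integral_finsetSum _ fun j _ => hi j]
  refine integral_congr_ae (Eventually.of_forall fun y => ?_)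
  have h1 := hL.sum_integral_fieldDeriv hD (hφ.comp_mul_left y⁻¹)
  simp only [hφ.fieldDeriv_mul_left] at h1
  simp only [← Finset.mul_sum, h1]

theorem exists_isTestFunction_eq_one {K : Set G} (hK : IsCompact K) :
    ∃ η : G → ℝ, IsTestFunction (E := E) η ∧ (∀ x ∈ K, η x = 1) ∧
      ∀ (X : GroupLieAlgebra 𝓘(ℝ, E) G), ∀ x ∈ K, fieldDeriv X η x = 0 := by
  obtain ⟨K', hK', hKK'⟩ := exists_compact_superset hK
  obtain ⟨η, h1, h0, -⟩ := exists_contMDiffMap_one_nhds_of_subset_interior (n := (⊤ : ℕ∞)) 𝓘(ℝ, E)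
    hK.isClosed hKK'
  refine ⟨η, ⟨η.contMDiff, HasCompactSupport.intro hK' h0⟩, fun x hx => h1.self_of_nhdsSet x hx,
    fun X x hx => ?_⟩
  have h2 : (η : G → ℝ) =ᶠ[𝓝 x] fun _ => (1 : ℝ) := h1.filter_mono (nhds_le_nhdsSet hx)
  unfold fieldDeriv
  rw [h2.mfderiv_eq, mfderiv_const]
  rfl

/-- Tested against a function equal to 1 on K, whose derivatives vanish on K. -/
theorem IsWeakDeriv.integral_eq_of_support {X : GroupLieAlgebra 𝓘(ℝ, E) G} {u v : G → ℝ}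
    (h : IsWeakDeriv μ X u v) {K : Set G} (hK : IsCompact K) (hu : ∀ x, x ∉ K → u x = 0)
    (hv : ∀ x, x ∉ K → v x = 0) : ∫ x, v x ∂μ = -(modularDeriv X * ∫ x, u x ∂μ) := by
  obtain ⟨η, hη, hη1, hη'⟩ := exists_isTestFunction_eq_one (E := E) hK
  have h1 := h.integral_eq η hη
  have e1 : ∀ x, η x • v x = v x := fun x => by
    by_cases hx : x ∈ K
    · simp [hη1 x hx]
    · simp [hv x hx]
  have e2 : ∀ x, (fieldDeriv X η x + modularDeriv X * η x) • u x = modularDeriv X * u x := fun x => by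
    by_cases hx : x ∈ K
    · simp [hη1 x hx, hη' X x hx]
    · simp [hu x hx]
  simp_rw [e1, e2] at h1
  rw [h1, integral_const_mul]

/-- The sub-Laplacian identity for mollified weights, tested against bounded functions with
compact support and integrable horizontal derivatives. -/
theorem IsWeakSubLaplacian.sum_integral_mollify {w Lw : G → ℝ} {Dw : Fin S.dim → G → ℝ}
    (hL : IsWeakSubLaplacian S μ w Lw) (hD : ∀ j, IsWeakDeriv μ (S.X j) w (Dw j)) {ρ : G → ℝ}
    (hρ : IsTestFunction (E := E) ρ) {γ : Fin S.dim → ℝ → G} (hγ : ∀ j, IsOneParam (S.X j) (γ j))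
    {φ : G → ℝ} {φ' : Fin S.dim → G → ℝ} (hφ : ∀ j, HasLineDeriv μ (γ j) φ (φ' j))
    (hφi : Integrable φ μ) (hφi' : ∀ j, Integrable (φ' j) μ) {K : Set G} (hK : IsCompact K)
    (hφ0 : ∀ x, x ∉ K → φ x = 0) (hφ0' : ∀ j x, x ∉ K → φ' j x = 0) :
    ∑ j, ∫ x, φ' j x * mollify μ (fun y => ρ y * Measure.modularCharacterFun y) (Dw j) x ∂μ =
      ∫ x, φ x * mollify μ (fun y => ρ y * Measure.modularCharacterFun y) Lw x ∂μ := by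
  set A : (G → ℝ) → G → ℝ := mollify μ (fun y => ρ y * Measure.modularCharacterFun y) with hA
  have hAc : ∀ j, Continuous (A (Dw j)) := fun j => continuous_mollify hρ (hD j).locInt_deriv
  have hALc : Continuous (A Lw) := continuous_mollify hρ hL.locInt_subLaplacian
  have hcA : ∀ j, Continuous fun x => modularDeriv (S.X j) * A (Dw j) x :=
    fun j => continuous_const.mul (hAc j)
  choose P hPc hP using fun j => exists_hasLineDeriv_mollify hρ (hD j).locInt_deriv (hγ j)
  have hPw := fun j => (hP j).isWeakDeriv (hγ j) (hAc j).locallyIntegrable (hPc j).locallyIntegrable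
  -- After mollification X_j w has a continuous derivative P_j, so the equation holds as an almost
  -- everywhere identity of functions and can be multiplied by any φ.
  have h1 : (fun x => ∑ j, (P j x + modularDeriv (S.X j) * A (Dw j) x)) =ᵐ[μ] fun x => -A Lw x := by
    refine ae_eq_of_integral_contMDiff_smul_eq 𝓘(ℝ, E) (Continuous.locallyIntegrable ?_)
      hALc.neg.locallyIntegrable fun ψ hψs hψc => ?_
    · exact continuous_finsetSum _ fun j _ => (hPc j).add (hcA j)
    · have hψ : IsTestFunction (E := E) ψ := ⟨hψs, hψc⟩
      have h2 := hL.sum_integral_mollify_fieldDeriv hD hρ hψ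
      have h3 := fun j => (hPw j).integral_eq ψ hψ
      simp only [smul_eq_mul, ← hA] at h2 h3
      have ic : ∀ {p q : G → ℝ}, Continuous p → HasCompactSupport p → Continuous q →
          Integrable (fun x => p x * q x) μ := fun hp hpc hq =>
        (hp.mul hq).integrable_of_hasCompactSupport hpc.mul_right
      simp only [smul_eq_mul, mul_neg, Finset.mul_sum]
      rw [integral_neg, ← h2, integral_finsetSum, ← Finset.sum_neg_distrib]
      · refine Finset.sum_congr rfl fun j _ => ?_
        simp_rw [mul_add]
        rw [integral_add (ic hψ.smooth.continuous hψc (hPc j))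
          (ic hψ.smooth.continuous hψc (hcA j)), h3 j]
        simp_rw [add_mul]
        rw [integral_add (ic (hψ.continuous_fieldDeriv _) (hψ.hasCompactSupport_fieldDeriv _) (hAc j))
          (ic (p := fun x => modularDeriv (S.X j) * ψ x)
            (continuous_const.mul hψ.smooth.continuous) hψc.mul_left (hAc j))]
        have : ∀ x, ψ x * (modularDeriv (S.X j) * A (Dw j) x) =
          modularDeriv (S.X j) * ψ x * A (Dw j) x := fun x => by ring
        simp_rw [this]
        ring
      · exact fun j _ => ic hψ.smooth.continuous hψc ((hPc j).add (hcA j))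
  have ik : ∀ {p q : G → ℝ}, Integrable p μ → (∀ x, x ∉ K → p x = 0) → Continuous q →
      Integrable (fun x => p x * q x) μ := by
    intro p q hp hp0 hq
    have : IntegrableOn (fun x => p x * q x) K μ := hp.integrableOn.mul_continuousOn hq.continuousOn hK
    refine (integrableOn_iff_integrable_of_support_subset fun x hx => ?_).1 this
    by_contra h
    exact hx (by simp [hp0 x h])
  -- Integration by parts: φ·A(X_j w) has compact support, and the integral of its derivative is
  -- −c_j times its own integral.
  have h4 : ∀ j, ∫ x, φ' j x * A (Dw j) x ∂μ =
      -∫ x, φ x * (P j x + modularDeriv (S.X j) * A (Dw j) x) ∂μ := by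
    intro j
    have h5 := ((hφ j).mul (hP j)).isWeakDeriv (hγ j)
      (ik hφi hφ0 (hAc j)).locallyIntegrable
      ((ik (hφi' j) (hφ0' j) (hAc j)).add (ik hφi hφ0 (hPc j))).locallyIntegrable
    have h6 := h5.integral_eq_of_support hK (fun x hx => by simp [hφ0 x hx])
      (fun x hx => by simp [hφ0 x hx, hφ0' j x hx])
    rw [integral_add (ik (hφi' j) (hφ0' j) (hAc j)) (ik hφi hφ0 (hPc j))] at h6
    simp only [← hA] at h6
    simp_rw [mul_add]
    rw [integral_add (ik hφi hφ0 (hPc j)) (ik hφi hφ0 (hcA j))]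
    simp_rw [mul_left_comm _ (modularDeriv (S.X j)), integral_const_mul]
    linarith
  simp_rw [h4]
  rw [Finset.sum_neg_distrib, ← integral_finsetSum, ← integral_neg]
  · refine integral_congr_ae ?_
    filter_upwards [h1] with x hx
    rw [← Finset.mul_sum, hx]
    ring
  · exact fun j _ => ik hφi hφ0 ((hPc j).add (hcA j))

end SubLaplacian

/-! ### Approximate identities: almost everywhere and dominated convergence -/

section ApproximateIdentity
open Set Filter Topology
open scoped Pointwise

set_option linter.unusedSectionVars false

variable {E : Type*} [NormedAddCommGroup E] [NormedSpace ℝ E] [FiniteDimensional ℝ E]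
  {G : Type*} [TopologicalSpace G] [ChartedSpace E G] [Group G]
  [LieGroup 𝓘(ℝ, E) ∞ G] [IsTopologicalGroup G] [LocallyCompactSpace G]
  [T2Space G] [SecondCountableTopology G] [MeasurableSpace G] [BorelSpace G]
  {μ : Measure G} [μ.IsHaarMeasure]

/-- Translation is continuous in L¹. Cutting g off to N·K, with N a compact neighbourhood of 1,
makes it integrable without affecting g(yx) for y ∈ N and x ∈ K. -/
theorem exists_nhds_lintegral_translate_le {g : G → ℝ} (hg : LocallyIntegrable g μ) {K : Set G}
    (hK : IsCompact K) {ε : ℝ≥0∞} (hε : 0 < ε) :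
    ∃ U ∈ 𝓝 (1 : G), ∀ y ∈ U, ∫⁻ x in K, ‖g (y * x) - g x‖ₑ ∂μ ≤ ε := by
  obtain ⟨N, hN, h1N⟩ := exists_compact_mem_nhds (1 : G)
  have hNK : IsCompact (N * K) := hN.mul hK
  set h := (N * K).indicator g with hdef
  have hh : MemLp h 1 μ := memLp_one_iff_integrable.2
    ((integrable_indicator_iff hNK.measurableSet).2 (hg.integrableOn_isCompact hNK))
  have : Fact ((1 : ℝ≥0∞) ≠ ⊤) := ⟨ENNReal.one_ne_top⟩
  have hc : Continuous fun y : G => DomMulAct.mk y • hh.toLp h :=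
    continuous_smul.comp (DomMulAct.continuous_mk.prodMk continuous_const)
  have ht : Tendsto (fun y : G => edist (DomMulAct.mk y • hh.toLp h) (hh.toLp h)) (𝓝 1) (𝓝 0) := by
    have := (hc.edist (continuous_const (y := hh.toLp h))).tendsto 1
    simpa using this
  refine ⟨_, inter_mem h1N (ENNReal.tendsto_nhds_zero.1 ht ε hε), fun y hy => ?_⟩
  have hy2 : edist (DomMulAct.mk y • hh.toLp h) (hh.toLp h) ≤ ε := hy.2
  rw [DomMulAct.mk_smul_toLp, Lp.edist_toLp_toLp, eLpNorm_one_eq_lintegral_enorm] at hy2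
  refine le_trans ?_ hy2
  refine le_trans (setLIntegral_congr_fun hK.measurableSet fun x hx => ?_).le
    (setLIntegral_le_lintegral K _)
  have e1 : h (y * x) = g (y * x) := indicator_of_mem (mul_mem_mul hy.1 hx) g
  have e2 : h x = g x := indicator_of_mem (by
    simpa using mul_mem_mul (mem_of_mem_nhds h1N) hx) g
  simp only [Pi.sub_apply, smul_eq_mul, e1, e2]

theorem integrable_mul_comp_mul_right {g : G → ℝ} (hg : LocallyIntegrable g μ) {κ : G → ℝ}
    (hκ : Continuous κ) (hκc : HasCompactSupport κ) (x : G) :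
    Integrable (fun y => κ y * g (y * x)) μ := by
  refine (locallyIntegrable_comp_mul_right hg x).integrable_smul_left_of_hasCompactSupport hκ hκc

theorem lintegral_mollify_sub_le {κ g : G → ℝ} (hκ : Continuous κ) (hκc : HasCompactSupport κ)
    (hκ0 : ∀ y, 0 ≤ κ y) (hκ1 : ∫ y, κ y ∂μ = 1) (hg : LocallyIntegrable g μ) {K : Set G}
    {ε : ℝ≥0∞} (h : ∀ y, κ y ≠ 0 → ∫⁻ x in K, ‖g (y * x) - g x‖ₑ ∂μ ≤ ε) :
    ∫⁻ x in K, ‖mollify μ κ g x - g x‖ₑ ∂μ ≤ ε := by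
  have hκi : Integrable κ μ := hκ.integrable_of_hasCompactSupport hκc
  have hT : Measure.QuasiMeasurePreserving (fun q : G × G => q.2 * q.1) (μ.prod μ) μ :=
    QuasiMeasurePreserving.prod_of_left (continuous_snd.mul continuous_fst).measurable
      (Eventually.of_forall fun y => (measurePreserving_mul_left μ y).quasiMeasurePreserving)
  have hm : AEStronglyMeasurable (fun q : G × G => κ q.2 * (g (q.2 * q.1) - g q.1)) (μ.prod μ) :=
    (hκ.comp continuous_snd).aestronglyMeasurable.mul
      ((hg.aestronglyMeasurable.comp_quasiMeasurePreserving hT).sub hg.aestronglyMeasurable.comp_fst)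
  have hm' : AEMeasurable (Function.uncurry fun x y => ‖κ y * (g (y * x) - g x)‖ₑ)
      ((μ.restrict K).prod μ) :=
    (hm.mono_ac (Measure.restrict_le_self.absolutelyContinuous.prod .rfl)).enorm
  have h1 : ∀ x, ‖mollify μ κ g x - g x‖ₑ ≤ ∫⁻ y, ‖κ y * (g (y * x) - g x)‖ₑ ∂μ := by
    intro x
    have : mollify μ κ g x - g x = ∫ y, κ y * (g (y * x) - g x) ∂μ := by
      simp_rw [mul_sub]
      rw [integral_sub (integrable_mul_comp_mul_right hg hκ hκc x) (hκi.mul_const _),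
        integral_mul_const, hκ1, one_mul, mollify]
    rw [this]
    exact enorm_integral_le_lintegral_enorm _
  calc ∫⁻ x in K, ‖mollify μ κ g x - g x‖ₑ ∂μ
      ≤ ∫⁻ x in K, ∫⁻ y, ‖κ y * (g (y * x) - g x)‖ₑ ∂μ ∂μ := lintegral_mono h1
    _ = ∫⁻ y, ∫⁻ x in K, ‖κ y * (g (y * x) - g x)‖ₑ ∂μ ∂μ := lintegral_lintegral_swap hm'
    _ ≤ ∫⁻ y, ‖κ y‖ₑ * ε ∂μ := by
        refine lintegral_mono fun y => ?_
        simp_rw [enorm_mul]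
        rw [lintegral_const_mul' _ _ enorm_ne_top]
        by_cases hy : κ y = 0
        · simp [hy]
        · exact mul_le_mul_right (h y hy) _
    _ = ε := by
        rw [lintegral_mul_const'' _ hκ.aestronglyMeasurable.enorm]
        have : ∫⁻ y, ‖κ y‖ₑ ∂μ = 1 := by
          have h2 := ofReal_integral_eq_lintegral_ofReal hκi (Eventually.of_forall hκ0)
          rw [hκ1, ENNReal.ofReal_one] at h2
          rw [h2]
          exact lintegral_congr fun y => Real.enorm_of_nonneg (hκ0 y)
        rw [this, one_mul]

/-- Mollifiers which converge almost everywhere and dominatedly on a compact set. -/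
theorem exists_mollifier {ι : Type*} [Finite ι] {g : ι → G → ℝ}
    (hg : ∀ i, LocallyIntegrable (g i) μ) {K : Set G} (hK : IsCompact K) :
    ∃ ρ : ℕ → G → ℝ, (∀ n, IsTestFunction (E := E) (ρ n)) ∧ (∀ n y, 0 ≤ ρ n y) ∧
      ∀ i, (∀ᵐ x ∂μ.restrict K, Tendsto (fun n =>
          mollify μ (fun y => ρ n y * Measure.modularCharacterFun y) (g i) x) atTop (𝓝 (g i x))) ∧
        ∃ B : G → ℝ, IntegrableOn B K μ ∧ ∀ n, ∀ᵐ x ∂μ.restrict K,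
          |mollify μ (fun y => ρ n y * Measure.modularCharacterFun y) (g i) x| ≤ B x := by
  -- The rate 2⁻ⁿ makes the L¹(K) errors summable. Their sum is then finite almost everywhere and
  -- integrable, which gives pointwise convergence and a dominating function at once.
  have step : ∀ n : ℕ, ∃ ρ : G → ℝ, IsTestFunction (E := E) ρ ∧ (∀ y, 0 ≤ ρ y) ∧ ∀ i,
      ∫⁻ x in K, ‖mollify μ (fun y => ρ y * Measure.modularCharacterFun y) (g i) x - g i x‖ₑ ∂μ
        ≤ 2⁻¹ ^ n := by
    intro n
    have hε : (0 : ℝ≥0∞) < 2⁻¹ ^ n := ENNReal.pow_pos (by simp) n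
    choose U hU hUle using fun i => exists_nhds_lintegral_translate_le (hg i) hK hε
    obtain ⟨ρ, hρ, hρ0, hρ1, hρU⟩ := exists_isTestFunction (E := E) (iInter_mem.2 hU)
    have hΔ : ∀ y : G, (0 : ℝ) < Measure.modularCharacterFun y := fun y =>
      NNReal.coe_pos.2 (Measure.modularCharacterFun_pos y)
    have hc : Continuous fun y => ρ y * (Measure.modularCharacterFun y : ℝ) :=
      hρ.smooth.continuous.mul continuous_modularCharacterFun
    have hN : 0 < ∫ y, ρ y * (Measure.modularCharacterFun y : ℝ) ∂μ :=
      hc.integral_pos_of_hasCompactSupport_nonneg_nonzero hρ.compact.mul_right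
        (fun y => mul_nonneg (hρ0 y) (hΔ y).le) (x := 1) (by simp [hρ1, (hΔ 1).ne'])
    set N := ∫ y, ρ y * (Measure.modularCharacterFun y : ℝ) ∂μ with hNdef
    have hρ' := hρ.const_mul N⁻¹
    refine ⟨fun y => N⁻¹ * ρ y, hρ', fun y => mul_nonneg (inv_nonneg.2 hN.le) (hρ0 y),
      fun i => ?_⟩
    refine lintegral_mollify_sub_le (hρ'.smooth.continuous.mul continuous_modularCharacterFun)
      hρ'.compact.mul_right (fun y => mul_nonneg (mul_nonneg (inv_nonneg.2 hN.le) (hρ0 y)) (hΔ y).le)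
      ?_ (hg i) fun y hy => hUle i y ?_
    · have hassoc : (fun y => N⁻¹ * ρ y * (Measure.modularCharacterFun y : ℝ)) =
          fun y => N⁻¹ * (ρ y * Measure.modularCharacterFun y) := funext fun y => mul_assoc _ _ _
      refine (congrArg (fun f : G → ℝ => ∫ y, f y ∂μ) hassoc).trans ?_
      rw [integral_const_mul, ← hNdef, inv_mul_cancel₀ hN.ne']
    · have : ρ y ≠ 0 := by
        rintro h
        exact hy (by simp [h])
      exact mem_iInter.1 (hρU (subset_tsupport ρ this)) i
  choose ρ hρ hρ0 hle using step
  refine ⟨ρ, hρ, hρ0, fun i => ?_⟩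
  set A : ℕ → G → ℝ := fun n => mollify μ (fun y => ρ n y * Measure.modularCharacterFun y) (g i)
  have hAm : ∀ n, AEMeasurable (fun x => ‖A n x - g i x‖ₑ) (μ.restrict K) := fun n =>
    ((continuous_mollify (hρ n) (hg i)).aestronglyMeasurable.sub
      (hg i).aestronglyMeasurable.restrict).enorm
  set D : G → ℝ≥0∞ := fun x => ∑' n, ‖A n x - g i x‖ₑ with hD
  have hDm : AEMeasurable D (μ.restrict K) := AEMeasurable.tsum hAm
  have hDi : ∫⁻ x in K, D x ∂μ ≠ ⊤ := by
    rw [hD, lintegral_tsum hAm]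
    refine ne_top_of_le_ne_top ?_ (ENNReal.tsum_le_tsum fun n => hle n i)
    rw [ENNReal.tsum_geometric]
    simp
  have hDae : ∀ᵐ x ∂μ.restrict K, D x ≠ ⊤ := (ae_lt_top' hDm hDi).mono fun x hx => hx.ne
  refine ⟨?_, fun x => |g i x| + (D x).toReal, ?_, fun n => ?_⟩
  · filter_upwards [hDae] with x hx
    have h1 := ENNReal.tendsto_atTop_zero_of_tsum_ne_top hx
    rw [tendsto_iff_edist_tendsto_0]
    simpa only [edist_eq_enorm_sub] using h1
  · exact ((hg i).integrableOn_isCompact hK).abs.add (integrable_toReal_of_lintegral_ne_top hDm hDi)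
  · filter_upwards [hDae] with x hx
    have h1 : ‖A n x - g i x‖ₑ ≤ D x := ENNReal.le_tsum n
    have h2 : |A n x - g i x| ≤ (D x).toReal := by
      have := (ENNReal.toReal_le_toReal enorm_ne_top hx).2 h1
      rwa [toReal_enorm, Real.norm_eq_abs] at this
    calc |A n x| = |g i x + (A n x - g i x)| := by ring_nf
      _ ≤ _ := (abs_add_le _ _).trans (by gcongr)

end ApproximateIdentity

/-! ### Two dominated limits -/

section DominatedLimits
open Set Filter Topology

variable {α : Type*} [MeasurableSpace α] {ν : Measure α}

/-- A bound on the squares e_n² suffices: the linear term is controlled by |p e_n| ≤ p² + e_n², the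
quadratic one by boundedness of q. -/
theorem tendsto_integral_quadratic {p q : α → ℝ} {C : ℝ} (hp : MemLp p 2 ν)
    (hq : AEStronglyMeasurable q ν) (hqC : ∀ᵐ x ∂ν, |q x| ≤ C) {e : ℕ → α → ℝ} {e' B : α → ℝ}
    (he : ∀ n, AEStronglyMeasurable (e n) ν) (hB : Integrable B ν)
    (heB : ∀ n, ∀ᵐ x ∂ν, e n x ^ 2 ≤ B x)
    (ht : ∀ᵐ x ∂ν, Tendsto (fun n => e n x) atTop (𝓝 (e' x))) :
    Tendsto (fun n => ∫ x, (p x * e n x - q x * e n x ^ 2) ∂ν) atTop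
      (𝓝 (∫ x, (p x * e' x - q x * e' x ^ 2) ∂ν)) := by
  refine tendsto_integral_of_dominated_convergence (fun x => p x ^ 2 + B x + C * B x) (fun n => ?_)
    ((hp.integrable_sq.add hB).add (hB.const_mul C)) (fun n => ?_) ?_
  · exact (hp.1.mul (he n)).sub (hq.mul ((he n).pow 2))
  · filter_upwards [heB n, hqC] with x hx h1
    have hC : 0 ≤ C := (abs_nonneg _).trans h1
    have h2 : |q x * e n x ^ 2| ≤ C * B x := by
      rw [abs_mul, abs_of_nonneg (sq_nonneg (e n x))]
      exact mul_le_mul h1 hx (sq_nonneg _) hC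
    have h3 : |p x * e n x| ≤ p x ^ 2 + B x := by
      rw [abs_le]
      constructor <;> nlinarith [sq_nonneg (p x - e n x), sq_nonneg (p x + e n x), sq_nonneg (p x)]
    exact (abs_sub _ _).trans (add_le_add h3 h2)
  · filter_upwards [ht] with x hx
    exact (hx.const_mul _).sub ((hx.pow 2).const_mul _)

theorem tendsto_integral_bdd_mul {q : α → ℝ} {C : ℝ}
    (hq : AEStronglyMeasurable q ν) (hqC : ∀ᵐ x ∂ν, |q x| ≤ C) {l : ℕ → α → ℝ} {l' B : α → ℝ}
    (hl : ∀ n, AEStronglyMeasurable (l n) ν) (hB : Integrable B ν)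
    (hlB : ∀ n, ∀ᵐ x ∂ν, |l n x| ≤ B x)
    (ht : ∀ᵐ x ∂ν, Tendsto (fun n => l n x) atTop (𝓝 (l' x))) :
    Tendsto (fun n => ∫ x, q x * l n x ∂ν) atTop (𝓝 (∫ x, q x * l' x ∂ν)) := by
  refine tendsto_integral_of_dominated_convergence (fun x => C * B x) (fun n => hq.mul (hl n))
    (hB.const_mul C) (fun n => ?_) ?_
  · filter_upwards [hlB n, hqC] with x hx h1
    rw [Real.norm_eq_abs, abs_mul]
    exact mul_le_mul h1 hx (abs_nonneg _) ((abs_nonneg _).trans h1)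
  · filter_upwards [ht] with x hx using hx.const_mul _

end DominatedLimits

/-! ### The equation of the logarithm of the weight -/

section Weights
open Set Filter Topology

set_option linter.unusedSectionVars false

variable {E : Type*} [NormedAddCommGroup E] [NormedSpace ℝ E] [FiniteDimensional ℝ E]
  {G : Type*} [TopologicalSpace G] [ChartedSpace E G] [Group G]
  [LieGroup 𝓘(ℝ, E) ∞ G] [IsTopologicalGroup G] [LocallyCompactSpace G]
  [T2Space G] [SecondCountableTopology G] [MeasurableSpace G] [BorelSpace G]
  {μ : Measure G}

/-- The standing assumptions on a weight `w` with `∇_H w = Dw` and `L w = Lw`. -/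
structure RegularWeight (S : SubRiemannian E G) (μ : Measure G) (w : G → ℝ)
    (Dw : Fin S.dim → G → ℝ) (Lw : G → ℝ) : Prop extends IsWeight μ w where
  weakDeriv : ∀ j, IsWeakDeriv μ (S.X j) w (Dw j)
  deriv_sqrt : ∀ j, MemL2Loc (fun x => Dw j x / √(w x)) μ
  deriv_div : ∀ j, MemL2Loc (fun x => Dw j x / w x) μ
  weakSubLaplacian : IsWeakSubLaplacian S μ w Lw
  subLaplacian_div : LocallyIntegrable (fun x => Lw x / w x) μ

variable [μ.IsHaarMeasure] {S : SubRiemannian E G} {w Lw : G → ℝ} {Dw : Fin S.dim → G → ℝ}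
  {γ : Fin S.dim → ℝ → G}

theorem MemL2Loc.locallyIntegrable_sq {f : G → ℝ} (hf : MemL2Loc f μ) :
    LocallyIntegrable (fun x => f x ^ 2) μ :=
  locallyIntegrable_iff.2 fun K hK => (hf K hK).integrable_sq

/-- Cauchy–Schwarz for the average with weight κ: the polynomial t ↦ A(u)t² + 2A(d)t + A(q) is
nonnegative, hence its discriminant is not positive. It is used with u = w, d = X_j w, q = |X_j
w|²/w. -/
theorem mollify_sq_le {κ u d q : G → ℝ} (hκ : Continuous κ) (hκc : HasCompactSupport κ)
    (hκ0 : ∀ y, 0 ≤ κ y) (hu : LocallyIntegrable u μ) (hd : LocallyIntegrable d μ)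
    (hq : LocallyIntegrable q μ) (h : ∀ᵐ x ∂μ, 0 < u x ∧ d x ^ 2 ≤ u x * q x) (x : G) :
    0 ≤ mollify μ κ u x ∧ mollify μ κ d x ^ 2 ≤ mollify μ κ u x * mollify μ κ q x := by
  have hx := (quasiMeasurePreserving_mul_right μ x).ae h
  have iu := integrable_mul_comp_mul_right hu hκ hκc x
  have id := integrable_mul_comp_mul_right hd hκ hκc x
  have iq := integrable_mul_comp_mul_right hq hκ hκc x
  refine ⟨integral_nonneg_of_ae (hx.mono fun y hy => mul_nonneg (hκ0 y) hy.1.le), ?_⟩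
  have h1 : ∀ t : ℝ, 0 ≤ mollify μ κ u x * (t * t) + (2 * mollify μ κ d x) * t +
      mollify μ κ q x := by
    intro t
    have e : mollify μ κ u x * (t * t) + (2 * mollify μ κ d x) * t + mollify μ κ q x =
        ∫ y, (t * t * (κ y * u (y * x)) + 2 * t * (κ y * d (y * x)) + κ y * q (y * x)) ∂μ := by
      have i1 : Integrable (fun y => t * t * (κ y * u (y * x))) μ := iu.const_mul _
      have i2 : Integrable (fun y => 2 * t * (κ y * d (y * x))) μ := id.const_mul _
      have i3 : Integrable (fun y => t * t * (κ y * u (y * x)) + 2 * t * (κ y * d (y * x))) μ :=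
        i1.add i2
      rw [integral_add i3 iq, integral_add i1 i2, integral_const_mul, integral_const_mul]
      simp only [mollify]
      ring
    rw [e]
    refine integral_nonneg_of_ae (hx.mono fun y hy => ?_)
    have h2 : 0 ≤ u (y * x) * (t * t * u (y * x) + 2 * t * d (y * x) + q (y * x)) := by
      nlinarith [sq_nonneg (t * u (y * x) + d (y * x)), hy.2]
    have h3 := nonneg_of_mul_nonneg_right h2 hy.1
    have := mul_nonneg (hκ0 y) h3
    simp only [Pi.zero_apply]
    linarith
  have := discrim_le_zero h1
  rw [discrim] at this
  nlinarith

theorem sq_mul_inv_le {W d Q B τ : ℝ} (hW : 0 ≤ W) (hτ : 0 < τ) (hd : d ^ 2 ≤ W * Q) (hQ : Q ≤ B)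
    (hB : 0 ≤ B) : (d * (W + τ)⁻¹) ^ 2 ≤ B / τ := by
  have hpos : 0 < W + τ := by linarith
  rw [mul_pow, inv_pow, ← div_eq_mul_inv, div_le_div_iff₀ (by positivity) hτ]
  nlinarith [mul_le_mul_of_nonneg_left hQ hW, mul_nonneg hB hW, mul_nonneg hB hτ.le,
    mul_nonneg (mul_nonneg hB hW) hτ.le, mul_nonneg hB (sq_nonneg W), mul_nonneg hB (sq_nonneg τ)]

namespace RegularWeight

/-- The mollified equation is tested with ψ/(A w + τ). The quadratic term is dominated by A(|X_j
w|²/w)/τ, which converges dominatedly because |X_j w|²/w is locally integrable; τ > 0 keeps the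
denominators away from 0. -/
theorem integral_regularized (h : RegularWeight S μ w Dw Lw) (hγ : ∀ j, IsOneParam (S.X j) (γ j))
    {ψ : G → ℝ} {ψ' : Fin S.dim → G → ℝ} (hψ : ∀ j, HasLineDeriv μ (γ j) ψ (ψ' j))
    (hψm : AEStronglyMeasurable ψ μ) {C : ℝ} (hC : ∀ᵐ x ∂μ, |ψ x| ≤ C)
    (hψ' : ∀ j, MemLp (ψ' j) 2 μ) {K : Set G} (hK : IsCompact K)
    (hψ0 : ∀ x, x ∉ K → ψ x = 0) (hψ0' : ∀ j x, x ∉ K → ψ' j x = 0) {τ : ℝ} (hτ : 0 < τ) :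
    ∑ j, ∫ x in K, (ψ' j x * (Dw j x * (w x + τ)⁻¹) - ψ x * (Dw j x * (w x + τ)⁻¹) ^ 2) ∂μ =
      ∫ x in K, ψ x * (Lw x * (w x + τ)⁻¹) ∂μ := by
  have hq : ∀ j, LocallyIntegrable (fun x => (Dw j x / √(w x)) ^ 2) μ := fun j =>
    (h.deriv_sqrt j).locallyIntegrable_sq
  -- All functions to be mollified share one sequence of mollifiers. The last family serves only to
  -- provide the dominating functions.
  let g : Option (Option (Fin S.dim ⊕ Fin S.dim)) → G → ℝ := fun
    | none => w
    | some none => Lw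
    | some (some (.inl j)) => Dw j
    | some (some (.inr j)) => fun x => (Dw j x / √(w x)) ^ 2
  have hg : ∀ i, LocallyIntegrable (g i) μ := by
    rintro (_ | _ | j | j)
    exacts [h.locInt, h.weakSubLaplacian.locInt_subLaplacian, (h.weakDeriv j).locInt_deriv, hq j]
  obtain ⟨ρ, hρ, hρ0, hlim⟩ := exists_mollifier (E := E) hg hK
  set A : ℕ → (G → ℝ) → G → ℝ := fun n =>
    mollify μ (fun y => ρ n y * Measure.modularCharacterFun y) with hA
  have hW := hlim none
  have hL := hlim (some none)
  have hD := fun j => hlim (some (some (.inl j)))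
  have hQ := fun j => hlim (some (some (.inr j)))
  obtain ⟨hLt, BL, hBL, hLB⟩ := hL
  have hAc : ∀ n {f : G → ℝ}, LocallyIntegrable f μ → Continuous (A n f) := fun n f hf =>
    continuous_mollify (hρ n) hf
  have hCS : ∀ n j x, 0 ≤ A n w x ∧
      A n (Dw j) x ^ 2 ≤ A n w x * A n (fun x => (Dw j x / √(w x)) ^ 2) x := by
    intro n j x
    refine mollify_sq_le ((hρ n).smooth.continuous.mul continuous_modularCharacterFun)
      (hρ n).compact.mul_right (fun y => mul_nonneg (hρ0 n y) (NNReal.coe_nonneg _))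
      h.locInt (h.weakDeriv j).locInt_deriv (hq j) (h.pos.mono fun y hy => ⟨hy, ?_⟩) x
    rw [div_pow, Real.sq_sqrt hy.le, mul_div_cancel₀ _ hy.ne']
  have hW0 : ∀ n x, 0 ≤ A n w x := fun n x =>
    integral_nonneg_of_ae (((quasiMeasurePreserving_mul_right μ x).ae h.pos).mono fun y hy =>
      mul_nonneg (mul_nonneg (hρ0 n y) (NNReal.coe_nonneg _)) hy.le)
  have hinvc : ∀ n, Continuous fun x => (A n w x + τ)⁻¹ := fun n =>
    Continuous.inv₀ (f := fun x => A n w x + τ) ((hAc n h.locInt).add continuous_const)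
      fun x => (add_pos_of_nonneg_of_pos (hW0 n x) hτ).ne'
  have ik : ∀ {p q : G → ℝ}, IntegrableOn p K μ → (∀ x, x ∉ K → p x = 0) → Continuous q →
      Integrable (fun x => p x * q x) μ := by
    intro p q hp hp0 hq
    refine (integrableOn_iff_integrable_of_support_subset fun x hx => ?_).1
      (hp.mul_continuousOn hq.continuousOn hK)
    by_contra h
    exact hx (by simp [hp0 x h])
  have hfinK : IsFiniteMeasure (μ.restrict K) := ⟨by simpa using hK.measure_lt_top⟩
  have hψK : IntegrableOn ψ K μ :=
    Integrable.of_bound hψm.restrict C (ae_restrict_of_ae hC)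
  have hψK' : ∀ j, IntegrableOn (ψ' j) K μ := fun j => (hψ' j).restrict K |>.integrable (by norm_num)
  have hid : ∀ n, ∑ j, ∫ x in K, (ψ' j x * (A n (Dw j) x * (A n w x + τ)⁻¹)
      - ψ x * (A n (Dw j) x * (A n w x + τ)⁻¹) ^ 2) ∂μ =
      ∫ x in K, ψ x * (A n Lw x * (A n w x + τ)⁻¹) ∂μ := by
    intro n
    have hlw : ∀ j, HasLineDeriv μ (γ j) (A n w) (A n (Dw j)) := fun j =>
      ((h.weakDeriv j).mollify_apply (hρ n)).hasLineDeriv (hγ j)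
    have hli : ∀ j, HasLineDeriv μ (γ j) (fun x => (A n w x + τ)⁻¹)
        (fun x => -((A n w x + τ) ^ 2)⁻¹ * A n (Dw j) x) := fun j =>
      (hlw j).comp (hγ j) (Φ := fun y => (y + τ)⁻¹) (Φ' := fun y => -((y + τ) ^ 2)⁻¹)
        (Eventually.of_forall (hW0 n))
        (fun y hy => (((hasDerivAt_id y).add_const τ).inv (by simp; linarith)).congr_deriv
          (by simp [neg_div]))
        (ContinuousOn.neg (ContinuousOn.inv₀ (by fun_prop) fun y hy => by
          have : (0 : ℝ) ≤ y := hy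
          positivity))
    have hM := h.weakSubLaplacian.sum_integral_mollify h.weakDeriv (hρ n) hγ
      (fun j => (hψ j).mul (hli j)) (ik hψK hψ0 (hinvc n))
      (fun j => (ik (hψK' j) (hψ0' j) (hinvc n)).add (ik hψK hψ0 ?_)) hK
      (fun x hx => by simp [hψ0 x hx]) (fun j x hx => by simp [hψ0 x hx, hψ0' j x hx])
    · rw [setIntegral_eq_integral_of_forall_compl_eq_zero fun x hx => by simp [hψ0 x hx]]
      refine Eq.trans (Finset.sum_congr rfl fun j _ => ?_) (hM.trans ?_)
      · rw [setIntegral_eq_integral_of_forall_compl_eq_zero fun x hx => by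
          simp [hψ0 x hx, hψ0' j x hx]]
        refine integral_congr_ae (Eventually.of_forall fun x => ?_)
        simp only [inv_pow, mul_pow, hA]
        ring
      · refine integral_congr_ae (Eventually.of_forall fun x => ?_)
        simp only [hA]
        ring
    · refine Continuous.mul (Continuous.neg ?_) (hAc n (h.weakDeriv j).locInt_deriv)
      have := (hinvc n).pow 2
      simp only [← inv_pow]
      exact this
  have hinvt : ∀ᵐ x ∂μ.restrict K, Tendsto (fun n => (A n w x + τ)⁻¹) atTop (𝓝 (w x + τ)⁻¹) := by
    filter_upwards [hW.1, ae_restrict_of_ae h.pos] with x hx hx0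
    exact (Tendsto.add_const τ hx).inv₀ (by linarith)
  refine tendsto_nhds_unique (l := (atTop : Filter ℕ)) (tendsto_finsetSum Finset.univ fun j _ => ?_)
    (Tendsto.congr (fun n => (hid n).symm) ?_)
  · obtain ⟨hDt, -⟩ := hD j
    obtain ⟨-, B, hB, hQB⟩ := hQ j
    refine tendsto_integral_quadratic (B := fun x => B x / τ) ((hψ' j).restrict K) hψm.restrict (ae_restrict_of_ae hC)
      (fun n => ((hAc n (h.weakDeriv j).locInt_deriv).mul (hinvc n)).aestronglyMeasurable)
      (Integrable.div_const hB τ) (fun n => ?_) ?_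
    · filter_upwards [hQB n] with x hx
      exact sq_mul_inv_le (hW0 n x) hτ (hCS n j x).2 ((le_abs_self _).trans hx)
        ((abs_nonneg _).trans hx)
    · filter_upwards [hDt, hinvt] with x h1 h2 using h1.mul h2
  · refine tendsto_integral_bdd_mul (B := fun x => BL x / τ) hψm.restrict (ae_restrict_of_ae hC)
      (fun n => ((hAc n h.weakSubLaplacian.locInt_subLaplacian).mul (hinvc n)).aestronglyMeasurable)
      (Integrable.div_const hBL τ) (fun n => ?_) ?_
    · filter_upwards [hLB n] with x hx
      have hp : 0 < A n w x + τ := add_pos_of_nonneg_of_pos (hW0 n x) hτ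
      rw [abs_mul, div_eq_mul_inv, abs_of_pos (inv_pos.2 hp)]
      exact mul_le_mul hx (inv_anti₀ hτ (le_add_of_nonneg_left (hW0 n x))) (inv_pos.2 hp).le
        ((abs_nonneg _).trans hx)
    · filter_upwards [hLt, hinvt] with x h1 h2 using h1.mul h2

/-- The equation for the logarithm of the weight, `L (log w) = |∇_H w|² / w² + L w / w`. -/
theorem sum_integral_mul_deriv_div (h : RegularWeight S μ w Dw Lw)
    (hγ : ∀ j, IsOneParam (S.X j) (γ j))
    {ψ : G → ℝ} {ψ' : Fin S.dim → G → ℝ} (hψ : ∀ j, HasLineDeriv μ (γ j) ψ (ψ' j))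
    (hψm : AEStronglyMeasurable ψ μ) {C : ℝ} (hC : ∀ᵐ x ∂μ, |ψ x| ≤ C)
    (hψ' : ∀ j, MemLp (ψ' j) 2 μ) {K : Set G} (hK : IsCompact K)
    (hψ0 : ∀ x, x ∉ K → ψ x = 0) (hψ0' : ∀ j x, x ∉ K → ψ' j x = 0) :
    ∑ j, ∫ x in K, (ψ' j x * (Dw j x / w x) - ψ x * (Dw j x / w x) ^ 2) ∂μ =
      ∫ x in K, ψ x * (Lw x / w x) ∂μ := by
  have hτ : ∀ n : ℕ, (0 : ℝ) < 1 / ((n : ℝ) + 1) := fun n => by positivity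
  have hwm : AEStronglyMeasurable w (μ.restrict K) := h.locInt.aestronglyMeasurable.restrict
  have him : ∀ n : ℕ, AEStronglyMeasurable (fun x => (w x + 1 / ((n : ℝ) + 1))⁻¹) (μ.restrict K) :=
    fun n => (hwm.aemeasurable.add_const _).inv.aestronglyMeasurable
  have hpos := ae_restrict_of_ae (s := K) h.pos
  have hinvt : ∀ᵐ x ∂μ.restrict K,
      Tendsto (fun n : ℕ => (w x + 1 / ((n : ℝ) + 1))⁻¹) atTop (𝓝 (w x)⁻¹) := by
    filter_upwards [hpos] with x hx
    exact (IsACDeriv.tendsto_add_inv_nat _).inv₀ hx.ne'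
  -- For τ = 1/(n+1) → 0 everything is dominated by the limit itself, since (w + τ)⁻¹ ≤ w⁻¹.
  have hle : ∀ n : ℕ, ∀ᵐ x ∂μ.restrict K, ∀ d : ℝ,
      |d * (w x + 1 / ((n : ℝ) + 1))⁻¹| ≤ |d / w x| := by
    intro n
    filter_upwards [hpos] with x hx d
    rw [div_eq_mul_inv d, abs_mul, abs_mul, abs_of_pos (inv_pos.2 hx),
      abs_of_pos (inv_pos.2 (add_pos hx (hτ n)))]
    gcongr
    linarith [hτ n]
  refine tendsto_nhds_unique (l := (atTop : Filter ℕ)) (tendsto_finsetSum Finset.univ fun j _ => ?_)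
    (Tendsto.congr (fun n => (h.integral_regularized hγ hψ hψm hC hψ' hK hψ0 hψ0' (hτ n)).symm) ?_)
  · refine tendsto_integral_quadratic (B := fun x => (Dw j x / w x) ^ 2) ((hψ' j).restrict K)
      hψm.restrict (ae_restrict_of_ae hC) (fun n => (h.weakDeriv j).locInt_deriv.aestronglyMeasurable.restrict.mul (him n))
      (h.deriv_div j K hK).integrable_sq (fun n => ?_) ?_
    · filter_upwards [hle n] with x hx using sq_le_sq.2 (hx _)
    · filter_upwards [hinvt] with x hx
      simpa only [div_eq_mul_inv] using hx.const_mul (Dw j x)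
  · refine tendsto_integral_bdd_mul (B := fun x => |Lw x / w x|) hψm.restrict (ae_restrict_of_ae hC)
      (fun n => h.weakSubLaplacian.locInt_subLaplacian.aestronglyMeasurable.restrict.mul (him n))
      (h.subLaplacian_div.integrableOn_isCompact hK).abs (fun n => ?_) ?_
    · filter_upwards [hle n] with x hx using hx _
    · filter_upwards [hinvt] with x hx
      simpa only [div_eq_mul_inv] using hx.const_mul (Lw x)

end RegularWeight
end Weights

/-! ### From the equation of log w back to the equation of w -/

section CompactIdentities
open Set Filter Topology

set_option linter.unusedSectionVars false

variable {E : Type*} [NormedAddCommGroup E] [NormedSpace ℝ E] [FiniteDimensional ℝ E]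
  {G : Type*} [TopologicalSpace G] [ChartedSpace E G] [Group G]
  [LieGroup 𝓘(ℝ, E) ∞ G] [IsTopologicalGroup G] [LocallyCompactSpace G]
  [T2Space G] [SecondCountableTopology G] [MeasurableSpace G] [BorelSpace G]
  {μ : Measure G} [μ.IsHaarMeasure] {S : SubRiemannian E G} {w Lw : G → ℝ}
  {Dw : Fin S.dim → G → ℝ} {γ : Fin S.dim → ℝ → G}

theorem integrable_of_integrableOn {F : Type*} [NormedAddCommGroup F] {f : G → F} {K : Set G}
    (hf : IntegrableOn f K μ) (h0 : ∀ x, x ∉ K → f x = 0) : Integrable f μ :=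
  (integrableOn_iff_integrable_of_support_subset fun x hx => by
    by_contra h
    exact hx (h0 x h)).1 hf

/-- θ(y) = My/(M + y) is a bounded, smooth substitute for y. The estimate θ² ≤ My bounds θ(w)g' by
√w g', and θ'(y)y ≤ M bounds θ'(w)X_j w by X_j w / w; this puts the derivatives of gθ(w) in L². -/
theorem damping_bounds {M y : ℝ} (hM : 0 < M) (hy : 0 < y) :
    0 < M * y / (M + y) ∧ M * y / (M + y) ≤ M ∧ M * y / (M + y) ≤ y ∧
      (M * y / (M + y)) ^ 2 ≤ M * y ∧ 0 < M ^ 2 / (M + y) ^ 2 ∧ M ^ 2 / (M + y) ^ 2 ≤ 1 ∧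
      M ^ 2 / (M + y) ^ 2 * y ≤ M := by
  have h := mul_pos hM hy
  have h1 : M * y / (M + y) ≤ M := by rw [div_le_iff₀ (by positivity)]; nlinarith
  have h2 : M * y / (M + y) ≤ y := by rw [div_le_iff₀ (by positivity)]; nlinarith
  have h0 : 0 < M * y / (M + y) := by positivity
  refine ⟨h0, h1, h2, ?_, by positivity, ?_, ?_⟩
  · rw [sq]
    exact mul_le_mul h1 h2 h0.le hM.le
  · rw [div_le_one (by positivity)]
    nlinarith
  · rw [div_mul_eq_mul_div, div_le_iff₀ (by positivity)]
    nlinarith [mul_pos h hM, mul_pos h hy, pow_pos hM 3]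

theorem hasDerivAt_damping {M y : ℝ} (hM : 0 < M) (hy : 0 ≤ y) :
    HasDerivAt (fun y => M * y / (M + y)) (M ^ 2 / (M + y) ^ 2) y := by
  have h1 : HasDerivAt (fun y : ℝ => M * y) M y := by simpa using (hasDerivAt_id y).const_mul M
  have h2 : HasDerivAt (fun y : ℝ => M + y) 1 y := by simpa using (hasDerivAt_id y).const_add M
  exact (h1.div h2 (by positivity)).congr_deriv (by ring)

theorem tendsto_damping (y : ℝ) :
    Tendsto (fun n : ℕ => ((n : ℝ) + 1) * y / ((n : ℝ) + 1 + y)) atTop (𝓝 y) ∧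
      Tendsto (fun n : ℕ => ((n : ℝ) + 1) ^ 2 / ((n : ℝ) + 1 + y) ^ 2) atTop (𝓝 1) := by
  have h1 : Tendsto (fun n : ℕ => ((n : ℝ) + 1)) atTop atTop :=
    tendsto_atTop_add_const_right _ _ tendsto_natCast_atTop_atTop
  have h2 : Tendsto (fun n : ℕ => 1 + y / ((n : ℝ) + 1)) atTop (𝓝 1) := by
    simpa using (tendsto_const_nhds (x := (1 : ℝ))).add (h1.const_div_atTop y)
  have h3 : Tendsto (fun n : ℕ => (1 + y / ((n : ℝ) + 1))⁻¹) atTop (𝓝 1) := by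
    simpa using h2.inv₀ one_ne_zero
  have e : ∀ n : ℕ, (1 + y / ((n : ℝ) + 1))⁻¹ = ((n : ℝ) + 1) / ((n : ℝ) + 1 + y) := by
    intro n
    have : (n : ℝ) + 1 ≠ 0 := by positivity
    rw [one_add_div this, inv_div]
  simp_rw [e] at h3
  refine ⟨?_, ?_⟩
  · have := h3.mul_const y
    simpa only [one_mul, div_mul_eq_mul_div] using this
  · have := h3.pow 2
    simpa only [one_pow, div_pow] using this

namespace RegularWeight

/-- The equation of log w is tested with ψ = gθ(w), M = n + 1. In the limit θ(w) → w and θ'(w) → 1,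
the two terms g(X_j w)²/w cancel, and g' X_j w remains. -/
theorem sum_integral_mul_deriv (h : RegularWeight S μ w Dw Lw)
    (hγ : ∀ j, IsOneParam (S.X j) (γ j))
    {g : G → ℝ} {g' : Fin S.dim → G → ℝ} (hg : ∀ j, HasLineDeriv μ (γ j) g (g' j))
    (hgm : AEStronglyMeasurable g μ) {C : ℝ} (hC : ∀ x, |g x| ≤ C)
    (hgm' : ∀ j, AEStronglyMeasurable (g' j) μ)
    (hg' : ∀ j, MemLp (fun x => √(w x) * g' j x) 2 μ) {K : Set G} (hK : IsCompact K)
    (hg0 : ∀ x, x ∉ K → g x = 0) (hg0' : ∀ j x, x ∉ K → g' j x = 0) :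
    ∑ j, ∫ x in K, g' j x * Dw j x ∂μ = ∫ x in K, g x * Lw x ∂μ := by
  have hC0 : 0 ≤ C := (abs_nonneg _).trans (hC 1)
  have hM : ∀ n : ℕ, (0 : ℝ) < (n : ℝ) + 1 := fun n => by positivity
  have hwm : AEStronglyMeasurable w μ := h.locInt.aestronglyMeasurable
  have hDm : ∀ j, AEStronglyMeasurable (Dw j) μ := fun j =>
    (h.weakDeriv j).locInt_deriv.aestronglyMeasurable
  set θ : ℕ → G → ℝ := fun n x => ((n : ℝ) + 1) * w x / ((n : ℝ) + 1 + w x) with hθ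
  set θ' : ℕ → G → ℝ := fun n x => ((n : ℝ) + 1) ^ 2 / ((n : ℝ) + 1 + w x) ^ 2 with hθ'
  have hθm : ∀ n, AEStronglyMeasurable (θ n) μ := fun n =>
    ((hwm.aemeasurable.const_mul _).div (hwm.aemeasurable.const_add _)).aestronglyMeasurable
  have hθm' : ∀ n, AEStronglyMeasurable (θ' n) μ := fun n =>
    (((hwm.aemeasurable.const_add _).pow_const 2).const_div _).aestronglyMeasurable
  have hbd : ∀ n, ∀ᵐ x ∂μ, 0 < w x ∧ 0 < θ n x ∧ θ n x ≤ (n : ℝ) + 1 ∧ θ n x ≤ w x ∧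
      (θ n x) ^ 2 ≤ ((n : ℝ) + 1) * w x ∧ 0 < θ' n x ∧ θ' n x ≤ 1 ∧ θ' n x * w x ≤ (n : ℝ) + 1 :=
    fun n => h.pos.mono fun x hx => ⟨hx, damping_bounds (hM n) hx⟩
  have hline : ∀ n j, HasLineDeriv μ (γ j) (fun x => g x * θ n x)
      (fun x => g' j x * θ n x + g x * (θ' n x * Dw j x)) := fun n j =>
    (hg j).mul (((h.weakDeriv j).hasLineDeriv (hγ j)).comp (hγ j) (h.pos.mono fun x hx => hx.le)
      (Φ := fun y => ((n : ℝ) + 1) * y / ((n : ℝ) + 1 + y))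
      (Φ' := fun y => ((n : ℝ) + 1) ^ 2 / ((n : ℝ) + 1 + y) ^ 2)
      (fun y hy => hasDerivAt_damping (hM n) hy)
      (ContinuousOn.div (by fun_prop) (by fun_prop) fun y hy => by
        have : (0 : ℝ) ≤ y := hy
        have := hM n
        positivity))
  have hL2 : ∀ n j, MemLp (fun x => g' j x * θ n x + g x * (θ' n x * Dw j x)) 2 μ := by
    intro n j
    refine MemLp.add ?_ ?_
    · refine (hg' j).of_le_mul (c := √((n : ℝ) + 1)) ((hgm' j).mul (hθm n)) ?_
      filter_upwards [hbd n] with x hx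
      obtain ⟨h1, h2, -, -, h5, -⟩ := hx
      have : θ n x ≤ √((n : ℝ) + 1) * √(w x) := by
        rw [← Real.sqrt_mul (hM n).le]
        exact Real.le_sqrt_of_sq_le h5
      rw [norm_mul, norm_mul, Real.norm_of_nonneg h2.le, Real.norm_of_nonneg (Real.sqrt_nonneg _)]
      calc ‖g' j x‖ * θ n x ≤ ‖g' j x‖ * (√((n : ℝ) + 1) * √(w x)) := by gcongr
        _ = _ := by ring
    · have hb : MemLp (K.indicator fun x => Dw j x / w x) 2 μ :=
        (memLp_indicator_iff_restrict hK.measurableSet).2 (h.deriv_div j K hK)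
      refine hb.of_le_mul (c := C * ((n : ℝ) + 1)) (hgm.mul ((hθm' n).mul (hDm j))) ?_
      filter_upwards [hbd n] with x hx
      obtain ⟨h1, -, -, -, -, h6, -, h8⟩ := hx
      by_cases hxK : x ∈ K
      · rw [indicator_of_mem hxK, norm_mul, mul_assoc]
        refine mul_le_mul (hC x) ?_ (norm_nonneg _) hC0
        have e : θ' n x * Dw j x = (θ' n x * w x) * (Dw j x / w x) := by
          field_simp
        rw [e, norm_mul, Real.norm_of_nonneg (mul_pos h6 h1).le]
        gcongr
      · simp [hg0 x hxK, indicator_of_notMem hxK]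
  have hid := fun n => h.sum_integral_mul_deriv_div hγ (hline n) (hgm.mul (hθm n))
    (C := C * ((n : ℝ) + 1)) (by
      filter_upwards [hbd n] with x hx
      rw [abs_mul, abs_of_pos hx.2.1]
      exact mul_le_mul (hC x) hx.2.2.1 hx.2.1.le hC0) (hL2 n) hK
    (fun x hx => by simp [hg0 x hx]) (fun j x hx => by simp [hg0 x hx, hg0' j x hx])
  refine tendsto_nhds_unique (l := (atTop : Filter ℕ)) (tendsto_finsetSum Finset.univ fun j _ => ?_)
    (Tendsto.congr (fun n => (hid n).symm) ?_)
  -- With e = X_j w/√w the integrand equals (θ/w)(√w g')e + g(θ' − θ/w)e². Both θ/w and θ' lie in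
  -- [0, 1], so the first term is at most (√w g')² + e² and the second at most 2Ce².
  · refine tendsto_integral_of_dominated_convergence
      (fun x => (√(w x) * g' j x) ^ 2 + (1 + 2 * C) * (Dw j x / √(w x)) ^ 2) (fun n => ?_)
      (((hg' j).restrict K).integrable_sq.add ((h.deriv_sqrt j K hK).integrable_sq.const_mul _))
      (fun n => ?_) ?_
    · exact (((hL2 n j).1.mul ((hDm j).aemeasurable.div hwm.aemeasurable).aestronglyMeasurable).sub
        ((hgm.mul (hθm n)).mul
          (((hDm j).aemeasurable.div hwm.aemeasurable).pow_const 2).aestronglyMeasurable)).restrict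
    · filter_upwards [ae_restrict_of_ae (hbd n)] with x hx
      obtain ⟨h1, h2, -, h4, -, h6, h7, -⟩ := hx
      have hs : 0 < √(w x) := Real.sqrt_pos.2 h1
      have hsq : √(w x) ^ 2 = w x := Real.sq_sqrt h1.le
      set e := Dw j x / √(w x) with he
      have hD : Dw j x = e * √(w x) := by rw [he]; field_simp
      have hdiv : Dw j x / w x = e / √(w x) := by
        rw [div_eq_div_iff h1.ne' hs.ne', hD]
        linear_combination e * hsq
      have hq : θ n x / w x ≤ 1 := (div_le_one h1).2 h4
      have hq0 : 0 ≤ θ n x / w x := by positivity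
      have e1 : (g' j x * θ n x + g x * (θ' n x * Dw j x)) * (Dw j x / w x) -
          g x * θ n x * (Dw j x / w x) ^ 2 = (θ n x / w x) * ((√(w x) * g' j x) * e)
          + g x * ((θ' n x - θ n x / w x) * e ^ 2) := by
        have aux : ∀ s e a b t t' : ℝ, s ≠ 0 → (a * t + b * (t' * (e * s))) * (e / s) -
            b * t * (e / s) ^ 2 = (t / s ^ 2) * ((s * a) * e) + b * ((t' - t / s ^ 2) * e ^ 2) := by
          intro s e a b t t' hs
          field_simp
          ring
        have := aux (√(w x)) e (g' j x) (g x) (θ n x) (θ' n x) hs.ne'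
        rwa [hsq, ← hdiv, ← hD] at this
      rw [e1, Real.norm_eq_abs]
      have b1 : |(θ n x / w x) * ((√(w x) * g' j x) * e)| ≤ (√(w x) * g' j x) ^ 2 + e ^ 2 := by
        rw [abs_mul, abs_of_nonneg hq0]
        refine (mul_le_of_le_one_left (abs_nonneg _) hq).trans ?_
        rw [abs_le]
        constructor <;> nlinarith [sq_nonneg (√(w x) * g' j x - e), sq_nonneg (√(w x) * g' j x + e),
          sq_nonneg e, sq_nonneg (√(w x) * g' j x)]
      have b2 : |g x * ((θ' n x - θ n x / w x) * e ^ 2)| ≤ C * (2 * e ^ 2) := by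
        rw [abs_mul]
        refine mul_le_mul (hC x) ?_ (abs_nonneg _) hC0
        rw [abs_mul, abs_of_nonneg (sq_nonneg e)]
        refine mul_le_mul_of_nonneg_right ?_ (sq_nonneg e)
        rw [abs_le]
        constructor <;> linarith
      refine (abs_add_le _ _).trans ((add_le_add b1 b2).trans (le_of_eq ?_))
      ring
    · filter_upwards [ae_restrict_of_ae h.pos] with x hx
      have ⟨t1, t2⟩ := tendsto_damping (w x)
      have := (((t1.const_mul (g' j x)).add ((t2.mul_const (Dw j x)).const_mul (g x))).mul_const
        (Dw j x / w x)).sub ((t1.const_mul (g x)).mul_const ((Dw j x / w x) ^ 2))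
      convert this using 2
      field_simp
      ring
  · have e : ∀ n x, g x * θ n x * (Lw x / w x) = g x * (θ n x * (Lw x / w x)) := fun n x => by ring
    simp_rw [e]
    refine tendsto_integral_bdd_mul (B := fun x => |Lw x|) hgm.restrict (Eventually.of_forall hC)
      (fun n => ((hθm n).mul h.subLaplacian_div.aestronglyMeasurable).restrict)
      (h.weakSubLaplacian.locInt_subLaplacian.integrableOn_isCompact hK).abs (fun n => ?_) ?_
    · filter_upwards [ae_restrict_of_ae (hbd n)] with x hx
      obtain ⟨h1, h2, -, h4, -⟩ := hx
      rw [abs_mul, abs_of_pos h2, abs_div, abs_of_pos h1, mul_div_assoc', div_le_iff₀ h1, mul_comm]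
      gcongr
    · filter_upwards [ae_restrict_of_ae h.pos] with x hx
      have := (tendsto_damping (w x)).1.mul_const (Lw x / w x)
      rwa [mul_div_cancel₀ _ hx.ne'] at this

end RegularWeight
end CompactIdentities

/-! ### Equality of energies for bounded functions with compact support -/

section EnergyIdentities
open Set Filter Topology

set_option linter.unusedSectionVars false

theorem norm_sub_mul_ofReal_sq (z z' : ℂ) (t : ℝ) :
    ‖z' - z * (t : ℂ)‖ ^ 2 = ‖z'‖ ^ 2 - t * (2 * (z.re * z'.re + z.im * z'.im)) +
      t ^ 2 * ‖z‖ ^ 2 := by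
  simp only [Complex.sq_norm, Complex.normSq_apply, Complex.sub_re, Complex.sub_im, Complex.mul_re,
    Complex.mul_im, Complex.ofReal_re, Complex.ofReal_im]
  ring

theorem abs_two_mul_inner_le (z z' : ℂ) :
    |2 * (z.re * z'.re + z.im * z'.im)| ≤ 2 * ‖z‖ * ‖z'‖ := by
  have h1 : z.re * z'.re + z.im * z'.im = (conj z * z').re := by simp
  rw [h1, abs_mul, abs_two, mul_assoc]
  have := Complex.abs_re_le_norm (conj z * z')
  rw [norm_mul, RCLike.norm_conj] at this
  linarith

variable {E : Type*} [NormedAddCommGroup E] [NormedSpace ℝ E] [FiniteDimensional ℝ E]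
  {G : Type*} [TopologicalSpace G] [ChartedSpace E G] [Group G]
  [LieGroup 𝓘(ℝ, E) ∞ G] [IsTopologicalGroup G] [LocallyCompactSpace G]
  [T2Space G] [SecondCountableTopology G] [MeasurableSpace G] [BorelSpace G]
  {μ : Measure G} [μ.IsHaarMeasure] {S : SubRiemannian E G} {w Lw : G → ℝ}
  {Dw : Fin S.dim → G → ℝ} {γ : Fin S.dim → ℝ → G}

theorem potential_eq (x : G) : potential w Dw Lw x =
    -(∑ j, (Dw j x / w x) ^ 2) / 4 - Lw x / w x / 2 := by
  simp only [potential, div_pow, ← Finset.sum_div]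
  ring

namespace RegularWeight

/-- Here u' − u X_j w/(2w) is √w times the derivative of u/√w. Expanding its square, the two
energies differ by half of the equation of log w tested with |u|², whose derivative is in L² since u
is bounded. -/
theorem energy_eq_of_schrodinger (h : RegularWeight S μ w Dw Lw)
    (hγ : ∀ j, IsOneParam (S.X j) (γ j)) (m : ℝ)
    {u : G → ℂ} {u' : Fin S.dim → G → ℂ} (hu : ∀ j, HasLineDeriv μ (γ j) u (u' j))
    (hum : AEStronglyMeasurable u μ) {C : ℝ} (hC : ∀ x, ‖u x‖ ≤ C)
    (hu' : ∀ j, MemLp (u' j) 2 μ) {K : Set G} (hK : IsCompact K)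
    (hu0 : ∀ x, x ∉ K → u x = 0) :
    Integrable (fun x => ∑ j, ‖u' j x - u x * ((Dw j x / (2 * w x) : ℝ) : ℂ)‖ ^ 2
      + m * ‖u x‖ ^ 2) μ ∧
    Integrable (fun x => ∑ j, ‖u' j x‖ ^ 2 + (potential w Dw Lw x + m) * ‖u x‖ ^ 2) μ ∧
    ∫ x, (∑ j, ‖u' j x - u x * ((Dw j x / (2 * w x) : ℝ) : ℂ)‖ ^ 2 + m * ‖u x‖ ^ 2) ∂μ =
      ∫ x, (∑ j, ‖u' j x‖ ^ 2 + (potential w Dw Lw x + m) * ‖u x‖ ^ 2) ∂μ := by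
  set ψ' : Fin S.dim → G → ℝ := fun j x => 2 * ((u x).re * (u' j x).re + (u x).im * (u' j x).im)
    with hψ'
  have hψm : AEStronglyMeasurable (fun x => ‖u x‖ ^ 2) μ := hum.norm.pow 2
  have hψC : ∀ x, |‖u x‖ ^ 2| ≤ C ^ 2 := fun x => by
    rw [abs_of_nonneg (sq_nonneg _)]
    exact pow_le_pow_left₀ (norm_nonneg _) (hC x) 2
  have hψm' : ∀ j, AEStronglyMeasurable (ψ' j) μ := fun j =>
    (((Complex.continuous_re.comp_aestronglyMeasurable hum).mul
      (Complex.continuous_re.comp_aestronglyMeasurable (hu' j).1)).add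
      ((Complex.continuous_im.comp_aestronglyMeasurable hum).mul
      (Complex.continuous_im.comp_aestronglyMeasurable (hu' j).1))).const_mul 2
  have hψL : ∀ j, MemLp (ψ' j) 2 μ := fun j =>
    (hu' j).of_le_mul (c := 2 * C) (hψm' j) (Eventually.of_forall fun x =>
      (abs_two_mul_inner_le _ _).trans (by gcongr; exact hC x))
  have h0 : ∀ x, x ∉ K → ‖u x‖ ^ 2 = 0 := fun x hx => by simp [hu0 x hx]
  have h0' : ∀ j x, x ∉ K → ψ' j x = 0 := fun j x hx => by simp [hψ', hu0 x hx]
  have hmain := h.sum_integral_mul_deriv_div hγ (fun j => (hu j).normSq) hψm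
    (Eventually.of_forall hψC) hψL hK h0 h0'
  have ib : ∀ {f : G → ℝ}, IntegrableOn f K μ → Integrable (fun x => ‖u x‖ ^ 2 * f x) μ :=
    fun hf => integrable_of_integrableOn
      (Integrable.bdd_mul hf hψm.restrict (Eventually.of_forall hψC)) fun x hx => by simp [hu0 x hx]
  have iP : ∀ j, Integrable (fun x => ψ' j x * (Dw j x / w x) - ‖u x‖ ^ 2 * (Dw j x / w x) ^ 2) μ :=
    fun j => (integrable_of_integrableOn (((hψL j).restrict K).integrable_mul (h.deriv_div j K hK))
      fun x hx => by simp [h0' j x hx]).sub (ib (h.deriv_div j K hK).integrable_sq)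
  have iR : Integrable (fun x => ‖u x‖ ^ 2 * (Lw x / w x)) μ :=
    ib (h.subLaplacian_div.integrableOn_isCompact hK)
  have iV : Integrable (fun x => ‖u x‖ ^ 2 * (potential w Dw Lw x + m)) μ := by
    refine ib ?_
    simp_rw [potential_eq]
    have hfinK : IsFiniteMeasure (μ.restrict K) := ⟨by simpa using hK.measure_lt_top⟩
    exact (((integrable_finsetSum _ fun j _ => (h.deriv_div j K hK).integrable_sq).neg.div_const
      4).sub ((h.subLaplacian_div.integrableOn_isCompact hK).div_const 2)).add (integrable_const m)
  have iH : Integrable (fun x => ∑ j, ‖u' j x‖ ^ 2 + (potential w Dw Lw x + m) * ‖u x‖ ^ 2) μ := by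
    refine (integrable_finsetSum _ fun j _ => (hu' j).norm.integrable_sq).add ?_
    simpa only [mul_comm] using iV
  have e : (fun x => ∑ j, ‖u' j x - u x * ((Dw j x / (2 * w x) : ℝ) : ℂ)‖ ^ 2 + m * ‖u x‖ ^ 2) =
      fun x => (∑ j, ‖u' j x‖ ^ 2 + (potential w Dw Lw x + m) * ‖u x‖ ^ 2) -
        ((∑ j, (ψ' j x * (Dw j x / w x) - ‖u x‖ ^ 2 * (Dw j x / w x) ^ 2)) -
          ‖u x‖ ^ 2 * (Lw x / w x)) / 2 := by
    funext x
    have e1 : ∀ j, ‖u' j x - u x * ((Dw j x / (2 * w x) : ℝ) : ℂ)‖ ^ 2 = ‖u' j x‖ ^ 2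
        - ψ' j x * (Dw j x / w x) / 2 + ‖u x‖ ^ 2 * (Dw j x / w x) ^ 2 / 4 := fun j => by
      have hd : Dw j x / (2 * w x) = Dw j x / w x / 2 := by ring
      rw [norm_sub_mul_ofReal_sq, hd]
      simp only [hψ']
      ring
    simp only [e1, potential_eq, Finset.sum_add_distrib, Finset.sum_sub_distrib, ← Finset.sum_div,
      ← Finset.mul_sum]
    ring
  have iS := ((integrable_finsetSum Finset.univ fun j _ => iP j).sub iR).div_const 2
  have iF := iH.sub iS
  refine ⟨?_, iH, ?_⟩
  · rw [e]
    exact iF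
  · rw [e]
    refine (integral_sub iH iS).trans ?_
    have z : ∫ x, ((∑ j, (ψ' j x * (Dw j x / w x) - ‖u x‖ ^ 2 * (Dw j x / w x) ^ 2)) -
        ‖u x‖ ^ 2 * (Lw x / w x)) / 2 ∂μ = 0 := by
      rw [integral_div, integral_sub (integrable_finsetSum Finset.univ fun j _ => iP j) iR,
        integral_finsetSum _ fun j _ => iP j]
      rw [setIntegral_eq_integral_of_forall_compl_eq_zero fun x hx => by simp [hu0 x hx]] at hmain
      rw [Finset.sum_congr rfl fun j _ => setIntegral_eq_integral_of_forall_compl_eq_zero (μ := μ)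
        (s := K) (f := fun x => ψ' j x * (Dw j x / w x) - ‖u x‖ ^ 2 * (Dw j x / w x) ^ 2)
        fun x hx => by rw [h0' j x hx, h0 x hx, zero_mul, zero_mul, sub_zero]] at hmain
      rw [hmain, sub_self, zero_div]
    exact (congrArg _ z).trans (sub_zero _)

/-- The companion identity starting from the weighted side. Only √w g' is in L², so it rests on the
equation of w itself, tested with |g|². -/
theorem energy_eq_of_weighted (h : RegularWeight S μ w Dw Lw)
    (hγ : ∀ j, IsOneParam (S.X j) (γ j)) (m : ℝ)
    {g : G → ℂ} {g' : Fin S.dim → G → ℂ} (hg : ∀ j, HasLineDeriv μ (γ j) g (g' j))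
    (hgm : AEStronglyMeasurable g μ) {C : ℝ} (hC : ∀ x, ‖g x‖ ≤ C)
    (hgm' : ∀ j, AEStronglyMeasurable (g' j) μ)
    (hg' : ∀ j, MemLp (fun x => g' j x * (√(w x) : ℂ)) 2 μ) {K : Set G} (hK : IsCompact K)
    (hg0 : ∀ x, x ∉ K → g x = 0) :
    Integrable (fun x => ∑ j, ‖g' j x * (√(w x) : ℂ) + g x * ((Dw j x / (2 * √(w x)) : ℝ) : ℂ)‖ ^ 2
      + (potential w Dw Lw x + m) * ‖g x * (√(w x) : ℂ)‖ ^ 2) μ ∧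
    Integrable (fun x => ∑ j, ‖g' j x * (√(w x) : ℂ)‖ ^ 2 + m * ‖g x * (√(w x) : ℂ)‖ ^ 2) μ ∧
    ∫ x, (∑ j, ‖g' j x * (√(w x) : ℂ) + g x * ((Dw j x / (2 * √(w x)) : ℝ) : ℂ)‖ ^ 2
      + (potential w Dw Lw x + m) * ‖g x * (√(w x) : ℂ)‖ ^ 2) ∂μ =
      ∫ x, (∑ j, ‖g' j x * (√(w x) : ℂ)‖ ^ 2 + m * ‖g x * (√(w x) : ℂ)‖ ^ 2) ∂μ := by
  set ψ' : Fin S.dim → G → ℝ := fun j x => 2 * ((g x).re * (g' j x).re + (g x).im * (g' j x).im)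
    with hψ'
  have hC0 : 0 ≤ C := (norm_nonneg _).trans (hC 1)
  have hψm : AEStronglyMeasurable (fun x => ‖g x‖ ^ 2) μ := hgm.norm.pow 2
  have hψC : ∀ x, |‖g x‖ ^ 2| ≤ C ^ 2 := fun x => by
    rw [abs_of_nonneg (sq_nonneg _)]
    exact pow_le_pow_left₀ (norm_nonneg _) (hC x) 2
  have hψm' : ∀ j, AEStronglyMeasurable (ψ' j) μ := fun j =>
    (((Complex.continuous_re.comp_aestronglyMeasurable hgm).mul
      (Complex.continuous_re.comp_aestronglyMeasurable (hgm' j))).add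
      ((Complex.continuous_im.comp_aestronglyMeasurable hgm).mul
      (Complex.continuous_im.comp_aestronglyMeasurable (hgm' j)))).const_mul 2
  have hwm : AEStronglyMeasurable (fun x => √(w x)) μ :=
    Real.continuous_sqrt.comp_aestronglyMeasurable h.locInt.aestronglyMeasurable
  have hψL : ∀ j, MemLp (fun x => √(w x) * ψ' j x) 2 μ := fun j =>
    (hg' j).of_le_mul (c := 2 * C) (hwm.mul (hψm' j)) (Eventually.of_forall fun x => by
      rw [norm_mul, norm_mul (g' j x), Complex.norm_real]
      calc ‖√(w x)‖ * ‖ψ' j x‖ ≤ ‖√(w x)‖ * (2 * C * ‖g' j x‖) := by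
            gcongr
            refine (abs_two_mul_inner_le _ _).trans ?_
            gcongr
            exact hC x
        _ = _ := by ring)
  have h0 : ∀ x, x ∉ K → ‖g x‖ ^ 2 = 0 := fun x hx => by simp [hg0 x hx]
  have h0' : ∀ j x, x ∉ K → ψ' j x = 0 := fun j x hx => by simp [hψ', hg0 x hx]
  have hmain := h.sum_integral_mul_deriv hγ (fun j => (hg j).normSq) hψm hψC hψm' hψL hK h0 h0'
  have ib : ∀ {f : G → ℝ}, IntegrableOn f K μ → Integrable (fun x => ‖g x‖ ^ 2 * f x) μ :=
    fun hf => integrable_of_integrableOn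
      (Integrable.bdd_mul hf hψm.restrict (Eventually.of_forall hψC)) fun x hx => by simp [hg0 x hx]
  have iP : ∀ j, Integrable (fun x => ψ' j x * Dw j x) μ := fun j => by
    refine integrable_of_integrableOn (K := K) ?_ fun x hx => by simp [h0' j x hx]
    have i1 : Integrable ((fun x => √(w x) * ψ' j x) * fun x => Dw j x / √(w x)) (μ.restrict K) :=
      ((hψL j).restrict K).integrable_mul (h.deriv_sqrt j K hK)
    refine i1.congr ?_
    filter_upwards [ae_restrict_of_ae h.pos] with x hx
    have := Real.sqrt_pos.2 hx
    simp only [Pi.mul_apply]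
    field_simp
  have iR : Integrable (fun x => ‖g x‖ ^ 2 * Lw x) μ :=
    ib (h.weakSubLaplacian.locInt_subLaplacian.integrableOn_isCompact hK)
  have iH : Integrable (fun x => ∑ j, ‖g' j x * (√(w x) : ℂ)‖ ^ 2
      + m * ‖g x * (√(w x) : ℂ)‖ ^ 2) μ := by
    refine (integrable_finsetSum _ fun j _ => (hg' j).norm.integrable_sq).add
      (Integrable.const_mul ((ib (h.locInt.integrableOn_isCompact hK)).congr ?_) m)
    filter_upwards [h.pos] with x hx
    rw [norm_mul, mul_pow, Complex.norm_real, Real.norm_of_nonneg (Real.sqrt_nonneg _),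
      Real.sq_sqrt hx.le]
  have e : (fun x => (∑ j, ‖g' j x * (√(w x) : ℂ)‖ ^ 2 + m * ‖g x * (√(w x) : ℂ)‖ ^ 2) +
        ((∑ j, ψ' j x * Dw j x) - ‖g x‖ ^ 2 * Lw x) / 2) =ᵐ[μ]
      (fun x => ∑ j, ‖g' j x * (√(w x) : ℂ) + g x * ((Dw j x / (2 * √(w x)) : ℝ) : ℂ)‖ ^ 2
      + (potential w Dw Lw x + m) * ‖g x * (√(w x) : ℂ)‖ ^ 2) := by
    filter_upwards [h.pos] with x hx
    have hs := Real.sqrt_pos.2 hx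
    have hsq := Real.sq_sqrt hx.le
    have e0 : ‖g x * (√(w x) : ℂ)‖ ^ 2 = w x * ‖g x‖ ^ 2 := by
      rw [norm_mul, mul_pow, Complex.norm_real, Real.norm_of_nonneg hs.le, hsq, mul_comm]
    have e1 : ∀ j, ‖g' j x * (√(w x) : ℂ) + g x * ((Dw j x / (2 * √(w x)) : ℝ) : ℂ)‖ ^ 2 =
        ‖g' j x * (√(w x) : ℂ)‖ ^ 2 + ψ' j x * Dw j x / 2 +
          w x * ‖g x‖ ^ 2 * (Dw j x / w x) ^ 2 / 4 := fun j => by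
      have e2 := norm_sub_mul_ofReal_sq (g x) (g' j x * (√(w x) : ℂ)) (-(Dw j x / (2 * √(w x))))
      rw [Complex.ofReal_neg, mul_neg, sub_neg_eq_add] at e2
      rw [e2, Complex.re_mul_ofReal, Complex.im_mul_ofReal]
      have e3 : (Dw j x / (2 * √(w x))) ^ 2 = w x * (Dw j x / w x) ^ 2 / 4 := by
        rw [div_pow, mul_pow, hsq]
        field_simp
        norm_num
      have e4 : Dw j x / (2 * √(w x)) * √(w x) = Dw j x / 2 := by field_simp
      rw [neg_sq, e3]
      simp only [hψ']
      linear_combination (2 * ((g x).re * (g' j x).re + (g x).im * (g' j x).im)) * e4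
    simp only [e1, e0, potential_eq, Finset.sum_add_distrib, ← Finset.sum_div, ← Finset.mul_sum]
    have e5 : w x * (Lw x / w x) = Lw x := mul_div_cancel₀ _ hx.ne'
    linear_combination (‖g x‖ ^ 2 / 2) * e5
  have iS := ((integrable_finsetSum Finset.univ fun j _ => iP j).sub iR).div_const 2
  refine ⟨(iH.add iS).congr e, iH, ?_⟩
  rw [← integral_congr_ae e]
  refine (integral_add iH iS).trans ?_
  have z : ∫ x, ((∑ j, ψ' j x * Dw j x) - ‖g x‖ ^ 2 * Lw x) / 2 ∂μ = 0 := by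
    rw [integral_div, integral_sub (integrable_finsetSum Finset.univ fun j _ => iP j) iR,
      integral_finsetSum _ fun j _ => iP j]
    rw [setIntegral_eq_integral_of_forall_compl_eq_zero fun x hx => by simp [hg0 x hx]] at hmain
    rw [Finset.sum_congr rfl fun j _ => setIntegral_eq_integral_of_forall_compl_eq_zero (μ := μ)
      (s := K) (f := fun x => ψ' j x * Dw j x) fun x hx => by rw [h0' j x hx, zero_mul]] at hmain
    rw [hmain, sub_self, zero_div]
  exact (congrArg _ z).trans (add_zero _)

end RegularWeight
end EnergyIdentities

/-! ### Passing to the limit in an identity of energies -/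

section Fatou
open Set Filter Topology

variable {α : Type*} [MeasurableSpace α] {ν : Measure α}

/-- Fatou's lemma on one side of an identity and dominated convergence on the other one. -/
theorem integral_le_of_tendsto {F H : ℕ → α → ℝ} {F' H' B : α → ℝ}
    (hFi : ∀ n, Integrable (F n) ν) (hF0 : ∀ n, 0 ≤ᵐ[ν] F n)
    (hFt : ∀ᵐ x ∂ν, Tendsto (fun n => F n x) atTop (𝓝 (F' x)))
    (hHm : ∀ n, AEStronglyMeasurable (H n) ν) (hB : Integrable B ν)
    (hHB : ∀ n, ∀ᵐ x ∂ν, ‖H n x‖ ≤ B x)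
    (hHt : ∀ᵐ x ∂ν, Tendsto (fun n => H n x) atTop (𝓝 (H' x)))
    (heq : ∀ n, ∫ x, F n x ∂ν = ∫ x, H n x ∂ν) :
    Integrable F' ν ∧ ∫ x, F' x ∂ν ≤ ∫ x, H' x ∂ν := by
  have hm : AEStronglyMeasurable F' ν :=
    aestronglyMeasurable_of_tendsto_ae atTop (fun n => (hFi n).1) hFt
  have h0 : 0 ≤ᵐ[ν] F' := by
    filter_upwards [ae_all_iff.2 hF0, hFt] with x h1 h2
    exact ge_of_tendsto' h2 h1
  have hH := tendsto_integral_of_dominated_convergence B hHm hB hHB hHt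
  have hle : ∫⁻ x, ENNReal.ofReal (F' x) ∂ν ≤ ENNReal.ofReal (∫ x, H' x ∂ν) := by
    calc ∫⁻ x, ENNReal.ofReal (F' x) ∂ν
        = ∫⁻ x, liminf (fun n => ENNReal.ofReal (F n x)) atTop ∂ν := by
          refine lintegral_congr_ae ?_
          filter_upwards [hFt] with x hx
          exact ((ENNReal.continuous_ofReal.tendsto _).comp hx).liminf_eq.symm
      _ ≤ liminf (fun n => ∫⁻ x, ENNReal.ofReal (F n x) ∂ν) atTop :=
          lintegral_liminf_le' fun n => (hFi n).1.aemeasurable.ennreal_ofReal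
      _ = liminf (fun n => ENNReal.ofReal (∫ x, H n x ∂ν)) atTop := by
          congr 1
          funext n
          rw [← heq n, ofReal_integral_eq_lintegral_ofReal (hFi n) (hF0 n)]
      _ = ENNReal.ofReal (∫ x, H' x ∂ν) :=
          ((ENNReal.continuous_ofReal.tendsto _).comp hH).liminf_eq
  have hH0 : 0 ≤ ∫ x, H' x ∂ν := ge_of_tendsto' hH fun n => by
    rw [← heq n]
    exact integral_nonneg_of_ae (hF0 n)
  refine ⟨⟨hm, (hasFiniteIntegral_iff_ofReal h0).2 (hle.trans_lt ENNReal.ofReal_lt_top)⟩, ?_⟩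
  rw [integral_eq_lintegral_of_nonneg_ae h0 hm]
  exact ENNReal.toReal_le_of_le_ofReal hH0 hle

end Fatou

/-! ### Truncation and the two energy inequalities -/

section EnergyInequalities
open Set Filter Topology

set_option linter.unusedSectionVars false

variable {E : Type*} [NormedAddCommGroup E] [NormedSpace ℝ E] [FiniteDimensional ℝ E]
  {G : Type*} [TopologicalSpace G] [ChartedSpace E G] [Group G]
  [LieGroup 𝓘(ℝ, E) ∞ G] [IsTopologicalGroup G] [LocallyCompactSpace G]
  [T2Space G] [SecondCountableTopology G] [MeasurableSpace G] [BorelSpace G]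
  {μ : Measure G} [μ.IsHaarMeasure]

theorem tendsto_truncation (y : ℝ) :
    Tendsto (fun n : ℕ => ((n : ℝ) + 1) / ((n : ℝ) + 1 + y)) atTop (𝓝 1) ∧
      Tendsto (fun n : ℕ => -(((n : ℝ) + 1) / ((n : ℝ) + 1 + y) ^ 2)) atTop (𝓝 0) := by
  have h1 : Tendsto (fun n : ℕ => ((n : ℝ) + 1)) atTop atTop :=
    tendsto_atTop_add_const_right _ _ tendsto_natCast_atTop_atTop
  have h2 : Tendsto (fun n : ℕ => 1 + y / ((n : ℝ) + 1)) atTop (𝓝 1) := by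
    simpa using (tendsto_const_nhds (x := (1 : ℝ))).add (h1.const_div_atTop y)
  have h3 : Tendsto (fun n : ℕ => (1 + y / ((n : ℝ) + 1))⁻¹) atTop (𝓝 1) := by
    simpa using h2.inv₀ one_ne_zero
  have e : ∀ n : ℕ, (1 + y / ((n : ℝ) + 1))⁻¹ = ((n : ℝ) + 1) / ((n : ℝ) + 1 + y) := by
    intro n
    have : (n : ℝ) + 1 ≠ 0 := by positivity
    rw [one_add_div this, inv_div]
  simp_rw [e] at h3
  refine ⟨h3, ?_⟩
  have h4 : Tendsto (fun n : ℕ => ((n : ℝ) + 1 + y)⁻¹) atTop (𝓝 0) :=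
    (tendsto_atTop_add_const_right _ y h1).inv_tendsto_atTop
  have := (h3.mul h4).neg
  simpa only [one_mul, mul_zero, neg_zero, ← div_eq_mul_inv, div_div, ← sq] using this

/-- Truncation of a function to bounded functions with compact support. -/
theorem exists_truncation {ι : Type*} [Finite ι] {X : ι → GroupLieAlgebra 𝓘(ℝ, E) G}
    {γ : ι → ℝ → G} (hγ : ∀ j, IsOneParam (X j) (γ j)) {f : G → ℂ} {f' : ι → G → ℂ}
    (hf : ∀ j, HasLineDeriv μ (γ j) f (f' j)) (hfm : AEStronglyMeasurable f μ)
    (hfm' : ∀ j, AEStronglyMeasurable (f' j) μ) :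
    ∃ (g : ℕ → G → ℂ) (g' : ℕ → ι → G → ℂ) (C : ℝ), 0 ≤ C ∧
      (∀ n j, HasLineDeriv μ (γ j) (g n) (g' n j)) ∧ (∀ n, AEStronglyMeasurable (g n) μ) ∧
      (∀ n j, AEStronglyMeasurable (g' n j) μ) ∧ (∀ n, ∃ R, ∀ x, ‖g n x‖ ≤ R) ∧
      (∀ n, ∃ K, IsCompact K ∧ ∀ x, x ∉ K → g n x = 0) ∧ (∀ n x, ‖g n x‖ ≤ ‖f x‖) ∧
      (∀ n j x, ‖g' n j x‖ ≤ 3 * ‖f' j x‖ + C * ‖f x‖) ∧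
      (∀ x, Tendsto (fun n => g n x) atTop (𝓝 (f x))) ∧
      ∀ j x, Tendsto (fun n => g' n j x) atTop (𝓝 (f' j x)) := by
  obtain ⟨χ, D, C, hχc, hDc, hχ, hD, hχK, hχ1, hχD⟩ := exists_cutoff μ X hγ
  set h' : ι → G → ℝ := fun j x => 2 * ((f x).re * (f' j x).re + (f x).im * (f' j x).im) with hh'
  -- A smooth function of |f|² tending to 1. It makes fσ_n bounded by n + 1, and |f|²|σ_n'| ≤ 1
  -- bounds the term where the derivative hits σ_n by 2|f'|; with f'σ_n this explains the factor 3.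
  set σ : ℕ → G → ℝ := fun n x => ((n : ℝ) + 1) / ((n : ℝ) + 1 + ‖f x‖ ^ 2) with hσ
  set σ' : ℕ → G → ℝ := fun n x => -(((n : ℝ) + 1) / ((n : ℝ) + 1 + ‖f x‖ ^ 2) ^ 2) with hσ'
  have hN : ∀ n : ℕ, (1 : ℝ) ≤ (n : ℝ) + 1 := fun n => by
    have : (0 : ℝ) ≤ n := n.cast_nonneg
    linarith
  have hσ0 : ∀ n x, 0 ≤ σ n x := fun n x => by positivity
  have hσ1 : ∀ n x, σ n x ≤ 1 := fun n x => by
    rw [hσ]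
    simp only
    rw [div_le_one (by positivity)]
    nlinarith [sq_nonneg ‖f x‖]
  have hσf : ∀ n x, ‖f x‖ * σ n x ≤ (n : ℝ) + 1 := fun n x => by
    rw [hσ]
    simp only
    rw [mul_div_assoc', div_le_iff₀ (by positivity), mul_comm]
    refine mul_le_mul_of_nonneg_left ?_ (by positivity)
    nlinarith [sq_nonneg (‖f x‖ - 1), hN n, norm_nonneg (f x)]
  have hσf' : ∀ n x, ‖f x‖ ^ 2 * |σ' n x| ≤ 1 := fun n x => by
    rw [hσ']
    simp only
    rw [abs_neg, abs_of_nonneg (by positivity), mul_div_assoc', div_le_one (by positivity)]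
    nlinarith [sq_nonneg ‖f x‖, hN n, mul_nonneg (sq_nonneg ‖f x‖) (by positivity : (0:ℝ) ≤ n + 1)]
  have hfn : AEStronglyMeasurable (fun x => ‖f x‖ ^ 2) μ := hfm.norm.pow 2
  have hσm : ∀ n, AEStronglyMeasurable (σ n) μ := fun n =>
    ((hfn.aemeasurable.const_add _).const_div _).aestronglyMeasurable
  have hσm' : ∀ n, AEStronglyMeasurable (σ' n) μ := fun n =>
    ((((hfn.aemeasurable.const_add _).pow_const 2).const_div _).neg).aestronglyMeasurable
  have hhm : ∀ j, AEStronglyMeasurable (h' j) μ := fun j =>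
    (((Complex.continuous_re.comp_aestronglyMeasurable hfm).mul
      (Complex.continuous_re.comp_aestronglyMeasurable (hfm' j))).add
      ((Complex.continuous_im.comp_aestronglyMeasurable hfm).mul
      (Complex.continuous_im.comp_aestronglyMeasurable (hfm' j)))).const_mul 2
  have hline : ∀ n j, HasLineDeriv μ (γ j) (fun x => f x * ((χ n x * σ n x : ℝ) : ℂ))
      (fun x => f' j x * ((χ n x * σ n x : ℝ) : ℂ) +
        f x * ((D n j x * σ n x + χ n x * (σ' n x * h' j x) : ℝ) : ℂ)) := fun n j =>
    (hf j).mul_ofReal ((hχD n j).mul ((hf j).normSq.comp (hγ j)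
      (Eventually.of_forall fun x => sq_nonneg _)
      (Φ := fun y => ((n : ℝ) + 1) / ((n : ℝ) + 1 + y))
      (Φ' := fun y => -(((n : ℝ) + 1) / ((n : ℝ) + 1 + y) ^ 2))
      (fun y hy => (((hasDerivAt_id y).const_add ((n : ℝ) + 1)).inv
        (by simp only [id]; positivity)).const_mul ((n : ℝ) + 1) |>.congr_deriv (by
          simp only [id]; ring))
      (ContinuousOn.neg (ContinuousOn.div (by fun_prop) (by fun_prop) fun y hy => by
        have : (0 : ℝ) ≤ y := hy
        positivity))))
  have ofm : ∀ {p : G → ℝ}, AEStronglyMeasurable p μ →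
      AEStronglyMeasurable (fun x => (p x : ℂ)) μ := fun hp =>
    Complex.continuous_ofReal.comp_aestronglyMeasurable hp
  refine ⟨_, _, |C|, abs_nonneg C, hline, fun n => ?_, fun n j => ?_, fun n => ⟨(n : ℝ) + 1, fun x => ?_⟩,
    fun n => ?_, fun n x => ?_, fun n j x => ?_, fun x => ?_, fun j x => ?_⟩
  · exact hfm.mul (ofm ((hχc n).aestronglyMeasurable.mul (hσm n)))
  · exact ((hfm' j).mul (ofm ((hχc n).aestronglyMeasurable.mul (hσm n)))).add (hfm.mul (ofm
      (((hDc n j).aestronglyMeasurable.mul (hσm n)).add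
        ((hχc n).aestronglyMeasurable.mul ((hσm' n).mul (hhm j))))))
  · rw [norm_mul, Complex.norm_real, norm_mul, Real.norm_of_nonneg (hχ n x).1,
      Real.norm_of_nonneg (hσ0 n x), mul_left_comm]
    exact (mul_le_of_le_one_left (mul_nonneg (norm_nonneg _) (hσ0 n x)) (hχ n x).2).trans (hσf n x)
  · obtain ⟨K, hK, h0⟩ := hχK n
    exact ⟨K, hK, fun x hx => by simp [(h0 x hx).1]⟩
  · rw [norm_mul, Complex.norm_real, norm_mul, Real.norm_of_nonneg (hχ n x).1,
      Real.norm_of_nonneg (hσ0 n x)]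
    exact mul_le_of_le_one_right (norm_nonneg _) (mul_le_one₀ (hχ n x).2 (hσ0 n x) (hσ1 n x))
  · have hχσ : |χ n x * σ n x| ≤ 1 := by
      rw [abs_of_nonneg (mul_nonneg (hχ n x).1 (hσ0 n x))]
      exact mul_le_one₀ (hχ n x).2 (hσ0 n x) (hσ1 n x)
    have b1 : ‖f' j x * ((χ n x * σ n x : ℝ) : ℂ)‖ ≤ ‖f' j x‖ := by
      rw [norm_mul, Complex.norm_real]
      exact mul_le_of_le_one_right (norm_nonneg _) hχσ
    have b2 : ‖f x‖ * |D n j x * σ n x| ≤ |C| * ‖f x‖ := by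
      rw [mul_comm, abs_mul, abs_of_nonneg (hσ0 n x)]
      gcongr
      exact (mul_le_of_le_one_right (abs_nonneg _) (hσ1 n x)).trans ((hD n j x).trans (le_abs_self C))
    have b3 : ‖f x‖ * |χ n x * (σ' n x * h' j x)| ≤ 2 * ‖f' j x‖ := by
      rw [abs_mul, abs_mul, abs_of_nonneg (hχ n x).1]
      calc ‖f x‖ * (χ n x * (|σ' n x| * |h' j x|))
          ≤ ‖f x‖ * (1 * (|σ' n x| * (2 * ‖f x‖ * ‖f' j x‖))) := by
            gcongr
            · exact (hχ n x).2
            · exact abs_two_mul_inner_le _ _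
        _ = (‖f x‖ ^ 2 * |σ' n x|) * (2 * ‖f' j x‖) := by ring
        _ ≤ 1 * (2 * ‖f' j x‖) := by gcongr; exact hσf' n x
        _ = _ := one_mul _
    have b4 : ‖f x * ((D n j x * σ n x + χ n x * (σ' n x * h' j x) : ℝ) : ℂ)‖ ≤
        |C| * ‖f x‖ + 2 * ‖f' j x‖ := by
      rw [norm_mul, Complex.norm_real]
      refine (mul_le_mul_of_nonneg_left (abs_add_le _ _) (norm_nonneg _)).trans ?_
      rw [mul_add]
      exact add_le_add b2 b3
    refine (norm_add_le _ _).trans ((add_le_add b1 b4).trans (le_of_eq ?_))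
    ring
  · have ht := (tendsto_truncation (‖f x‖ ^ 2)).1
    have h1 : Tendsto (fun n => χ n x) atTop (𝓝 1) :=
      tendsto_const_nhds.congr' ((hχ1 x).mono fun n hn => hn.1.symm)
    have := ((Complex.continuous_ofReal.tendsto _).comp (h1.mul ht)).const_mul (f x)
    rw [mul_one, Complex.ofReal_one, mul_one] at this
    exact this
  · have ht := tendsto_truncation (‖f x‖ ^ 2)
    have h1 : Tendsto (fun n => χ n x) atTop (𝓝 1) :=
      tendsto_const_nhds.congr' ((hχ1 x).mono fun n hn => hn.1.symm)
    have h2 : Tendsto (fun n => D n j x) atTop (𝓝 0) :=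
      tendsto_const_nhds.congr' ((hχ1 x).mono fun n hn => (hn.2 j).symm)
    have h3 := ((Complex.continuous_ofReal.tendsto _).comp (h1.mul ht.1)).const_mul (f' j x)
    have h4 := ((Complex.continuous_ofReal.tendsto _).comp ((h2.mul ht.1).add
      (h1.mul (ht.2.mul_const (h' j x))))).const_mul (f x)
    have := h3.add h4
    rw [mul_one, Complex.ofReal_one, mul_one, zero_mul, zero_mul, mul_zero, add_zero,
      Complex.ofReal_zero, mul_zero, add_zero] at this
    exact this

variable {S : SubRiemannian E G} {w Lw : G → ℝ}
  {Dw : Fin S.dim → G → ℝ} {γ : Fin S.dim → ℝ → G}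

namespace RegularWeight

theorem aestronglyMeasurable_potential (h : RegularWeight S μ w Dw Lw) :
    AEStronglyMeasurable (potential w Dw Lw) μ := by
  have hw := h.locInt.aestronglyMeasurable.aemeasurable
  have hD := fun j => (h.weakDeriv j).locInt_deriv.aestronglyMeasurable.aemeasurable
  have hL := h.weakSubLaplacian.locInt_subLaplacian.aestronglyMeasurable.aemeasurable
  have e : potential w Dw Lw = fun x => -(∑ j, (Dw j x / w x) ^ 2) / 4 - Lw x / w x / 2 :=
    funext fun x => potential_eq x
  rw [e]
  exact ((((Finset.aemeasurable_fun_sum _ fun j _ => ((hD j).div hw).pow_const 2).neg.div_const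
    4)).sub ((hL.div hw).div_const 2)).aestronglyMeasurable

/-- For truncations of u the energies agree. The Schrödinger side converges dominatedly because its
terms are integrable by hypothesis; Fatou on the weighted side proves that the limit energy is
finite and no larger. -/
theorem energy_le_of_schrodinger (h : RegularWeight S μ w Dw Lw)
    (hγ : ∀ j, IsOneParam (S.X j) (γ j)) {m : ℝ} (hm : 0 ≤ m)
    (hV : ∀ᵐ x ∂μ, 0 ≤ potential w Dw Lw x + m)
    {u : G → ℂ} {u' : Fin S.dim → G → ℂ} (hu : ∀ j, HasLineDeriv μ (γ j) u (u' j))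
    (hu2 : MemLp u 2 μ) (hu' : ∀ j, MemLp (u' j) 2 μ)
    (huV : Integrable (fun x => (potential w Dw Lw x + m) * ‖u x‖ ^ 2) μ) :
    Integrable (fun x => ∑ j, ‖u' j x - u x * ((Dw j x / (2 * w x) : ℝ) : ℂ)‖ ^ 2
      + m * ‖u x‖ ^ 2) μ ∧
    ∫ x, (∑ j, ‖u' j x - u x * ((Dw j x / (2 * w x) : ℝ) : ℂ)‖ ^ 2 + m * ‖u x‖ ^ 2) ∂μ ≤
      ∫ x, (∑ j, ‖u' j x‖ ^ 2 + (potential w Dw Lw x + m) * ‖u x‖ ^ 2) ∂μ := by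
  obtain ⟨g, g', C, hC, hg, hgm, hgm', hgR, hgK, hgu, hgu', hgt, hgt'⟩ :=
    exists_truncation hγ hu hu2.1 fun j => (hu' j).1
  have hb : ∀ j, MemLp (fun x => 3 * ‖u' j x‖ + C * ‖u x‖) 2 μ := fun j =>
    ((hu' j).norm.const_mul 3).add (hu2.norm.const_mul C)
  have hgL : ∀ n j, MemLp (g' n j) 2 μ := fun n j =>
    (hb j).mono' (hgm' n j) (Eventually.of_forall (hgu' n j))
  choose R hR using hgR
  choose K hK h0 using hgK
  have key := fun n => h.energy_eq_of_schrodinger hγ m (hg n) (hgm n) (hR n) (hgL n) (hK n) (h0 n)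
  refine integral_le_of_tendsto (fun n => (key n).1) (fun n => Eventually.of_forall fun x => ?_)
    (Eventually.of_forall fun x => ?_) (fun n => (key n).2.1.1)
    ((integrable_finsetSum Finset.univ fun j _ => (hb j).integrable_sq).add huV) (fun n => ?_)
    (Eventually.of_forall fun x => ?_) (fun n => (key n).2.2)
  · simp only [Pi.zero_apply]
    positivity
  · exact (tendsto_finsetSum _ fun j _ => (((hgt' j x).sub ((hgt x).mul_const _)).norm.pow 2)).add
      (((hgt x).norm.pow 2).const_mul m)
  · filter_upwards [hV] with x hx
    rw [Real.norm_of_nonneg (by positivity)]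
    refine add_le_add (Finset.sum_le_sum fun j _ => ?_) (mul_le_mul_of_nonneg_left ?_ hx)
    · exact pow_le_pow_left₀ (norm_nonneg _) (hgu' n j x) 2
    · exact pow_le_pow_left₀ (norm_nonneg _) (hgu n x) 2
  · exact (tendsto_finsetSum _ fun j _ => ((hgt' j x).norm.pow 2)).add
      (((hgt x).norm.pow 2).const_mul _)

/-- The same limit with the roles exchanged: Fatou is now applied to the Schrödinger side, whose
integrand is nonnegative by `hV`. -/
theorem energy_le_of_weighted (h : RegularWeight S μ w Dw Lw)
    (hγ : ∀ j, IsOneParam (S.X j) (γ j)) {m : ℝ} (hm : 0 ≤ m)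
    (hV : ∀ᵐ x ∂μ, 0 ≤ potential w Dw Lw x + m)
    {f : G → ℂ} {f' : Fin S.dim → G → ℂ} (hf : ∀ j, HasLineDeriv μ (γ j) f (f' j))
    (hfm : AEStronglyMeasurable f μ) (hfm' : ∀ j, AEStronglyMeasurable (f' j) μ)
    (hf2 : MemLp (fun x => f x * (√(w x) : ℂ)) 2 μ)
    (hf' : ∀ j, MemLp (fun x => f' j x * (√(w x) : ℂ)) 2 μ) :
    Integrable (fun x => ∑ j, ‖f' j x * (√(w x) : ℂ) + f x * ((Dw j x / (2 * √(w x)) : ℝ) : ℂ)‖ ^ 2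
      + (potential w Dw Lw x + m) * ‖f x * (√(w x) : ℂ)‖ ^ 2) μ ∧
    ∫ x, (∑ j, ‖f' j x * (√(w x) : ℂ) + f x * ((Dw j x / (2 * √(w x)) : ℝ) : ℂ)‖ ^ 2
      + (potential w Dw Lw x + m) * ‖f x * (√(w x) : ℂ)‖ ^ 2) ∂μ ≤
      ∫ x, (∑ j, ‖f' j x * (√(w x) : ℂ)‖ ^ 2 + m * ‖f x * (√(w x) : ℂ)‖ ^ 2) ∂μ := by
  obtain ⟨g, g', C, hC, hg, hgm, hgm', hgR, hgK, hgu, hgu', hgt, hgt'⟩ :=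
    exists_truncation hγ hf hfm hfm'
  have hwm : AEStronglyMeasurable (fun x => (√(w x) : ℂ)) μ :=
    (Complex.continuous_ofReal.comp Real.continuous_sqrt).comp_aestronglyMeasurable
      h.locInt.aestronglyMeasurable
  have hb : ∀ j, MemLp (fun x => 3 * ‖f' j x * (√(w x) : ℂ)‖ + C * ‖f x * (√(w x) : ℂ)‖) 2 μ :=
    fun j => ((hf' j).norm.const_mul 3).add (hf2.norm.const_mul C)
  have hgb : ∀ n j x, ‖g' n j x * (√(w x) : ℂ)‖ ≤
      3 * ‖f' j x * (√(w x) : ℂ)‖ + C * ‖f x * (√(w x) : ℂ)‖ := fun n j x => by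
    simp only [norm_mul]
    nlinarith [mul_le_mul_of_nonneg_right (hgu' n j x) (norm_nonneg (√(w x) : ℂ))]
  have hgL : ∀ n j, MemLp (fun x => g' n j x * (√(w x) : ℂ)) 2 μ := fun n j =>
    (hb j).mono' ((hgm' n j).mul hwm) (Eventually.of_forall (hgb n j))
  choose R hR using hgR
  choose K hK h0 using hgK
  have key := fun n => h.energy_eq_of_weighted hγ m (hg n) (hgm n) (hR n) (hgm' n) (hgL n) (hK n) (h0 n)
  refine integral_le_of_tendsto (fun n => (key n).1) (fun n => hV.mono fun x hx => ?_)
    (Eventually.of_forall fun x => ?_) (fun n => (key n).2.1.1)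
    ((integrable_finsetSum Finset.univ fun j _ => (hb j).integrable_sq).add
      (hf2.norm.integrable_sq.const_mul m)) (fun n => Eventually.of_forall fun x => ?_)
    (Eventually.of_forall fun x => ?_) (fun n => (key n).2.2)
  · simp only [Pi.zero_apply]
    positivity
  · exact (tendsto_finsetSum _ fun j _ =>
      ((((hgt' j x).mul_const _).add ((hgt x).mul_const _)).norm.pow 2)).add
      ((((hgt x).mul_const _).norm.pow 2).const_mul _)
  · rw [Real.norm_of_nonneg (by positivity)]
    refine add_le_add (Finset.sum_le_sum fun j _ => ?_) (mul_le_mul_of_nonneg_left ?_ hm)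
    · exact pow_le_pow_left₀ (norm_nonneg _) (hgb n j x) 2
    · refine pow_le_pow_left₀ (norm_nonneg _) ?_ 2
      rw [norm_mul, norm_mul]
      exact mul_le_mul_of_nonneg_right (hgu n x) (norm_nonneg _)
  · exact (tendsto_finsetSum _ fun j _ => (((hgt' j x).mul_const _).norm.pow 2)).add
      ((((hgt x).mul_const _).norm.pow 2).const_mul m)

end RegularWeight
end EnergyInequalities

/-! ### Polarization of sums of squared norms -/

section Polarization
open Set Filter Topology

variable {α : Type*} [MeasurableSpace α] {ν : Measure α}

theorem integrable_mul_conj {a b : α → ℂ} (ha : MemLp a 2 ν) (hb : MemLp b 2 ν) :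
    Integrable (fun x => a x * conj (b x)) ν :=
  ha.integrable_mul hb.star

theorem integral_norm_add_mul_sq {a b : α → ℂ} (ha : MemLp a 2 ν) (hb : MemLp b 2 ν) (c : ℂ) :
    ∫ x, ‖a x + c * b x‖ ^ 2 ∂ν = ∫ x, ‖a x‖ ^ 2 ∂ν + ‖c‖ ^ 2 * ∫ x, ‖b x‖ ^ 2 ∂ν +
      2 * (conj c * ∫ x, a x * conj (b x) ∂ν).re := by
  have hi := (integrable_mul_conj ha hb).const_mul (conj c)
  have e : ∀ x, ‖a x + c * b x‖ ^ 2 =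
      ‖a x‖ ^ 2 + ‖c‖ ^ 2 * ‖b x‖ ^ 2 + 2 * (conj c * (a x * conj (b x))).re := by
    intro x
    rw [Complex.sq_norm, Complex.normSq_add, ← Complex.sq_norm, ← Complex.sq_norm, norm_mul,
      mul_pow, map_mul]
    congr 3
    ring
  have h1 : Integrable (fun x => (conj c * (a x * conj (b x))).re) ν := hi.re
  have h2 : ∫ x, (conj c * (a x * conj (b x))).re ∂ν =
      (∫ x, conj c * (a x * conj (b x)) ∂ν).re := integral_re hi
  simp_rw [e]
  have i1 : Integrable (fun x => ‖c‖ ^ 2 * ‖b x‖ ^ 2) ν := hb.norm.integrable_sq.const_mul _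
  have i2 : Integrable (fun x => ‖a x‖ ^ 2 + ‖c‖ ^ 2 * ‖b x‖ ^ 2) ν := ha.norm.integrable_sq.add i1
  rw [integral_add i2 (h1.const_mul 2), integral_add ha.norm.integrable_sq i1,
    integral_const_mul, integral_const_mul, h2, integral_const_mul]

/-- Polarization for differences of squares of `L²` norms. -/
theorem sum_integral_mul_conj_eq {κ κ' : Type*} [Fintype κ] [Fintype κ'] {a b : κ → α → ℂ}
    {a' b' : κ' → α → ℂ} (ha : ∀ k, MemLp (a k) 2 ν) (hb : ∀ k, MemLp (b k) 2 ν)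
    (ha' : ∀ k, MemLp (a' k) 2 ν) (hb' : ∀ k, MemLp (b' k) 2 ν)
    (h : ∀ c : ℂ, ∑ k, ∫ x, ‖a k x + c * b k x‖ ^ 2 ∂ν = ∑ k, ∫ x, ‖a' k x + c * b' k x‖ ^ 2 ∂ν) :
    ∑ k, ∫ x, a k x * conj (b k x) ∂ν = ∑ k, ∫ x, a' k x * conj (b' k x) ∂ν := by
  have h' : ∀ c : ℂ, ∑ k, ∫ x, ‖a k x‖ ^ 2 ∂ν + ‖c‖ ^ 2 * ∑ k, ∫ x, ‖b k x‖ ^ 2 ∂ν +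
      2 * (conj c * ∑ k, ∫ x, a k x * conj (b k x) ∂ν).re =
      ∑ k, ∫ x, ‖a' k x‖ ^ 2 ∂ν + ‖c‖ ^ 2 * ∑ k, ∫ x, ‖b' k x‖ ^ 2 ∂ν +
      2 * (conj c * ∑ k, ∫ x, a' k x * conj (b' k x) ∂ν).re := by
    intro c
    have := h c
    simp_rw [fun k => integral_norm_add_mul_sq (ha k) (hb k) c,
      fun k => integral_norm_add_mul_sq (ha' k) (hb' k) c] at this
    simpa only [Finset.sum_add_distrib, ← Finset.mul_sum, ← Complex.re_sum] using this
  -- The values c = ±1 isolate the real part and c = ±i the imaginary part; the common quadratic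
  -- terms cancel in the differences.
  have h1 := h' 1
  have h2 := h' (-1)
  have h3 := h' Complex.I
  have h4 := h' (-Complex.I)
  simp at h1 h2 h3 h4
  refine Complex.ext ?_ ?_
  · simp only [Complex.re_sum]
    linarith
  · simp only [Complex.im_sum]
    linarith

end Polarization

/-! ### Weighted and unweighted L² spaces -/

section Transformation
open Set Filter Topology

set_option linter.unusedSectionVars false

variable {E : Type*} [NormedAddCommGroup E] [NormedSpace ℝ E] [FiniteDimensional ℝ E]
  {G : Type*} [TopologicalSpace G] [ChartedSpace E G] [Group G]
  [LieGroup 𝓘(ℝ, E) ∞ G] [IsTopologicalGroup G] [LocallyCompactSpace G]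
  [T2Space G] [SecondCountableTopology G] [MeasurableSpace G] [BorelSpace G]
  {μ : Measure G} {w : G → ℝ}

namespace IsWeight

theorem aemeasurable_density (hw : IsWeight μ w) :
    AEMeasurable (fun x => ENNReal.ofReal (w x)) μ :=
  hw.locInt.aestronglyMeasurable.aemeasurable.ennreal_ofReal

theorem weighted_absolutelyContinuous : weighted μ w ≪ μ := withDensity_absolutelyContinuous μ _

theorem aestronglyMeasurable_sqrt (hw : IsWeight μ w) :
    AEStronglyMeasurable (fun x => (√(w x) : ℂ)) μ :=
  (Complex.continuous_ofReal.comp Real.continuous_sqrt).comp_aestronglyMeasurable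
    hw.locInt.aestronglyMeasurable

theorem eLpNorm_weighted (hw : IsWeight μ w) (v : G → ℂ) :
    eLpNorm v 2 (weighted μ w) = eLpNorm (fun x => v x * (√(w x) : ℂ)) 2 μ := by
  rw [eLpNorm_eq_lintegral_rpow_enorm_toReal (by simp) (by simp),
    eLpNorm_eq_lintegral_rpow_enorm_toReal (by simp) (by simp), weighted,
    lintegral_withDensity_eq_lintegral_mul_non_measurable₀ _ hw.aemeasurable_density
      (Eventually.of_forall fun x => ENNReal.ofReal_lt_top)]
  congr 1
  refine lintegral_congr_ae ?_
  filter_upwards [hw.pos] with x hx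
  have e : ‖(√(w x) : ℂ)‖ₑ ^ (2 : ℝ) = ENNReal.ofReal (w x) := by
    rw [← ofReal_norm, Complex.norm_real, Real.norm_of_nonneg (Real.sqrt_nonneg _),
      ENNReal.ofReal_rpow_of_nonneg (Real.sqrt_nonneg _) (by norm_num)]
    congr 1
    rw [Real.rpow_two, Real.sq_sqrt hx.le]
  simp only [Pi.mul_apply, ENNReal.toReal_ofNat]
  rw [enorm_mul, ENNReal.mul_rpow_of_nonneg _ _ (by norm_num), e, mul_comm]

theorem memLp_mul_sqrt (hw : IsWeight μ w) {v : G → ℂ}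
    (hv : MemLp v 2 (weighted μ w)) : MemLp (fun x => v x * (√(w x) : ℂ)) 2 μ :=
  ⟨(hv.1.mono_ac hw.absolutelyContinuous).mul hw.aestronglyMeasurable_sqrt, by
    rw [← hw.eLpNorm_weighted]
    exact hv.2⟩

theorem memLp_weighted (hw : IsWeight μ w) {v : G → ℂ} (hvm : AEStronglyMeasurable v μ)
    (hv : MemLp (fun x => v x * (√(w x) : ℂ)) 2 μ) : MemLp v 2 (weighted μ w) :=
  ⟨hvm.mono_ac weighted_absolutelyContinuous, by
    rw [hw.eLpNorm_weighted]
    exact hv.2⟩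

theorem memLp_inv_sqrt (hw : IsWeight μ w) {K : Set G} (hK : IsCompact K) :
    MemLp (fun x => (√(w x))⁻¹) 2 (μ.restrict K) := by
  rw [memLp_two_iff_integrable_sq]
  · refine (hw.locInt_inv.integrableOn_isCompact hK).congr ?_
    filter_upwards [ae_restrict_of_ae hw.pos] with x hx
    rw [inv_pow, Real.sq_sqrt hx.le]
  · exact ((Real.continuous_sqrt.comp_aestronglyMeasurable
      hw.locInt.aestronglyMeasurable).aemeasurable.inv).aestronglyMeasurable.restrict

/-- v is the product of v√w and w^{-1/2}, both in L²_loc. Local integrability of w⁻¹ thus embeds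
L²(μ_w) into L¹_loc(μ), where distributional derivatives make sense. -/
theorem locallyIntegrable_of_memLp (hw : IsWeight μ w) {v : G → ℂ}
    (hv : MemLp (fun x => v x * (√(w x) : ℂ)) 2 μ) : LocallyIntegrable v μ := by
  refine locallyIntegrable_iff.2 fun K hK => ?_
  have h1 : MemLp (fun x => ((√(w x))⁻¹ : ℂ)) 2 (μ.restrict K) := by
    simpa using (hw.memLp_inv_sqrt hK).ofReal (K := ℂ)
  have h2 : Integrable ((fun x => v x * (√(w x) : ℂ)) * fun x => ((√(w x))⁻¹ : ℂ))
    (μ.restrict K) := (hv.restrict K).integrable_mul h1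
  refine h2.congr ?_
  filter_upwards [ae_restrict_of_ae hw.pos] with x hx
  have : (√(w x) : ℂ) ≠ 0 := Complex.ofReal_ne_zero.2 (Real.sqrt_pos.2 hx).ne'
  simp only [Pi.mul_apply]
  field_simp

end IsWeight
end Transformation

/-! ### Transfer of domains and forms between functions on the group -/

section Pairs
open Set Filter Topology

set_option linter.unusedSectionVars false

variable {E : Type*} [NormedAddCommGroup E] [NormedSpace ℝ E] [FiniteDimensional ℝ E]
  {G : Type*} [TopologicalSpace G] [ChartedSpace E G] [Group G]
  [LieGroup 𝓘(ℝ, E) ∞ G] [IsTopologicalGroup G] [LocallyCompactSpace G]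
  [T2Space G] [SecondCountableTopology G] [MeasurableSpace G] [BorelSpace G]
  {μ : Measure G} [μ.IsHaarMeasure] {S : SubRiemannian E G} {w Lw : G → ℝ}
  {Dw : Fin S.dim → G → ℝ} {γ : Fin S.dim → ℝ → G} {m : ℝ}

theorem MemL2Loc.locallyIntegrable {f : G → ℝ} (hf : MemL2Loc f μ) : LocallyIntegrable f μ :=
  locallyIntegrable_iff.2 fun K hK => by
    have : IsFiniteMeasure (μ.restrict K) := ⟨by simpa using hK.measure_lt_top⟩
    exact (hf K hK).integrable one_le_two

/-- `f` lies in the domain of the weighted form, and its derivatives along the curves `γ j`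
are `f' j`. -/
structure IsWeightedPair {n : ℕ} (μ : Measure G) (w : G → ℝ) (γ : Fin n → ℝ → G) (f : G → ℂ)
    (f' : Fin n → G → ℂ) : Prop where
  hasLineDeriv : ∀ j, HasLineDeriv μ (γ j) f (f' j)
  memLp : MemLp (fun x => f x * (√(w x) : ℂ)) 2 μ
  memLp_deriv : ∀ j, MemLp (fun x => f' j x * (√(w x) : ℂ)) 2 μ

/-- `u` lies in the domain of the form with potential `V`, and its derivatives along the
curves `γ j` are `u' j`. -/
structure IsSchrodingerPair {n : ℕ} (μ : Measure G) (V : G → ℝ) (m : ℝ) (γ : Fin n → ℝ → G)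
    (u : G → ℂ) (u' : Fin n → G → ℂ) : Prop where
  hasLineDeriv : ∀ j, HasLineDeriv μ (γ j) u (u' j)
  memLp : MemLp u 2 μ
  memLp_deriv : ∀ j, MemLp (u' j) 2 μ
  memLp_potential : MemLp (fun x => u x * (√(V x + m) : ℂ)) 2 μ

/-- The derivatives of `f √w`. -/
noncomputable def sqrtDeriv {n : ℕ} (w : G → ℝ) (Dw : Fin n → G → ℝ) (f : G → ℂ) (f' : Fin n → G → ℂ)
    (j : Fin n) (x : G) : ℂ :=
  f' j x * (√(w x) : ℂ) + f x * ((Dw j x / (2 * √(w x)) : ℝ) : ℂ)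

theorem IsWeightedPair.add_const_mul {n : ℕ} {γ : Fin n → ℝ → G} {f g : G → ℂ}
    {f' g' : Fin n → G → ℂ} (hf : IsWeightedPair μ w γ f f') (hg : IsWeightedPair μ w γ g g')
    (c : ℂ) :
    IsWeightedPair μ w γ (fun x => f x + c * g x) (fun j x => f' j x + c * g' j x) where
  hasLineDeriv j := (hf.hasLineDeriv j).add
    ((hg.hasLineDeriv j).clm_apply (ContinuousLinearMap.mul ℝ ℂ c))
  memLp := by
    simp_rw [add_mul, mul_assoc]
    exact hf.memLp.add (hg.memLp.const_mul c)
  memLp_deriv j := by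
    simp_rw [add_mul, mul_assoc]
    exact (hf.memLp_deriv j).add ((hg.memLp_deriv j).const_mul c)

theorem norm_mul_sqrt_sq {r : ℝ} (hr : 0 ≤ r) (z : ℂ) : ‖z * (√r : ℂ)‖ ^ 2 = r * ‖z‖ ^ 2 := by
  rw [norm_mul, Complex.norm_real, Real.norm_of_nonneg (Real.sqrt_nonneg _), mul_pow,
    Real.sq_sqrt hr, mul_comm]

namespace IsWeightedPair

theorem locallyIntegrable (hw : IsWeight μ w) {f : G → ℂ} {f' : Fin S.dim → G → ℂ}
    (hf : IsWeightedPair μ w γ f f') : LocallyIntegrable f μ :=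
  hw.locallyIntegrable_of_memLp hf.memLp

theorem locallyIntegrable_deriv (hw : IsWeight μ w) {f : G → ℂ} {f' : Fin S.dim → G → ℂ}
    (hf : IsWeightedPair μ w γ f f') (j : Fin S.dim) : LocallyIntegrable (f' j) μ :=
  hw.locallyIntegrable_of_memLp (hf.memLp_deriv j)

theorem isWeakDeriv (hw : IsWeight μ w) (hγ : ∀ j, IsOneParam (S.X j) (γ j)) {f : G → ℂ}
    {f' : Fin S.dim → G → ℂ} (hf : IsWeightedPair μ w γ f f') (j : Fin S.dim) :
    IsWeakDeriv μ (S.X j) f (f' j) :=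
  (hf.hasLineDeriv j).isWeakDeriv (hγ j) (hf.locallyIntegrable hw)
    (hf.locallyIntegrable_deriv hw j)

end IsWeightedPair

theorem IsSchrodingerPair.isWeakDeriv {V : G → ℝ} (hγ : ∀ j, IsOneParam (S.X j) (γ j)) {u : G → ℂ}
    {u' : Fin S.dim → G → ℂ} (hu : IsSchrodingerPair μ V m γ u u') (j : Fin S.dim) :
    IsWeakDeriv μ (S.X j) u (u' j) :=
  (hu.hasLineDeriv j).isWeakDeriv (hγ j) (hu.memLp.locallyIntegrable one_le_two)
    ((hu.memLp_deriv j).locallyIntegrable one_le_two)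

namespace RegularWeight

theorem locallyIntegrable_deriv_sqrt (h : RegularWeight S μ w Dw Lw) (j : Fin S.dim) :
    LocallyIntegrable (fun x => Dw j x / (2 * √(w x))) μ := by
  refine ((h.deriv_sqrt j).locallyIntegrable.smul (2⁻¹ : ℝ)).congr (Eventually.of_forall fun x => ?_)
  simp only [Pi.smul_apply, smul_eq_mul]
  ring

/-- Product of X_j w / w and w^{-1/2}, both in L²_loc. It supplies the domination in the chain rule
for 1/√w. -/
theorem locallyIntegrable_deriv_inv_sqrt (h : RegularWeight S μ w Dw Lw) (j : Fin S.dim) :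
    LocallyIntegrable (fun x => Dw j x / (2 * w x * √(w x))) μ := by
  refine locallyIntegrable_iff.2 fun K hK => ?_
  have h1 : Integrable ((fun x => Dw j x / w x) * fun x => (√(w x))⁻¹) (μ.restrict K) :=
    (h.deriv_div j K hK).integrable_mul (h.memLp_inv_sqrt hK)
  refine (h1.const_mul 2⁻¹).congr (Eventually.of_forall fun x => ?_)
  simp only [Pi.mul_apply]
  ring

variable {f : G → ℂ} {f' : Fin S.dim → G → ℂ}

theorem aestronglyMeasurable_sqrtDeriv (h : RegularWeight S μ w Dw Lw)
    (hf : IsWeightedPair μ w γ f f') (j : Fin S.dim) :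
    AEStronglyMeasurable (sqrtDeriv w Dw f f' j) μ :=
  (hf.memLp_deriv j).1.add ((hf.locallyIntegrable h.toIsWeight).aestronglyMeasurable.mul
    (Complex.continuous_ofReal.comp_aestronglyMeasurable
      (h.locallyIntegrable_deriv_sqrt j).aestronglyMeasurable))

/-- Multiplication by `√w` maps the domain of the weighted form into the domain of the form
with potential. -/
theorem isSchrodingerPair (h : RegularWeight S μ w Dw Lw)
    (hγ : ∀ j, IsOneParam (S.X j) (γ j)) (hm : 0 ≤ m)
    (hV : ∀ᵐ x ∂μ, 0 ≤ potential w Dw Lw x + m) (hf : IsWeightedPair μ w γ f f') :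
    IsSchrodingerPair μ (potential w Dw Lw) m γ (fun x => f x * (√(w x) : ℂ))
      (sqrtDeriv w Dw f f') := by
  -- Every summand of this integrable energy is nonnegative, so each is integrable on its own; that
  -- is membership in the target domain.
  have hi := (h.energy_le_of_weighted hγ hm hV hf.hasLineDeriv
    (hf.locallyIntegrable h.toIsWeight).aestronglyMeasurable
    (fun j => (hf.locallyIntegrable_deriv h.toIsWeight j).aestronglyMeasurable)
    hf.memLp hf.memLp_deriv).1
  have hVm : AEStronglyMeasurable (fun x => (√(potential w Dw Lw x + m) : ℂ)) μ :=
    (Complex.continuous_ofReal.comp Real.continuous_sqrt).comp_aestronglyMeasurable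
      (h.aestronglyMeasurable_potential.add aestronglyMeasurable_const)
  refine ⟨fun j => (hf.hasLineDeriv j).mul_ofReal (((h.weakDeriv j).hasLineDeriv (hγ j)).sqrt (hγ j)
    h.pos (h.locallyIntegrable_deriv_sqrt j)), hf.memLp, fun j => ?_, ?_⟩
  · have hjm := h.aestronglyMeasurable_sqrtDeriv hf j
    rw [← memLp_norm_iff hjm, memLp_two_iff_integrable_sq hjm.norm]
    refine hi.mono' (hjm.norm.pow 2) ?_
    filter_upwards [hV] with x hx
    rw [norm_pow, norm_norm]
    have h1 : ‖sqrtDeriv w Dw f f' j x‖ ^ 2 ≤ ∑ j, ‖sqrtDeriv w Dw f f' j x‖ ^ 2 :=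
      Finset.single_le_sum (f := fun j => ‖sqrtDeriv w Dw f f' j x‖ ^ 2)
        (fun i _ => sq_nonneg _) (Finset.mem_univ j)
    exact h1.trans (le_add_of_nonneg_right (mul_nonneg hx (sq_nonneg _)))
  · have hum := hf.memLp.1.mul hVm
    refine (memLp_norm_iff hum).1 ((memLp_two_iff_integrable_sq hum.norm).2 ?_)
    refine hi.mono' (hum.norm.pow 2) ?_
    filter_upwards [hV] with x hx
    simp only [Pi.mul_apply]
    rw [norm_pow, norm_norm, norm_mul_sqrt_sq hx]
    exact le_add_of_nonneg_left (Finset.sum_nonneg fun j _ => sq_nonneg _)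

/-- Division by `√w` maps the domain of the form with potential into the domain of the
weighted form. -/
theorem exists_isWeightedPair (h : RegularWeight S μ w Dw Lw)
    (hγ : ∀ j, IsOneParam (S.X j) (γ j)) (hm : 0 ≤ m)
    (hV : ∀ᵐ x ∂μ, 0 ≤ potential w Dw Lw x + m) {u : G → ℂ} {u' : Fin S.dim → G → ℂ}
    (hu : IsSchrodingerPair μ (potential w Dw Lw) m γ u u') :
    ∃ f f', IsWeightedPair μ w γ f f' ∧ u =ᵐ[μ] fun x => f x * (√(w x) : ℂ) := by
  have huV : Integrable (fun x => (potential w Dw Lw x + m) * ‖u x‖ ^ 2) μ := by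
    refine ((memLp_two_iff_integrable_sq hu.memLp_potential.1.norm).1
      hu.memLp_potential.norm).congr ?_
    filter_upwards [hV] with x hx using norm_mul_sqrt_sq hx _
  have hi := (h.energy_le_of_schrodinger hγ hm hV hu.hasLineDeriv hu.memLp hu.memLp_deriv huV).1
  have e : u =ᵐ[μ] fun x => u x * (((√(w x))⁻¹ : ℝ) : ℂ) * (√(w x) : ℂ) := by
    filter_upwards [h.pos] with x hx
    have : (√(w x) : ℂ) ≠ 0 := Complex.ofReal_ne_zero.2 (Real.sqrt_pos.2 hx).ne'
    rw [Complex.ofReal_inv, mul_assoc, inv_mul_cancel₀ this, mul_one]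
  refine ⟨_, _, ⟨fun j => (hu.hasLineDeriv j).mul_ofReal (((h.weakDeriv j).hasLineDeriv
    (hγ j)).inv_sqrt (hγ j) h.pos (h.locallyIntegrable_deriv_inv_sqrt j)), ?_, fun j => ?_⟩, e⟩
  · exact hu.memLp.ae_eq e
  · have hjm : AEStronglyMeasurable
        (fun x => u' j x - u x * ((Dw j x / (2 * w x) : ℝ) : ℂ)) μ :=
      (hu.memLp_deriv j).1.sub (hu.memLp.1.mul (Complex.continuous_ofReal.comp_aestronglyMeasurable
        ((h.weakDeriv j).locInt_deriv.aestronglyMeasurable.aemeasurable.div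
          (h.locInt.aestronglyMeasurable.aemeasurable.const_mul 2)).aestronglyMeasurable))
    have hj : MemLp (fun x => u' j x - u x * ((Dw j x / (2 * w x) : ℝ) : ℂ)) 2 μ := by
      rw [← memLp_norm_iff hjm, memLp_two_iff_integrable_sq hjm.norm]
      refine hi.mono' (hjm.norm.pow 2) (Eventually.of_forall fun x => ?_)
      rw [norm_pow, norm_norm]
      have h1 : ‖u' j x - u x * ((Dw j x / (2 * w x) : ℝ) : ℂ)‖ ^ 2 ≤
          ∑ j, ‖u' j x - u x * ((Dw j x / (2 * w x) : ℝ) : ℂ)‖ ^ 2 :=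
        Finset.single_le_sum (f := fun j => ‖u' j x - u x * ((Dw j x / (2 * w x) : ℝ) : ℂ)‖ ^ 2)
          (fun i _ => sq_nonneg _) (Finset.mem_univ j)
      exact h1.trans (le_add_of_nonneg_right (mul_nonneg hm (sq_nonneg _)))
    refine hj.ae_eq ?_
    filter_upwards [h.pos] with x hx
    have h1 : (√(w x) : ℂ) ≠ 0 := Complex.ofReal_ne_zero.2 (Real.sqrt_pos.2 hx).ne'
    have h2 : (w x : ℂ) ≠ 0 := Complex.ofReal_ne_zero.2 hx.ne'
    push_cast
    field_simp
    ring

/-- The weighted inequality for f and the Schrödinger inequality for u = f√w are opposite: the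
latter's left side is again the energy of f, since X_j u − u X_j w/(2w) = √w f'_j. -/
theorem integral_energy_eq (h : RegularWeight S μ w Dw Lw)
    (hγ : ∀ j, IsOneParam (S.X j) (γ j)) (hm : 0 ≤ m)
    (hV : ∀ᵐ x ∂μ, 0 ≤ potential w Dw Lw x + m) (hf : IsWeightedPair μ w γ f f') :
    ∑ j, ∫ x, ‖sqrtDeriv w Dw f f' j x‖ ^ 2 ∂μ +
        ∫ x, ‖f x * (√(w x) : ℂ) * (√(potential w Dw Lw x + m) : ℂ)‖ ^ 2 ∂μ =
      ∑ j, ∫ x, ‖f' j x * (√(w x) : ℂ)‖ ^ 2 ∂μ + m * ∫ x, ‖f x * (√(w x) : ℂ)‖ ^ 2 ∂μ := by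
  have hu := h.isSchrodingerPair hγ hm hV hf
  have eV : (fun x => ‖f x * (√(w x) : ℂ) * (√(potential w Dw Lw x + m) : ℂ)‖ ^ 2) =ᵐ[μ]
      fun x => (potential w Dw Lw x + m) * ‖f x * (√(w x) : ℂ)‖ ^ 2 := by
    filter_upwards [hV] with x hx using norm_mul_sqrt_sq hx _
  have huV : Integrable (fun x => (potential w Dw Lw x + m) * ‖f x * (√(w x) : ℂ)‖ ^ 2) μ :=
    ((memLp_two_iff_integrable_sq hu.memLp_potential.1.norm).1 hu.memLp_potential.norm).congr eV
  have i1 := (h.energy_le_of_weighted hγ hm hV hf.hasLineDeriv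
    (hf.locallyIntegrable h.toIsWeight).aestronglyMeasurable
    (fun j => (hf.locallyIntegrable_deriv h.toIsWeight j).aestronglyMeasurable)
    hf.memLp hf.memLp_deriv).2
  have i2 := (h.energy_le_of_schrodinger hγ hm hV hu.hasLineDeriv hu.memLp hu.memLp_deriv huV).2
  have e3 : ∫ x, (∑ j, ‖sqrtDeriv w Dw f f' j x - f x * (√(w x) : ℂ) *
      ((Dw j x / (2 * w x) : ℝ) : ℂ)‖ ^ 2 + m * ‖f x * (√(w x) : ℂ)‖ ^ 2) ∂μ =
      ∫ x, (∑ j, ‖f' j x * (√(w x) : ℂ)‖ ^ 2 + m * ‖f x * (√(w x) : ℂ)‖ ^ 2) ∂μ := by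
    refine integral_congr_ae ?_
    filter_upwards [h.pos] with x hx
    congr 1
    refine Finset.sum_congr rfl fun j _ => ?_
    congr 2
    have h1 : √(w x) ≠ 0 := (Real.sqrt_pos.2 hx).ne'
    have h2 : Dw j x / (2 * √(w x)) = √(w x) * (Dw j x / (2 * w x)) := by
      nth_rw 3 [← Real.mul_self_sqrt hx.le]
      field_simp
    rw [sqrtDeriv, h2, Complex.ofReal_mul]
    ring
  rw [e3] at i2
  have i3 := le_antisymm i1 i2
  have s1 : Integrable (fun x => ∑ j, ‖sqrtDeriv w Dw f f' j x‖ ^ 2) μ :=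
    integrable_finsetSum _ fun j _ => (hu.memLp_deriv j).norm.integrable_sq
  have s2 : Integrable (fun x => ∑ j, ‖f' j x * (√(w x) : ℂ)‖ ^ 2) μ :=
    integrable_finsetSum _ fun j _ => (hf.memLp_deriv j).norm.integrable_sq
  have i4 : ∫ x, (∑ j, ‖sqrtDeriv w Dw f f' j x‖ ^ 2 +
      (potential w Dw Lw x + m) * ‖f x * (√(w x) : ℂ)‖ ^ 2) ∂μ =
      ∫ x, (∑ j, ‖f' j x * (√(w x) : ℂ)‖ ^ 2 + m * ‖f x * (√(w x) : ℂ)‖ ^ 2) ∂μ := i3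
  rw [integral_add s1 huV, integral_add s2 (hf.memLp.norm.integrable_sq.const_mul m),
    integral_finsetSum _ fun j _ => (hu.memLp_deriv j).norm.integrable_sq,
    integral_finsetSum _ fun j _ => (hf.memLp_deriv j).norm.integrable_sq,
    integral_const_mul] at i4
  rw [integral_congr_ae eV]
  exact i4

theorem integral_mul_conj_eq (h : RegularWeight S μ w Dw Lw)
    (hγ : ∀ j, IsOneParam (S.X j) (γ j)) (hm : 0 ≤ m)
    (hV : ∀ᵐ x ∂μ, 0 ≤ potential w Dw Lw x + m) {g : G → ℂ} {g' : Fin S.dim → G → ℂ}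
    (hf : IsWeightedPair μ w γ f f') (hg : IsWeightedPair μ w γ g g') :
    ∑ j, ∫ x, sqrtDeriv w Dw f f' j x * conj (sqrtDeriv w Dw g g' j x) ∂μ +
        ∫ x, f x * (√(w x) : ℂ) * (√(potential w Dw Lw x + m) : ℂ) *
          conj (g x * (√(w x) : ℂ) * (√(potential w Dw Lw x + m) : ℂ)) ∂μ =
      ∑ j, ∫ x, f' j x * (√(w x) : ℂ) * conj (g' j x * (√(w x) : ℂ)) ∂μ +
        m * ∫ x, f x * (√(w x) : ℂ) * conj (g x * (√(w x) : ℂ)) ∂μ := by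
  have hu := h.isSchrodingerPair hγ hm hV hf
  have hz := h.isSchrodingerPair hγ hm hV hg
  -- The zeroth-order terms join the gradient components as one further component, u√(V + m) on one
  -- side and √m f√w on the other, so that both energies are plain sums of squared L² norms.
  have key := sum_integral_mul_conj_eq (ν := μ)
    (a := Sum.elim (sqrtDeriv w Dw f f') fun _ : Unit => fun x =>
      f x * (√(w x) : ℂ) * (√(potential w Dw Lw x + m) : ℂ))
    (b := Sum.elim (sqrtDeriv w Dw g g') fun _ : Unit => fun x =>
      g x * (√(w x) : ℂ) * (√(potential w Dw Lw x + m) : ℂ))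
    (a' := Sum.elim (fun j x => f' j x * (√(w x) : ℂ)) fun _ : Unit => fun x =>
      (√m : ℂ) * (f x * (√(w x) : ℂ)))
    (b' := Sum.elim (fun j x => g' j x * (√(w x) : ℂ)) fun _ : Unit => fun x =>
      (√m : ℂ) * (g x * (√(w x) : ℂ)))
    (by rintro (j | j); exacts [hu.memLp_deriv j, hu.memLp_potential])
    (by rintro (j | j); exacts [hz.memLp_deriv j, hz.memLp_potential])
    (by rintro (j | j); exacts [hf.memLp_deriv j, hf.memLp.const_mul _])
    (by rintro (j | j); exacts [hg.memLp_deriv j, hg.memLp.const_mul _]) ?_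
  · simp only [Fintype.sum_sum_type, Sum.elim_inl, Sum.elim_inr, Finset.univ_unique,
      Finset.sum_singleton] at key
    rw [key, ← integral_const_mul]
    congr 2
    funext x
    have : (√m : ℂ) * (√m : ℂ) = m := by rw [← Complex.ofReal_mul, Real.mul_self_sqrt hm]
    rw [map_mul, Complex.conj_ofReal, ← this]
    ring
  · intro c
    have hc := h.integral_energy_eq hγ hm hV (hf.add_const_mul hg c)
    simp only [Fintype.sum_sum_type, Sum.elim_inl, Sum.elim_inr, Finset.univ_unique,
      Finset.sum_singleton]
    rw [← integral_const_mul] at hc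
    refine (congr_arg₂ (· + ·) (Finset.sum_congr rfl fun j _ => ?_) ?_).trans (hc.trans
      (congr_arg₂ (· + ·) (Finset.sum_congr rfl fun j _ => ?_) ?_))
    · congr with x
      simp only [sqrtDeriv]
      ring_nf
    · congr with x
      ring_nf
    · congr with x
      ring_nf
    · congr with x
      have e : (√m : ℂ) * (f x * (√(w x) : ℂ)) + c * ((√m : ℂ) * (g x * (√(w x) : ℂ))) =
          (f x + c * g x) * (√(w x) : ℂ) * (√m : ℂ) := by ring
      rw [e, norm_mul_sqrt_sq hm]

end RegularWeight
end Pairs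

/-! ### Multiplication by √w as an operator between the form domains -/

section UnitaryEquivalence
open Set Filter Topology

set_option linter.unusedSectionVars false

variable {E : Type*} [NormedAddCommGroup E] [NormedSpace ℝ E] [FiniteDimensional ℝ E]
  {G : Type*} [TopologicalSpace G] [ChartedSpace E G] [Group G]
  [LieGroup 𝓘(ℝ, E) ∞ G] [IsTopologicalGroup G] [LocallyCompactSpace G]
  [T2Space G] [SecondCountableTopology G] [MeasurableSpace G] [BorelSpace G]
  {μ : Measure G} {S : SubRiemannian E G} {w Lw : G → ℝ}
  {Dw : Fin S.dim → G → ℝ} {γ : Fin S.dim → ℝ → G} {m : ℝ}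

/-- Multiplication by `√w`, as a linear map from `L²(μ_w)` to `L²(μ)`. -/
noncomputable def mulSqrt (hw : IsWeight μ w) : Lp ℂ 2 (weighted μ w) →ₗ[ℂ] Lp ℂ 2 μ where
  toFun f := (hw.memLp_mul_sqrt (Lp.memLp f)).toLp _
  map_add' f g := by
    rw [← MemLp.toLp_add, MemLp.toLp_eq_toLp_iff]
    filter_upwards [hw.absolutelyContinuous.ae_eq (Lp.coeFn_add f g)] with x hx
    rw [hx, Pi.add_apply, Pi.add_apply, add_mul]
  map_smul' c f := by
    rw [RingHom.id_apply, ← MemLp.toLp_const_smul, MemLp.toLp_eq_toLp_iff]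
    filter_upwards [hw.absolutelyContinuous.ae_eq (Lp.coeFn_smul c f)] with x hx
    rw [hx, Pi.smul_apply, Pi.smul_apply, smul_mul_assoc]

theorem coeFn_mulSqrt (hw : IsWeight μ w) (f : Lp ℂ 2 (weighted μ w)) :
    mulSqrt hw f =ᵐ[μ] fun x => f x * (√(w x) : ℂ) :=
  MemLp.coeFn_toLp (hw.memLp_mul_sqrt (Lp.memLp f))

theorem norm_mulSqrt (hw : IsWeight μ w) (f : Lp ℂ 2 (weighted μ w)) : ‖mulSqrt hw f‖ = ‖f‖ := by
  change ‖(hw.memLp_mul_sqrt (Lp.memLp f)).toLp _‖ = _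
  rw [Lp.norm_toLp, Lp.norm_def, hw.eLpNorm_weighted]

theorem integral_weighted (hw : IsWeight μ w) (p q : G → ℂ) :
    ∫ x, p x * conj (q x) ∂(weighted μ w) =
      ∫ x, p x * (√(w x) : ℂ) * conj (q x * (√(w x) : ℂ)) ∂μ := by
  rw [weighted, integral_withDensity_eq_integral_toReal_smul₀ hw.aemeasurable_density
    (Eventually.of_forall fun x => ENNReal.ofReal_lt_top)]
  refine integral_congr_ae ?_
  filter_upwards [hw.pos] with x hx
  have e : (√(w x) : ℂ) * (√(w x) : ℂ) = w x := by
    rw [← Complex.ofReal_mul, Real.mul_self_sqrt hx.le]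
  rw [ENNReal.toReal_ofReal hx.le, Complex.real_smul, map_mul, Complex.conj_ofReal, ← e]
  ring

variable [μ.IsHaarMeasure]

theorem exists_isWeightedPair_of_mem (hw : IsWeight μ w) (hγ : ∀ j, IsOneParam (S.X j) (γ j))
    {f : Lp ℂ 2 (weighted μ w)} (hf : f ∈ weightedDom S hw) : ∃ f', IsWeightedPair μ w γ f f' := by
  choose v hv hv2 using hf
  exact ⟨v, fun j => (hv j).hasLineDeriv (hγ j), hw.memLp_mul_sqrt (Lp.memLp f),
    fun j => hw.memLp_mul_sqrt (hv2 j)⟩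

theorem exists_isSchrodingerPair_of_mem {V : G → ℝ} (hγ : ∀ j, IsOneParam (S.X j) (γ j))
    {u : Lp ℂ 2 μ} (hu : u ∈ schrodingerDom S μ V m) : ∃ u', IsSchrodingerPair μ V m γ u u' := by
  obtain ⟨h1, h2⟩ := hu
  choose v hv hv2 using h1
  exact ⟨v, fun j => (hv j).hasLineDeriv (hγ j), Lp.memLp u, hv2, h2⟩

theorem weightedForm_eq (hw : IsWeight μ w) (hγ : ∀ j, IsOneParam (S.X j) (γ j))
    {f g : G → ℂ} {f' g' : Fin S.dim → G → ℂ} (hf : IsWeightedPair μ w γ f f')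
    (hg : IsWeightedPair μ w γ g g') :
    weightedForm S μ w f g =
      ∑ j, ∫ x, f' j x * (√(w x) : ℂ) * conj (g' j x * (√(w x) : ℂ)) ∂μ := by
  have hfw := fun j => hf.isWeakDeriv hw hγ j
  have hgw := fun j => hg.isWeakDeriv hw hγ j
  have e : (fun x => ∑ j, weakDeriv μ (S.X j) f x * conj (weakDeriv μ (S.X j) g x))
      =ᵐ[weighted μ w] fun x => ∑ j, f' j x * conj (g' j x) := by
    refine IsWeight.weighted_absolutelyContinuous.ae_eq ?_
    filter_upwards [ae_all_iff.2 fun j => (hfw j).weakDeriv.ae_eq (hfw j),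
      ae_all_iff.2 fun j => (hgw j).weakDeriv.ae_eq (hgw j)] with x h1 h2
    exact Finset.sum_congr rfl fun j _ => by rw [h1 j, h2 j]
  rw [weightedForm, integral_congr_ae e, integral_finsetSum _ fun j _ => integrable_mul_conj
    (hw.memLp_weighted (hf.locallyIntegrable_deriv hw j).aestronglyMeasurable (hf.memLp_deriv j))
    (hw.memLp_weighted (hg.locallyIntegrable_deriv hw j).aestronglyMeasurable (hg.memLp_deriv j))]
  exact Finset.sum_congr rfl fun j _ => integral_weighted hw _ _

/-- Writing V = (√(V + m))² − m expresses the form through products of L² functions, so the integral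
can be split into its components. -/
theorem schrodingerForm_add_eq {V : G → ℝ} (hV : ∀ᵐ x ∂μ, 0 ≤ V x + m)
    (hγ : ∀ j, IsOneParam (S.X j) (γ j)) {u z U Z : G → ℂ} {u' z' : Fin S.dim → G → ℂ}
    (hu : IsSchrodingerPair μ V m γ u u') (hz : IsSchrodingerPair μ V m γ z z')
    (hU : U =ᵐ[μ] u) (hZ : Z =ᵐ[μ] z) :
    schrodingerForm S μ V U Z + m * ∫ x, u x * conj (z x) ∂μ =
      ∑ j, ∫ x, u' j x * conj (z' j x) ∂μ +
        ∫ x, u x * (√(V x + m) : ℂ) * conj (z x * (√(V x + m) : ℂ)) ∂μ := by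
  have hUw := fun j => (hu.isWeakDeriv hγ j).congr hU.symm
  have hZw := fun j => (hz.isWeakDeriv hγ j).congr hZ.symm
  have i0 := integrable_mul_conj hu.memLp hz.memLp
  have i1 := integrable_mul_conj hu.memLp_potential hz.memLp_potential
  have i2 : ∀ j, Integrable (fun x => u' j x * conj (z' j x)) μ := fun j =>
    integrable_mul_conj (hu.memLp_deriv j) (hz.memLp_deriv j)
  have i3 : Integrable (fun x => ∑ j, u' j x * conj (z' j x)) μ :=
    integrable_finsetSum _ fun j _ => i2 j
  have i4 : Integrable (fun x => ∑ j, u' j x * conj (z' j x) +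
      u x * (√(V x + m) : ℂ) * conj (z x * (√(V x + m) : ℂ))) μ := i3.add i1
  have e : (fun x => ∑ j, weakDeriv μ (S.X j) U x * conj (weakDeriv μ (S.X j) Z x) +
      V x * U x * conj (Z x)) =ᵐ[μ] fun x => ∑ j, u' j x * conj (z' j x) +
        u x * (√(V x + m) : ℂ) * conj (z x * (√(V x + m) : ℂ)) - m * (u x * conj (z x)) := by
    filter_upwards [ae_all_iff.2 fun j => (hUw j).weakDeriv.ae_eq (hUw j),
      ae_all_iff.2 fun j => (hZw j).weakDeriv.ae_eq (hZw j), hU, hZ, hV] with x h1 h2 h3 h4 h5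
    have e1 : (√(V x + m) : ℂ) * (√(V x + m) : ℂ) = V x + m := by
      rw [← Complex.ofReal_mul, Real.mul_self_sqrt h5, Complex.ofReal_add]
    have e2 : u x * (√(V x + m) : ℂ) * conj (z x * (√(V x + m) : ℂ)) =
        (V x + m) * (u x * conj (z x)) := by
      rw [map_mul, Complex.conj_ofReal, ← e1]
      ring
    simp only [h1, h2, h3, h4, e2]
    ring
  rw [schrodingerForm, integral_congr_ae e, integral_sub i4 (i0.const_mul _), integral_const_mul,
    integral_add i3 i1, integral_finsetSum _ fun j _ => i2 j, sub_add_cancel]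

namespace RegularWeight

theorem mulSqrt_mem (h : RegularWeight S μ w Dw Lw) (hγ : ∀ j, IsOneParam (S.X j) (γ j))
    (hm : 0 ≤ m) (hV : ∀ᵐ x ∂μ, 0 ≤ potential w Dw Lw x + m) (f : Lp ℂ 2 (weighted μ w))
    (hf : f ∈ weightedDom S h.toIsWeight) :
    mulSqrt h.toIsWeight f ∈ schrodingerDom S μ (potential w Dw Lw) m := by
  obtain ⟨f', hf'⟩ := exists_isWeightedPair_of_mem h.toIsWeight hγ hf
  have hu := h.isSchrodingerPair hγ hm hV hf'
  have e := (coeFn_mulSqrt h.toIsWeight f).symm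
  refine ⟨fun j => ⟨_, (hu.isWeakDeriv hγ j).congr e, hu.memLp_deriv j⟩, hu.memLp_potential.ae_eq ?_⟩
  filter_upwards [e] with x hx
  rw [hx]

theorem exists_mulSqrt_eq (h : RegularWeight S μ w Dw Lw) (hγ : ∀ j, IsOneParam (S.X j) (γ j))
    (hm : 0 ≤ m) (hV : ∀ᵐ x ∂μ, 0 ≤ potential w Dw Lw x + m) (u : Lp ℂ 2 μ)
    (hu : u ∈ schrodingerDom S μ (potential w Dw Lw) m) :
    ∃ f ∈ weightedDom S h.toIsWeight, mulSqrt h.toIsWeight f = u := by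
  have hw := h.toIsWeight
  obtain ⟨u', hu'⟩ := exists_isSchrodingerPair_of_mem hγ hu
  obtain ⟨f, f', hf, e⟩ := h.exists_isWeightedPair hγ hm hV hu'
  have hf2 := hw.memLp_weighted (hf.locallyIntegrable hw).aestronglyMeasurable hf.memLp
  have ef : hf2.toLp f =ᵐ[μ] f := hw.absolutelyContinuous.ae_eq hf2.coeFn_toLp
  refine ⟨hf2.toLp f, fun j => ⟨f' j, (hf.isWeakDeriv hw hγ j).congr ef.symm, hw.memLp_weighted
    (hf.locallyIntegrable_deriv hw j).aestronglyMeasurable (hf.memLp_deriv j)⟩, Lp.ext ?_⟩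
  filter_upwards [coeFn_mulSqrt hw (hf2.toLp f), ef, e] with x h1 h2 h3
  rw [h1, h2, h3]

theorem schrodingerForm_mulSqrt (h : RegularWeight S μ w Dw Lw)
    (hγ : ∀ j, IsOneParam (S.X j) (γ j)) (hm : 0 ≤ m)
    (hV : ∀ᵐ x ∂μ, 0 ≤ potential w Dw Lw x + m) {f g : Lp ℂ 2 (weighted μ w)}
    (hf : f ∈ weightedDom S h.toIsWeight) (hg : g ∈ weightedDom S h.toIsWeight) :
    schrodingerForm S μ (potential w Dw Lw) (mulSqrt h.toIsWeight f) (mulSqrt h.toIsWeight g) =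
      weightedForm S μ w f g := by
  obtain ⟨f', hf'⟩ := exists_isWeightedPair_of_mem h.toIsWeight hγ hf
  obtain ⟨g', hg'⟩ := exists_isWeightedPair_of_mem h.toIsWeight hγ hg
  have e1 := schrodingerForm_add_eq hV hγ (h.isSchrodingerPair hγ hm hV hf')
    (h.isSchrodingerPair hγ hm hV hg') (coeFn_mulSqrt h.toIsWeight f)
    (coeFn_mulSqrt h.toIsWeight g)
  rw [h.integral_mul_conj_eq hγ hm hV hf' hg', ← weightedForm_eq h.toIsWeight hγ hf' hg'] at e1
  exact add_right_cancel e1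

end RegularWeight
end UnitaryEquivalence

end SubLap

theorem mainTheorem12
    {E : Type*} [NormedAddCommGroup E] [NormedSpace ℝ E] [FiniteDimensional ℝ E]
    {G : Type*} [TopologicalSpace G] [ChartedSpace E G] [Group G] [LieGroup 𝓘(ℝ, E) ∞ G]
    [IsTopologicalGroup G] [LocallyCompactSpace G] [T2Space G] [SecondCountableTopology G]
    [ConnectedSpace G] [NoncompactSpace G] [MeasurableSpace G] [BorelSpace G]
    (μ : Measure G) [μ.IsHaarMeasure]
    (S : SubLap.SubRiemannian E G)
    (w : G → ℝ) (hw : SubLap.IsWeight μ w)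
    (Dw : Fin S.dim → G → ℝ) (hDw : ∀ j, SubLap.IsWeakDeriv μ (S.X j) w (Dw j))
    (hDw_sqrt : ∀ j, SubLap.MemL2Loc (fun x => Dw j x / √(w x)) μ)
    (hDw_div : ∀ j, SubLap.MemL2Loc (fun x => Dw j x / w x) μ)
    (Lw : G → ℝ) (hLw : SubLap.IsWeakSubLaplacian S μ w Lw)
    (hLw_div : LocallyIntegrable (fun x => Lw x / w x) μ)
    (m : ℝ) (hm : 0 < m)
    (hV : ∀ᵐ x ∂μ, -m + 1 ≤ SubLap.potential w Dw Lw x) :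
    ∃ I : SubLap.weightedDom S hw ≃ₗ[ℂ]
        SubLap.schrodingerDom S μ (SubLap.potential w Dw Lw) m,
      (∀ f : SubLap.weightedDom S hw,
        ((I f : Lp ℂ 2 μ) : G → ℂ) =ᵐ[μ]
          fun x => (f : Lp ℂ 2 (SubLap.weighted μ w)) x * (√(w x) : ℂ)) ∧
      (∀ f : SubLap.weightedDom S hw,
        √(m * ‖(I f : Lp ℂ 2 μ)‖ ^ 2
            + (SubLap.schrodingerForm S μ (SubLap.potential w Dw Lw)
                (I f : Lp ℂ 2 μ) (I f : Lp ℂ 2 μ)).re)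
          = √(m * ‖(f : Lp ℂ 2 (SubLap.weighted μ w))‖ ^ 2
            + (SubLap.weightedForm S μ w
                (f : Lp ℂ 2 (SubLap.weighted μ w)) (f : Lp ℂ 2 (SubLap.weighted μ w))).re)) ∧
      (∀ f g : SubLap.weightedDom S hw,
        SubLap.schrodingerForm S μ (SubLap.potential w Dw Lw)
            (I f : Lp ℂ 2 μ) (I g : Lp ℂ 2 μ)
          = SubLap.weightedForm S μ w
            (f : Lp ℂ 2 (SubLap.weighted μ w)) (g : Lp ℂ 2 (SubLap.weighted μ w))) := by
  have h : SubLap.RegularWeight S μ w Dw Lw := ⟨hw, hDw, hDw_sqrt, hDw_div, hLw, hLw_div⟩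
  have hV0 : ∀ᵐ x ∂μ, 0 ≤ SubLap.potential w Dw Lw x + m := by
    filter_upwards [hV] with x hx
    linarith
  choose γ hγ using fun j => SubLap.exists_isOneParam (S.X j)
  let T := (SubLap.mulSqrt hw).restrict (h.mulSqrt_mem hγ hm.le hV0)
  have hT : Function.Bijective T := by
    -- Injectivity holds because multiplication by √w is an isometry of L²(μ_w) into L²(μ);
    -- surjectivity is division by √w.
    refine ⟨(injective_iff_map_eq_zero T).2 fun f hf => Subtype.ext (norm_eq_zero.1 ?_),
      fun u => ?_⟩
    · rw [← SubLap.norm_mulSqrt hw]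
      exact norm_eq_zero.2 (congrArg Subtype.val hf)
    · obtain ⟨f, hf, e⟩ := h.exists_mulSqrt_eq hγ hm.le hV0 u u.2
      exact ⟨⟨f, hf⟩, Subtype.ext e⟩
  have hQ := fun f g : SubLap.weightedDom S hw => h.schrodingerForm_mulSqrt hγ hm.le hV0 f.2 g.2
  refine ⟨LinearEquiv.ofBijective T hT, fun f => SubLap.coeFn_mulSqrt hw f, fun f => ?_, hQ⟩
  -- The form norms agree because both ingredients do: the L² norms, and the forms on the diagonal.
  congr 2
  · exact congrArg (fun r => m * r ^ 2) (SubLap.norm_mulSqrt hw f)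
  · exact congrArg Complex.re (hQ f f)
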